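/- A relation $R\subseteq\{0,1\}^r$ is *mergeable* if for all (not necessarily distinct) tuples $\alpha,\beta,\gamma,\delta\in R$ with $\alpha\wedge\delta\le\beta\le\alpha$ and $\beta\wedge\gamma\le\delta\le\gamma$ (with $\wedge,\vee,\le$ taken componentwise) one has $\alpha\wedge(\beta\vee\gamma)\in R$. Let $\Gamma$ be a finite set of relations over $\{0,1\}$. A formula $\mathcal F$ over $\Gamma$ is a finite conjunction of constraints $R(x_1,\dots,x_r)$ with $R\in\Gamma$ and variables $x_1,\dots,x_r$ that may be repeated; $V(\mathcal F)$ is the set of variables that occur in $\mathcal F$, and the weight of an assignment to $V(\mathcal F)$ is the number of variables that it sets to true. An instance of Min Ones SAT$(\Gamma)$ is a pair $(\mathcal F,k)$ of a formula $\mathcal F$ over $\Gamma$ and a number $k\in\mathbb N$, which is the parameter; it is a yes-instance if $\mathcal F$ has a satisfying assignment of weight at most $k$. The size of $\mathcal F$ is the length of its encoding as a string over a fixed finite alphabet, in which names of variables are written in binary. **Theorem.** Let $\Gamma$ be a finite set of relations over $\{0,1\}$, all of which are mergeable, and let $d$ be the maximum arity of a relation in $\Gamma$ ($d=0$ if $\Gamma=\emptyset$).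 Then Min Ones SAT$(\Gamma)$, parameterized by $k$, admits a polynomial kernelization whose kernel has $O(k^{d+1})$ variables. That is, there is a map $K:(\mathcal F,k)\mapsto(\mathcal F',k')$ from instances to instances of Min Ones SAT$(\Gamma)$, computable by a Turing machine in time polynomial in the length of the encoding of $(\mathcal F,k)$ (with $k$ in binary), such that for some polynomial $p$ and some constant $C$ that depend only on $\Gamma$, and for all instances $(\mathcal F,k)$ with $(\mathcal F',k')=K(\mathcal F,k)$: 1. $(\mathcal F,k)$ is a yes-instance if and only if $(\mathcal F',k')$ is a yes-instance; 2. $k'\le p(k)$, and the size of $\mathcal F'$ is at most $p(k)$; 3. $|V(\mathcal F')|\le C\,(k+1)^{d+1}$. -/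

import Mathlib

namespace MinOnes

/-- A relation over the Boolean domain: an arity together with a set of Boolean tuples of
that length.  Tuples are ordered and combined componentwise (`false ≤ true`, `⊓` is "and",
`⊔` is "or"). -/
structure BoolRel where
  arity : ℕ
  tuples : Set (Fin arity → Bool)

/-- The merge operation applies to `(α, β, γ, δ)`. -/
def MergeApplies {r : ℕ} (α β γ δ : Fin r → Bool) : Prop :=
  (α ⊓ δ ≤ β ∧ β ≤ α) ∧ (β ⊓ γ ≤ δ ∧ δ ≤ γ)

/-- `R` is mergeable: whenever the merge operation applies to four (not necessarily distinct)
tuples of `R`, the tuple `α ∧ (β ∨ γ)` that it produces is again in `R`. -/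
def BoolRel.Mergeable (R : BoolRel) : Prop :=
  ∀ α ∈ R.tuples, ∀ β ∈ R.tuples, ∀ γ ∈ R.tuples, ∀ δ ∈ R.tuples,
    MergeApplies α β γ δ → α ⊓ (β ⊔ γ) ∈ R.tuples

/-- The maximum arity of a relation in the finite constraint language `Γ`. -/
def maxArity (Γ : Finset BoolRel) : ℕ := Γ.sup BoolRel.arity

/-- A constraint over `Γ`: a relation of `Γ` applied to a tuple of variables, possibly with
repetitions.  Variables are natural numbers. -/
structure Constraint (Γ : Finset BoolRel) where
  rel : {R : BoolRel // R ∈ Γ}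
  args : Fin rel.1.arity → ℕ

/-- A formula over `Γ`: a finite conjunction of constraints. -/
abbrev Formula (Γ : Finset BoolRel) : Type := List (Constraint Γ)

/-- `V(F)`, the set of variables that occur in `F`. -/
def Formula.vars {Γ : Finset BoolRel} (F : Formula Γ) : Finset ℕ :=
  (F.flatMap fun c => List.ofFn c.args).toFinset

/-- The assignment `a` satisfies every constraint of `F`. -/
def Formula.Satisfies {Γ : Finset BoolRel} (F : Formula Γ) (a : ℕ → Bool) : Prop :=
  ∀ c ∈ F, (fun i => a (c.args i)) ∈ c.rel.1.tuples

/-- The weight of an assignment: the number of variables of `F` that it sets to true. -/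
def Formula.weight {Γ : Finset BoolRel} (F : Formula Γ) (a : ℕ → Bool) : ℕ :=
  (F.vars.filter fun x => a x = true).card

/-- Min Ones SAT(Γ): the instances `(F, k)`, with parameter `k`, such that `F` has a satisfying
assignment of weight at most `k`. -/
def MinOnesSAT (Γ : Finset BoolRel) : Set (Formula Γ × ℕ) :=
  {x | ∃ a : ℕ → Bool, x.1.Satisfies a ∧ x.1.weight a ≤ x.2}

/-! ### Formulas as strings

A constraint is written as one letter for its relation followed by the names of its variables,
each written in binary and closed by a separator; a formula is the concatenation of its
constraints. -/

/-- The finite alphabet in which formulas over `Γ` are written. -/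
inductive Letter (Γ : Finset BoolRel) : Type
  | rel (R : {R : BoolRel // R ∈ Γ})
  | bit (b : Bool)
  | sep

/-- A variable in binary, closed by a separator. -/
def encodeVar (Γ : Finset BoolRel) (n : ℕ) : List (Letter Γ) :=
  (Computability.encodeNat n).map Letter.bit ++ [Letter.sep]

def encodeConstraint {Γ : Finset BoolRel} (c : Constraint Γ) : List (Letter Γ) :=
  Letter.rel c.rel :: (List.ofFn c.args).flatMap (encodeVar Γ)

def encodeFormula {Γ : Finset BoolRel} (F : Formula Γ) : List (Letter Γ) :=
  F.flatMap encodeConstraint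

theorem encodeVar_append_inj {Γ : Finset BoolRel} {m n : ℕ} {s t : List (Letter Γ)}
    (h : encodeVar Γ m ++ s = encodeVar Γ n ++ t) : m = n ∧ s = t := by
  have key : ∀ (u v : List Bool),
      u.map (Letter.bit (Γ := Γ)) ++ Letter.sep :: s = v.map Letter.bit ++ Letter.sep :: t →
        u = v ∧ s = t := by
    intro u
    induction u with
    | nil => intro v hv; cases v <;> simp_all
    | cons b u ih =>
      intro v hv
      cases v with
      | nil => simp at hv
      | cons b' v =>
        simp only [List.map_cons, List.cons_append, List.cons.injEq, Letter.bit.injEq] at hv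
        obtain ⟨h1, h2⟩ := ih v hv.2
        exact ⟨by rw [hv.1, h1], h2⟩
  obtain ⟨h1, h2⟩ := key _ _ (by simpa [encodeVar] using h)
  exact ⟨Computability.encodingNatBool.encode_injective h1, h2⟩

theorem flatMap_encodeVar_append_inj {Γ : Finset BoolRel} {s t : List (Letter Γ)} :
    ∀ {u v : List ℕ}, u.length = v.length →
      u.flatMap (encodeVar Γ) ++ s = v.flatMap (encodeVar Γ) ++ t → u = v ∧ s = t
  | [], [], _, h => ⟨rfl, by simpa using h⟩
  | m :: u, n :: v, hl, h => by
    simp only [List.flatMap_cons, List.append_assoc] at h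
    obtain ⟨h1, h2⟩ := encodeVar_append_inj h
    obtain ⟨h3, h4⟩ := flatMap_encodeVar_append_inj (by simpa using hl) h2
    exact ⟨by rw [h1, h3], h4⟩

theorem encodeFormula_injective (Γ : Finset BoolRel) :
    Function.Injective (encodeFormula (Γ := Γ)) := by
  intro F
  induction F with
  | nil =>
    intro G h
    cases G with
    | nil => rfl
    | cons c G => simp [encodeFormula, encodeConstraint] at h
  | cons c F ih =>
    intro G h
    cases G with
    | nil => simp [encodeFormula, encodeConstraint] at h
    | cons c' G =>
      obtain ⟨R, x⟩ := c
      obtain ⟨R', x'⟩ := c'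
      simp only [encodeFormula, encodeConstraint, List.flatMap_cons, List.cons_append,
        List.cons.injEq, Letter.rel.injEq] at h
      obtain ⟨rfl, h⟩ := h
      obtain ⟨h1, h2⟩ := flatMap_encodeVar_append_inj (by simp) h
      rw [List.ofFn_injective h1, ih h2]

/-- Formulas over `Γ`, written as strings over the finite alphabet `Letter Γ`; the length of the
string is the size of the formula. -/
noncomputable def formulaEncoding (Γ : Finset BoolRel) :
    Computability.Encoding (Formula Γ) (Letter Γ) where
  encode := encodeFormula
  decode := Function.partialInv encodeFormula
  decode_encode F := Function.partialInv_left (encodeFormula_injective Γ) F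

/-- `K` is a polynomial kernelization for the parameterized problem `Q`, whose instances are pairs
`(I, k)`: some Turing machine computes `K` in time polynomial in the length of the
input `(I, k)`, where `I` is written as a string by `enc` and `k` in binary; `(I, k)` and
`(I', k') = K (I, k)` are equivalent; and both `k'` and the size of `I'` are bounded by a
polynomial in `k`. -/
structure IsPolynomialKernelization {I A : Type} (enc : Computability.Encoding I A)
    (Q : Set (I × ℕ)) (K : I × ℕ → I × ℕ) : Prop where
  polyTime : Nonempty (Turing.TM2ComputableInPolyTime
    (Computability.encodingProd enc Computability.encodingNatBool).encode
    (Computability.encodingProd enc Computability.encodingNatBool).encode K)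
  equivalent : ∀ x : I × ℕ, x ∈ Q ↔ K x ∈ Q
  bounded : ∃ p : Polynomial ℕ, ∀ x : I × ℕ,
    (K x).2 ≤ p.eval x.2 ∧ (enc.encode (K x).1).length ≤ p.eval x.2

end MinOnes

/-! Call a satisfying assignment light if it makes at most `k` variables true.

Forced partial constraints. A partial constraint is a constraint in which some positions hold the
constant zero. Suppose that more than `k` partial constraints hold under every light solution, all
extend the same `t`, and their additional variables (petals) are pairwise disjoint. A light solution
cannot have a true variable in every petal, so some petal vanishes and `t` holds as well. Iterating
this sunflower rule over the number of zero positions gives `forced`, which is sound by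
`forced_holds`. The minimal forced partial constraints are few: if `(R, v)` is not forced, a maximal
packing of petals over `v` has at most `k` members, so its variables, at most `k` times the arity
many, hit the petal of every minimal extension of `v`. Branching on the hit position and the hitting
variable leaves `O(k ^ d)` minimal ones (`minimal_extends_cases`, `card_minimal_le`).

Mergeability. Each constraint `R(x)` extends a minimal one; let `D` be the positions kept there.
Every light solution gives a tuple `α` with `α` and `α ⊓ D` in `R`. By
`BoolRel.Mergeable.restrict_mem`, such a tuple may be zeroed outside any `P ≥ D` that is closed
under those implications between positions, starting outside `D`, that hold for all tuples of this
kind. The implications become arcs between variables, along which truth propagates in every light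
solution. A variable that reaches more than `k` variables is therefore false. The union of the
reachable sets of the other variables in minimal constraints is `support`, of size `O(k ^ (d + 1))`.
Zeroing everything outside it preserves light solutions (`satisfies_support`).

Zeros. The language need not express the constant zero. Instead there are `k + 1` fresh zero
variables and one copy of each constraint for each of them; an assignment of weight at most `k`
leaves one of them false, and the corresponding copy is the intended formula (`solvable_of_kernel`).
Removing duplicate constraints bounds the size.

Running time. Functions on binary trees are shown to be computed by structured stack programs in
polynomial time (`FP`), closed under composition, case distinction and folds whose state grows
slowly; the programs compile to Turing machines. As `k` is given in binary, a formula of length at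
most `k` is returned unchanged, and otherwise `k` is small enough to be handled in unary. -/

/-! ### Structured programs on finitely many stacks -/

namespace StackProg

open Turing

/-- Structured programs that act on stacks indexed by `K`, where stack `k` holds symbols
from `S k`. -/
inductive Cmd {K : Type} (S : K → Type) : Type
  | skip : Cmd S
  | push (k : K) (a : S k) : Cmd S
  | seq (c d : Cmd S) : Cmd S
  | pop (k : K) (f : Option (S k) → Cmd S) : Cmd S
  | loop (k : K) (p : Option (S k) → Bool) (f : Option (S k) → Cmd S) : Cmd S

section Semantics

variable {K : Type} [DecidableEq K] {S : K → Type}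

/-- `Run c s s' t`: the program `c` turns the stacks `s` into `s'` in exactly `t` steps. -/
inductive Run : Cmd S → (∀ k, List (S k)) → (∀ k, List (S k)) → ℕ → Prop
  | skip (s) : Run .skip s s 1
  | push (k a s) : Run (.push k a) s (Function.update s k (a :: s k)) 1
  | seq {c d s s' s'' t t'} : Run c s s' t → Run d s' s'' t' → Run (.seq c d) s s'' (t + t')
  | pop {k f s s' t} : Run (f (s k).head?) (Function.update s k (s k).tail) s' t →
      Run (.pop k f) s s' (t + 1)
  | loop_exit {k p f s} : p (s k).head? = false →
      Run (.loop k p f) s (Function.update s k (s k).tail) 1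
  | loop_step {k p f s s' s'' t t'} : p (s k).head? = true →
      Run (f (s k).head?) (Function.update s k (s k).tail) s' t →
      Run (.loop k p f) s' s'' t' → Run (.loop k p f) s s'' (t + t' + 1)

/-- `Exec c s s' T`: the program `c` turns the stacks `s` into `s'` in at most `T` steps. -/
def Exec (c : Cmd S) (s s' : ∀ k, List (S k)) (T : ℕ) : Prop := ∃ t ≤ T, Run c s s' t

theorem Exec.mono {c : Cmd S} {s s' T T'} (h : Exec c s s' T) (hT : T ≤ T') : Exec c s s' T' := by
  obtain ⟨t, ht, hr⟩ := h
  exact ⟨t, ht.trans hT, hr⟩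

theorem Exec.skip {s : ∀ k, List (S k)} : Exec .skip s s 1 := ⟨1, le_rfl, .skip s⟩

theorem Exec.push {k : K} {a : S k} {s s' : ∀ k, List (S k)}
    (h : Function.update s k (a :: s k) = s') : Exec (.push k a) s s' 1 :=
  ⟨1, le_rfl, h ▸ .push k a s⟩

theorem Exec.seq {c d : Cmd S} {s s' s'' T T'} (h : Exec c s s' T) (h' : Exec d s' s'' T') :
    Exec (.seq c d) s s'' (T + T') := by
  obtain ⟨t, ht, hr⟩ := h
  obtain ⟨t', ht', hr'⟩ := h'
  exact ⟨t + t', by omega, hr.seq hr'⟩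

theorem Exec.pop {k : K} {f : Option (S k) → Cmd S} {o : Option (S k)}
    {s s₁ s' : ∀ k, List (S k)} {T : ℕ} (ho : (s k).head? = o)
    (h₁ : Function.update s k (s k).tail = s₁) (h : Exec (f o) s₁ s' T) :
    Exec (.pop k f) s s' (T + 1) := by
  obtain ⟨t, ht, hr⟩ := h
  subst ho h₁
  exact ⟨t + 1, by omega, .pop hr⟩

theorem Exec.loop_exit {k : K} {p : Option (S k) → Bool} {f : Option (S k) → Cmd S}
    {s s' : ∀ k, List (S k)} (hp : p (s k).head? = false)
    (h : Function.update s k (s k).tail = s') : Exec (.loop k p f) s s' 1 :=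
  ⟨1, le_rfl, h ▸ .loop_exit hp⟩

theorem Exec.loop_step {k : K} {p : Option (S k) → Bool} {f : Option (S k) → Cmd S}
    {o : Option (S k)} {s s₁ s' s'' : ∀ k, List (S k)} {T T' : ℕ} (ho : (s k).head? = o)
    (hp : p o = true) (h₁ : Function.update s k (s k).tail = s₁) (h : Exec (f o) s₁ s' T)
    (h' : Exec (.loop k p f) s' s'' T') : Exec (.loop k p f) s s'' (T + T' + 1) := by
  obtain ⟨t, ht, hr⟩ := h
  obtain ⟨t', ht', hr'⟩ := h'
  subst ho h₁
  exact ⟨t + t' + 1, by omega, .loop_step hp hr hr'⟩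

/-! ### Compilation to Turing machines -/

/-- The labels of the machine that runs a program. -/
def Cmd.Lab : Cmd S → Type
  | .skip => Unit
  | .push _ _ => Unit
  | .seq c d => c.Lab ⊕ d.Lab
  | .pop _ f => Option (Σ o, (f o).Lab)
  | .loop _ _ f => Option (Σ o, (f o).Lab)

/-- The label at which the run of a program starts. -/
def Cmd.entry : (c : Cmd S) → c.Lab
  | .skip => ()
  | .push _ _ => ()
  | .seq c _ => Sum.inl c.entry
  | .pop _ _ => none
  | .loop _ _ _ => none

/-- The statements of the machine that runs a program, whose labels are embedded by `emb` and
which ends by jumping to `exit`.  The local variables hold the last symbol read from each stack. -/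
def Cmd.compile {Λ : Type} : (c : Cmd S) → (c.Lab → Λ) → Λ → c.Lab →
    TM2.Stmt S Λ (∀ k, Option (S k))
  | .skip, _, exit, _ => .goto fun _ => exit
  | .push k a, _, exit, _ => .push k (fun _ => a) (.goto fun _ => exit)
  | .seq c d, emb, _, .inl l => c.compile (fun l => emb (.inl l)) (emb (.inr d.entry)) l
  | .seq _ d, emb, exit, .inr l => d.compile (fun l => emb (.inr l)) exit l
  | .pop k f, emb, _, none =>
      .pop k (fun v o => Function.update v k o) (.goto fun v => emb (some ⟨v k, (f (v k)).entry⟩))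
  | .pop _ f, emb, exit, some ⟨o, l⟩ => (f o).compile (fun l => emb (some ⟨o, l⟩)) exit l
  | .loop k p f, emb, exit, none =>
      .pop k (fun v o => Function.update v k o)
        (.goto fun v => if p (v k) then emb (some ⟨v k, (f (v k)).entry⟩) else exit)
  | .loop _ _ f, emb, _, some ⟨o, l⟩ =>
      (f o).compile (fun l => emb (some ⟨o, l⟩)) (emb none) l

/-- Each compiled statement is at most one stack operation followed by a jump, so one unit of `Run`
is one machine step; a branch is a jump that depends on the symbol just stored. The machine, the
embedding and the exit are arbitrary because subprograms run inside a larger machine. -/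
theorem Run.compile {c : Cmd S} {s s' : ∀ k, List (S k)} {t : ℕ} (h : Run c s s' t) :
    ∀ {Λ : Type} (M : Λ → TM2.Stmt S Λ (∀ k, Option (S k))) (emb : c.Lab → Λ) (exit : Λ),
      (∀ l, M (emb l) = c.compile emb exit l) → ∀ v, ∃ v',
        (flip bind (TM2.step M))^[t] (some ⟨some (emb c.entry), v, s⟩) =
          some ⟨some exit, v', s'⟩ := by
  induction h with
  | skip s =>
    intro Λ M emb exit hM v
    refine ⟨v, ?_⟩
    simp [flip, hM, Cmd.compile]
  | push k a s =>
    intro Λ M emb exit hM v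
    refine ⟨v, ?_⟩
    simp [flip, hM, Cmd.compile]
  | @seq c d s s' s'' t t' _ _ ih ih' =>
    intro Λ M emb exit hM v
    obtain ⟨v', hv'⟩ := ih M (fun l => emb (.inl l)) (emb (.inr d.entry))
      (fun l => hM (.inl l)) v
    obtain ⟨v'', hv''⟩ := ih' M (fun l => emb (.inr l)) exit (fun l => hM (.inr l)) v'
    refine ⟨v'', ?_⟩
    rw [add_comm, Function.iterate_add_apply]
    exact (congrArg _ hv').trans hv''
  | @pop k f s s' t _ ih =>
    intro Λ M emb exit hM v
    obtain ⟨v', hv'⟩ := ih M (fun l => emb (some ⟨_, l⟩)) exit (fun l => hM (some ⟨_, l⟩))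
      (Function.update v k (s k).head?)
    refine ⟨v', ?_⟩
    rw [Function.iterate_add_apply]
    refine (congrArg _ ?_).trans hv'
    have := hM none
    simp [flip, Cmd.entry, this, Cmd.compile]
    rw [Function.update_self]
  | @loop_exit k p f s hp =>
    intro Λ M emb exit hM v
    refine ⟨Function.update v k (s k).head?, ?_⟩
    have := hM none
    simp [flip, Cmd.entry, this, Cmd.compile, hp]
  | @loop_step k p f s s' s'' t t' hp _ _ ih ih' =>
    intro Λ M emb exit hM v
    obtain ⟨v', hv'⟩ := ih M (fun l => emb (some ⟨_, l⟩)) (emb none)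
      (fun l => hM (some ⟨_, l⟩)) (Function.update v k (s k).head?)
    obtain ⟨v'', hv''⟩ := ih' M emb exit hM v'
    refine ⟨v'', ?_⟩
    rw [show t + t' + 1 = t' + (t + 1) by ring, Function.iterate_add_apply]
    refine (congrArg _ ?_).trans hv''
    rw [Function.iterate_add_apply]
    refine (congrArg _ ?_).trans hv'
    have := hM none
    simp [flip, Cmd.entry, this, Cmd.compile, hp]
    rw [Function.update_self]

end Semantics

theorem Cmd.finite_lab {K : Type} {S : K → Type} [∀ k, Finite (S k)] : (c : Cmd S) → Finite c.Lab
  | .skip => inferInstanceAs (Finite Unit)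
  | .push _ _ => inferInstanceAs (Finite Unit)
  | .seq c d => by
    have := c.finite_lab
    have := d.finite_lab
    exact inferInstanceAs (Finite (c.Lab ⊕ d.Lab))
  | .pop _ f => by
    have := fun o => (f o).finite_lab
    exact inferInstanceAs (Finite (Option (Σ o, (f o).Lab)))
  | .loop _ _ f => by
    have := fun o => (f o).finite_lab
    exact inferInstanceAs (Finite (Option (Σ o, (f o).Lab)))

/-! ### The stacks of the programs below -/

/-- Names of stacks: one for input and output, one for data, and three auxiliary ones. -/
inductive Stk : Type
  | io | main | a | b | n
  deriving DecidableEq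

instance : Fintype Stk := ⟨{.io, .main, .a, .b, .n}, fun k => by cases k <;> simp⟩

/-- The alphabets of the stacks, where input and output are strings over `A`. -/
@[reducible] def Sym (A : Type) : Stk → Type
  | .io => A
  | .main => Bool
  | .a => Bool
  | .b => Bool
  | .n => Bool

/-- The stacks with the given contents. -/
def st {A : Type} (i : List A) (m a b n : List Bool) : ∀ k, List (Sym A k)
  | .io => i
  | .main => m
  | .a => a
  | .b => b
  | .n => n

section St

variable {A : Type} (i i' : List A) (m a b n x : List Bool)

@[simp] theorem st_io : st i m a b n .io = i := rfl
@[simp] theorem st_main : st i m a b n .main = m := rfl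
@[simp] theorem st_a : st i m a b n .a = a := rfl
@[simp] theorem st_b : st i m a b n .b = b := rfl
@[simp] theorem st_n : st i m a b n .n = n := rfl

@[simp] theorem update_st_io : Function.update (st i m a b n) .io i' = st i' m a b n := by
  funext k; cases k <;> rfl
@[simp] theorem update_st_main : Function.update (st i m a b n) .main x = st i x a b n := by
  funext k; cases k <;> rfl
@[simp] theorem update_st_a : Function.update (st i m a b n) .a x = st i m x b n := by
  funext k; cases k <;> rfl
@[simp] theorem update_st_b : Function.update (st i m a b n) .b x = st i m a x n := by
  funext k; cases k <;> rfl
@[simp] theorem update_st_n : Function.update (st i m a b n) .n x = st i m a b x := by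
  funext k; cases k <;> rfl

end St

noncomputable instance {A : Type} [Fintype A] (k : Stk) : Fintype (Sym A k) := by
  cases k <;> simp only [Sym] <;> infer_instance

/-- The Turing machine that runs a program. -/
noncomputable def machine {A : Type} [Fintype A] (c : Cmd (Sym A)) : FinTM2 where
  K := Stk
  k₀ := .io
  k₁ := .io
  Γ := Sym A
  Λ := Option c.Lab
  main := some c.entry
  ΛFin := by
    have := c.finite_lab
    exact Fintype.ofFinite _
  σ := ∀ k, Option (Sym A k)
  initialState := fun _ => none
  m
    | some l => c.compile some none l
    -- The required halting configuration has the initial local state, so the last step erases the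
    -- variables. This is the one step added to the time bound.
    | none => .load (fun _ _ => none) .halt

/-- A program that rewrites its input as required, in polynomial time, gives rise to a
polynomial-time Turing machine. -/
theorem polyTime_of_exec {A α β : Type} [Fintype A] {ea : α → List A} {eb : β → List A}
    {f : α → β} (c : Cmd (Sym A)) (p : Polynomial ℕ)
    (h : ∀ x, Exec c (st (ea x) [] [] [] []) (st (eb (f x)) [] [] [] []) (p.eval (ea x).length)) :
    Nonempty (TM2ComputableInPolyTime ea eb f) := by
  choose t ht hrun using h
  refine ⟨⟨⟨machine c, Equiv.refl _, Equiv.refl _⟩, p + 1, fun x => ⟨⟨t x + 1, ?_⟩, ?_⟩⟩⟩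
  · obtain ⟨v', hv'⟩ := (hrun x).compile (machine c).m some none (fun l => rfl) fun _ => none
    have h1 : initList (machine c) (List.map (Equiv.refl _).invFun (ea x)) =
        ⟨some (some c.entry), fun _ => none, st (ea x) [] [] [] []⟩ := by
      refine congrArg (TM2.Cfg.mk _ _) ?_
      funext k
      cases k
      · exact (dif_pos rfl).trans (by simp; rfl)
      all_goals rfl
    have h2 : haltList (machine c) (List.map (Equiv.refl _).invFun (eb (f x))) =
        ⟨none, fun _ => none, st (eb (f x)) [] [] [] []⟩ := by
      refine congrArg (TM2.Cfg.mk _ _) ?_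
      funext k
      cases k
      · exact (dif_pos rfl).trans (by simp; rfl)
      all_goals rfl
    rw [Nat.add_comm, Function.iterate_add_apply]
    refine (congrArg _ ((congrArg _ (congrArg some h1)).trans hv')).trans ?_
    simp only [Option.map_some]
    refine Eq.trans ?_ (congrArg some h2.symm)
    rfl
  · simpa using ht x

end StackProg

/-! ### Data as binary trees -/

namespace StackProg

/-- Binary trees, the universal data type. -/
inductive Data : Type
  | leaf
  | node (l r : Data)

/-- The prefix code of a binary tree. -/
def Data.code : Data → List Bool
  | .leaf => [false]
  | .node l r => true :: (l.code ++ r.code)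

/-- The length of the prefix code. -/
def Data.size (d : Data) : ℕ := d.code.length

@[simp] theorem Data.size_leaf : Data.leaf.size = 1 := rfl

@[simp] theorem Data.size_node (l r : Data) : (Data.node l r).size = l.size + r.size + 1 := by
  simp [Data.size, Data.code]

/-- The code is prefix-free, so trees can be stacked without separators. -/
theorem Data.code_append_inj {d e : Data} {s t : List Bool} (h : d.code ++ s = e.code ++ t) :
    d = e ∧ s = t := by
  induction d generalizing e s t with
  | leaf => cases e <;> simp_all [Data.code]
  | node l r ihl ihr =>
    cases e with
    | leaf => simp [Data.code] at h
    | node l' r' =>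
      simp only [Data.code, List.cons_append, List.append_assoc, List.cons.injEq, true_and] at h
      obtain ⟨h1, h2⟩ := ihl h
      obtain ⟨h3, h4⟩ := ihr h2
      exact ⟨by rw [h1, h3], h4⟩

theorem Data.code_injective : Function.Injective Data.code := fun d e h =>
  (Data.code_append_inj (s := []) (t := []) (by simpa using h)).1

/-! ### Basic operations on the data stack -/

section Primitives

variable {A : Type}

/-- Process the first symbol of the tree on top of the data stack. -/
def takeSymbol (dst : Bool → Cmd (Sym A)) : Option Bool → Cmd (Sym A)
  -- The loop has already removed one pending tree; a node replaces it by its two subtrees, a leaf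
  -- by nothing.
  | some true => .seq (dst true) (.seq (.push .n true) (.push .n true))
  | _ => dst false

/-- Remove the tree on top of the data stack, and run `dst` on every symbol of its code.  The
length of stack `n` is the number of trees that remain to be read. -/
def takeTree (dst : Bool → Cmd (Sym A)) : Cmd (Sym A) :=
  .seq (.push .n true) <| .loop .n Option.isSome fun _ => .pop .main (takeSymbol dst)

/-- The loop does not stop between two subtrees, so the induction on the tree carries an arbitrary
continuation of the loop. The function `f` gives stacks `a` and `b` in terms of the reversed word
read so far. A symbol costs at most 7 steps: loop test, pop, 3 for `dst`, two pushes. -/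
theorem exec_takeTree_loop {dst : Bool → Cmd (Sym A)} {f : List Bool → List Bool × List Bool}
    {i : List A}
    (hdst : ∀ b w m n, Exec (dst b) (st i m (f w).1 (f w).2 n)
      (st i m (f (b :: w)).1 (f (b :: w)).2 n) 3) (d : Data) :
    ∀ (w rest n : List Bool) (s : ∀ k, List (Sym A k)) (T : ℕ),
    Exec (.loop .n Option.isSome fun _ => .pop .main (takeSymbol dst))
      (st i rest (f (d.code.reverse ++ w)).1 (f (d.code.reverse ++ w)).2 n) s T →
    Exec (.loop .n Option.isSome fun _ => .pop .main (takeSymbol dst))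
      (st i (d.code ++ rest) (f w).1 (f w).2 (true :: n)) s (7 * d.size + T) := by
  induction d with
  | leaf =>
    intro w rest n s T h
    refine (Exec.loop_step rfl rfl rfl ?_ h).mono (T := 4 + T + 1)
      (by simp only [Data.size_leaf]; omega)
    simp only [Data.code, List.cons_append, List.nil_append, st_n, List.tail_cons, update_st_n]
    exact Exec.pop rfl (update_st_main ..) (hdst _ _ _ _)
  | node l r ihl ihr =>
    intro w rest n s T h
    refine (Exec.loop_step rfl rfl rfl (s' := st i (l.code ++ (r.code ++ rest)) (f (true :: w)).1
      (f (true :: w)).2 (true :: true :: n)) (T := 3 + (1 + 1) + 1) ?_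
      (ihl _ _ _ _ _ (ihr _ _ _ _ T ?_))).mono ?_
    · simp only [Data.code, List.cons_append, st_n, List.tail_cons, update_st_n]
      refine Exec.pop rfl (update_st_main ..) (Exec.seq (hdst _ _ _ _) (Exec.seq
        (Exec.push (update_st_n ..)) (Exec.push ?_)))
      simp
    · simpa [Data.code] using h
    · simp only [Data.size_node]; omega

theorem exec_takeTree {dst : Bool → Cmd (Sym A)} {f : List Bool → List Bool × List Bool}
    {i : List A}
    (hdst : ∀ b w m n, Exec (dst b) (st i m (f w).1 (f w).2 n)
      (st i m (f (b :: w)).1 (f (b :: w)).2 n) 3) (d : Data) (w rest : List Bool) :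
    Exec (takeTree dst) (st i (d.code ++ rest) (f w).1 (f w).2 [])
      (st i rest (f (d.code.reverse ++ w)).1 (f (d.code.reverse ++ w)).2 []) (7 * d.size + 2) := by
  refine (Exec.seq (Exec.push (update_st_n ..)) (exec_takeTree_loop hdst d w rest [] _ 1
    (Exec.loop_exit rfl ?_))).mono (by omega)
  simp

/-- Remove the tree on top of the data stack. -/
def dropTree : Cmd (Sym A) := takeTree fun _ => .skip

theorem exec_dropTree (d : Data) (i : List A) (m a b : List Bool) :
    Exec dropTree (st i (d.code ++ m) a b []) (st i m a b []) (7 * d.size + 2) :=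
  exec_takeTree (f := fun _ => (a, b)) (fun _ _ _ _ => Exec.mono Exec.skip (by omega)) d [] m

/-- Move the tree on top of the data stack, reversed, to stack `a`. -/
def treeToA : Cmd (Sym A) := takeTree fun x => .push .a x

theorem exec_treeToA (d : Data) (i : List A) (m a b : List Bool) :
    Exec treeToA (st i (d.code ++ m) a b []) (st i m (d.code.reverse ++ a) b [])
      (7 * d.size + 2) :=
  exec_takeTree (f := fun w => (w, b))
    (fun _ _ _ _ => Exec.mono (Exec.push (update_st_a ..)) (by omega))
    d a m

/-- Move the tree on top of the data stack, reversed, to stack `b`. -/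
def treeToB : Cmd (Sym A) := takeTree fun x => .push .b x

theorem exec_treeToB (d : Data) (i : List A) (m a b : List Bool) :
    Exec treeToB (st i (d.code ++ m) a b []) (st i m a (d.code.reverse ++ b) [])
      (7 * d.size + 2) :=
  exec_takeTree (f := fun w => (a, w))
    (fun _ _ _ _ => Exec.mono (Exec.push (update_st_b ..)) (by omega))
    d b m

/-- Move the tree on top of the data stack, reversed, to both stacks `a` and `b`. -/
def treeToAB : Cmd (Sym A) := takeTree fun x => .seq (.push .a x) (.push .b x)

theorem exec_treeToAB (d : Data) (i : List A) (m : List Bool) :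
    Exec treeToAB (st i (d.code ++ m) [] [] []) (st i m d.code.reverse d.code.reverse [])
      (7 * d.size + 2) := by
  have h := exec_takeTree (f := fun w => (w, w)) (i := i) (fun x w m n => Exec.mono (Exec.seq
    (Exec.push (update_st_a i m w w n (x :: w))) (Exec.push (update_st_b ..))) (by omega)) d [] m
  simp only [List.append_nil] at h
  exact h

/-- Move the content of stack `a` to the data stack, in reverse order. -/
def pourA : Cmd (Sym A) := .loop .a Option.isSome fun
  | some x => .push .main x
  | none => .skip

theorem exec_pourA (i : List A) (a : List Bool) : ∀ m b n : List Bool,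
    Exec pourA (st i m a b n) (st i (a.reverse ++ m) [] b n) (2 * a.length + 1) := by
  induction a with
  | nil => exact fun m b n => Exec.loop_exit rfl (update_st_a ..)
  | cons x a ih =>
    intro m b n
    refine Exec.mono (Exec.loop_step (o := some x) rfl rfl (update_st_a ..)
      (Exec.push (update_st_main ..)) (T' := 2 * a.length + 1) ?_) ?_
    · have h := ih (x :: m) b n
      simp only [List.reverse_cons, List.append_assoc, List.singleton_append]
      exact h
    · simp only [List.length_cons]; omega

/-- Move the content of stack `b` to the data stack, in reverse order. -/
def pourB : Cmd (Sym A) := .loop .b Option.isSome fun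
  | some x => .push .main x
  | none => .skip

theorem exec_pourB (i : List A) (b : List Bool) : ∀ m a n : List Bool,
    Exec pourB (st i m a b n) (st i (b.reverse ++ m) a [] n) (2 * b.length + 1) := by
  induction b with
  | nil => exact fun m a n => Exec.loop_exit rfl (update_st_b ..)
  | cons x a ih =>
    intro m b n
    refine Exec.mono (Exec.loop_step (o := some x) rfl rfl (update_st_b ..)
      (Exec.push (update_st_main ..)) (T' := 2 * a.length + 1) ?_) ?_
    · have h := ih (x :: m) b n
      simp only [List.reverse_cons, List.append_assoc, List.singleton_append]
      exact h
    · simp only [List.length_cons]; omega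

/-- Duplicate the tree on top of the data stack. -/
def dupTree : Cmd (Sym A) := .seq treeToAB (.seq pourA pourB)

theorem exec_dupTree (d : Data) (i : List A) (m : List Bool) :
    Exec dupTree (st i (d.code ++ m) [] [] []) (st i (d.code ++ (d.code ++ m)) [] [] [])
      (11 * d.size + 4) := by
  have h := (exec_treeToAB d i m).seq ((exec_pourA _ _ _ _ _).seq (exec_pourB _ _ _ _ _))
  simp only [List.length_reverse, List.reverse_reverse] at h
  exact h.mono (by simp only [Data.size]; omega)

/-- Exchange the two topmost trees of the data stack. -/
def swapTrees : Cmd (Sym A) := .seq treeToA (.seq treeToB (.seq pourA pourB))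

theorem exec_swapTrees (d e : Data) (i : List A) (m : List Bool) :
    Exec swapTrees (st i (d.code ++ (e.code ++ m)) [] [] [])
      (st i (e.code ++ (d.code ++ m)) [] [] []) (9 * d.size + 9 * e.size + 6) := by
  have h := (exec_treeToA d i (e.code ++ m) [] []).seq ((exec_treeToB e _ _ _ _).seq
    ((exec_pourA _ _ _ _ _).seq (exec_pourB _ _ _ _ _)))
  simp only [List.append_nil, List.length_reverse, List.reverse_reverse] at h
  exact h.mono (by simp only [Data.size]; omega)

/-- Join the second and the third tree of the data stack to a single tree. -/
def joinUnder : Cmd (Sym A) := .seq treeToA (.seq (.push .main true) pourA)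

theorem exec_joinUnder (d e f : Data) (i : List A) (m : List Bool) :
    Exec joinUnder (st i (d.code ++ (e.code ++ (f.code ++ m))) [] [] [])
      (st i (d.code ++ ((Data.node e f).code ++ m)) [] [] []) (9 * d.size + 4) := by
  have h := (exec_treeToA d i (e.code ++ (f.code ++ m)) [] []).seq
    ((Exec.push (update_st_main _ _ _ _ _ (true :: _))).seq (exec_pourA _ _ _ _ _))
  simp only [List.append_nil, List.length_reverse, List.reverse_reverse] at h
  simp only [Data.code, List.cons_append, List.append_assoc]
  exact h.mono (by simp only [Data.size]; omega)

/-- Compare the stacks `a` and `b`, and record every difference on stack `n`. -/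
def compareAB : Cmd (Sym A) := .seq
  (.loop .a Option.isSome fun o => .pop .b fun o' => if o = o' then .skip else .push .n true)
  (.loop .b Option.isSome fun _ => .push .n true)

theorem exec_compareAB_rest (i : List A) (m : List Bool) (b : List Bool) : ∀ n : List Bool,
    Exec (.loop .b Option.isSome fun _ => .push .n true) (st i m [] b n)
      (st i m [] [] (List.replicate b.length true ++ n)) (2 * b.length + 1) := by
  induction b with
  | nil => exact fun n => Exec.loop_exit rfl (update_st_b ..)
  | cons x b ih =>
    intro n
    refine Exec.mono (Exec.loop_step (o := some x) rfl rfl (update_st_b ..)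
      (Exec.push (update_st_n ..)) (T' := 2 * b.length + 1) ?_) ?_
    · simpa [List.replicate_succ', List.append_assoc] using ih (true :: n)
    · simp only [List.length_cons]; omega

/-- A mismatch, including exhaustion of `b`, leaves a mark on `n`, and excess symbols of `b` stay
there. Hence the words agree exactly when both remainders are empty and `n` had no earlier marks. -/
theorem exec_compareAB_main (i : List A) (m : List Bool) (a : List Bool) : ∀ b n : List Bool,
    ∃ b' n', Exec (.loop .a Option.isSome fun o => .pop .b fun o' =>
        if o = o' then .skip else .push .n true) (st i m a b n) (st i m [] b' n')
        (3 * a.length + 1) ∧ b'.length ≤ b.length ∧ n'.length ≤ n.length + a.length ∧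
      (b' = [] ∧ n' = [] ↔ a = b ∧ n = []) := by
  induction a with
  | nil =>
    exact fun b n => ⟨b, n, Exec.loop_exit rfl (update_st_a ..), le_rfl, le_rfl, by tauto⟩
  | cons x a ih =>
    intro b n
    by_cases h : some x = b.head?
    · obtain ⟨b', n', h1, h2, h3, h4⟩ := ih b.tail n
      refine ⟨b', n', Exec.mono (Exec.loop_step (o := some x) rfl rfl (update_st_a ..)
        (Exec.pop rfl (update_st_b ..) (T := 1) ?_) h1) ?_, h2.trans (by simp),
          h3.trans (by simp), h4.trans ?_⟩
      · change Exec (if some x = b.head? then _ else _) _ _ _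
        rw [if_pos h]
        exact Exec.skip
      · simp only [List.length_cons]; omega
      · cases b <;> simp_all
    · obtain ⟨b', n', h1, h2, h3, h4⟩ := ih b.tail (true :: n)
      refine ⟨b', n', Exec.mono (Exec.loop_step (o := some x) rfl rfl (update_st_a ..)
        (Exec.pop rfl (update_st_b ..) (T := 1) ?_) h1) ?_, h2.trans (by simp),
          h3.trans (by simp; omega), h4.trans ?_⟩
      · change Exec (if some x = b.head? then _ else _) _ _ _
        rw [if_neg h]
        exact Exec.push (update_st_n ..)
      · simp only [List.length_cons]; omega
      · cases b <;> simp_all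

theorem exec_compareAB (i : List A) (m a b : List Bool) :
    ∃ n, Exec compareAB (st i m a b []) (st i m [] [] n) (3 * a.length + 2 * b.length + 2) ∧
      n.length ≤ a.length + b.length ∧ (n = [] ↔ a = b) := by
  obtain ⟨b', n', h1, h2, h3, h4⟩ := exec_compareAB_main i m a b []
  refine ⟨_, (h1.seq (exec_compareAB_rest i m b' n')).mono (by omega), ?_, ?_⟩
  · simp at h3 ⊢; omega
  · simp only [List.append_eq_nil_iff, List.replicate_eq_nil_iff, List.length_eq_zero_iff, h4,
      and_true]

/-- Empty stack `n`. -/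
def clearN : Cmd (Sym A) := .loop .n Option.isSome fun _ => .skip

theorem exec_clearN (i : List A) (m : List Bool) (n : List Bool) :
    Exec clearN (st i m [] [] n) (st i m [] [] []) (2 * n.length + 1) := by
  induction n with
  | nil => exact Exec.loop_exit rfl (update_st_n ..)
  | cons x n ih =>
    refine Exec.mono (Exec.loop_step (o := some x) rfl rfl (update_st_n ..) Exec.skip ih) ?_
    simp only [List.length_cons]; omega

/-- The tree for a truth value. -/
def Data.ofBool : Bool → Data
  | false => .leaf
  | true => .node .leaf .leaf

/-- Replace the two topmost trees of the data stack by the truth value of their equality. -/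
def eqTrees : Cmd (Sym A) :=
  .seq treeToA <| .seq treeToB <| .seq compareAB <| .pop .n fun
    -- The code of `Data.ofBool true` is pushed from its last symbol to its first.
    | none => .seq (.push .main false) (.seq (.push .main false) (.push .main true))
    | some _ => .seq (.push .main false) clearN

open Classical in
theorem exec_eqTrees (d e : Data) (i : List A) (m : List Bool) :
    Exec eqTrees (st i (d.code ++ (e.code ++ m)) [] [] [])
      (st i ((Data.ofBool (decide (d = e))).code ++ m) [] [] [])
      (12 * d.size + 12 * e.size + 12) := by
  obtain ⟨n, h1, h2, h3⟩ := exec_compareAB i m d.code.reverse e.code.reverse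
  have key : d = e ↔ n = [] := by
    rw [h3, List.reverse_inj, Data.code_injective.eq_iff]
  have hlen : n.length ≤ d.size + e.size := by simpa [Data.size] using h2
  have hA := exec_treeToA d i (e.code ++ m) [] []
  have hB := exec_treeToB e i m d.code.reverse []
  simp only [List.append_nil] at hA hB
  refine (hA.seq (hB.seq (h1.seq (T' := 2 * n.length + 4) ?_))).mono ?_
  · cases n with
    | nil =>
      rw [decide_eq_true (key.2 rfl)]
      exact Exec.mono (Exec.pop (o := none) rfl (update_st_n ..) (Exec.seq
        (Exec.push (update_st_main ..)) (Exec.seq (Exec.push (update_st_main ..))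
        (Exec.push (update_st_main ..))))) (by simp)
    | cons x n =>
      rw [decide_eq_false (by simp [key])]
      exact Exec.mono (Exec.pop (o := some x) rfl (update_st_n ..) (Exec.seq
        (Exec.push (update_st_main ..)) (exec_clearN _ _ _))) (by simp; omega)
  · simp only [List.length_reverse, Data.size] at hlen ⊢; omega

end Primitives

end StackProg

/-! ### Functions computable in polynomial time on encoded data -/

namespace StackProg

/-- A type whose elements are represented by binary trees. -/
class Enc (α : Type) where
  enc : α → Data
  enc_injective : Function.Injective enc

open Enc (enc enc_injective)

/-- The size of the tree that represents `a`. -/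
def size {α : Type} [Enc α] (a : α) : ℕ := (enc a).size

instance : Enc Unit := ⟨fun _ => .leaf, fun _ _ _ => rfl⟩

instance : Enc Bool := ⟨Data.ofBool, fun a b h => by cases a <;> cases b <;> simp_all [Data.ofBool]⟩

/-- The tree for a number in unary. -/
def Data.ofNat : ℕ → Data
  | 0 => .leaf
  | n + 1 => .node .leaf (Data.ofNat n)

instance : Enc ℕ := ⟨Data.ofNat, fun m => by
  induction m with
  | zero => intro n h; cases n <;> simp_all [Data.ofNat]
  | succ m ih =>
    intro n h
    cases n with
    | zero => simp [Data.ofNat] at h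
    | succ n => rw [ih (by simpa [Data.ofNat] using h)]⟩

section Instances

variable {α β : Type} [Enc α] [Enc β]

instance : Enc (α × β) := ⟨fun x => .node (enc x.1) (enc x.2), fun x y h => by
  simp only [Data.node.injEq] at h
  exact Prod.ext (enc_injective h.1) (enc_injective h.2)⟩

/-- The tree for a list. -/
def Data.ofList : List α → Data
  | [] => .leaf
  | a :: l => .node (enc a) (Data.ofList l)

instance : Enc (List α) := ⟨Data.ofList, fun l => by
  induction l with
  | nil => intro l' h; cases l' <;> simp_all [Data.ofList]
  | cons a l ih =>
    intro l' h
    cases l' with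
    | nil => simp [Data.ofList] at h
    | cons b l' =>
      simp only [Data.ofList, Data.node.injEq] at h
      rw [enc_injective h.1, ih h.2]⟩

/-- An option shares its tree with a list of at most one element, so passing between the two needs
no computation. -/
instance : Enc (Option α) := ⟨fun o => enc o.toList, fun x y h => by
  have := enc_injective h
  cases x <;> cases y <;> simp_all⟩

/-- The elements of a finite type are represented by their numbers in some enumeration. -/
@[reducible] noncomputable def Enc.ofFinite (τ : Type) [Finite τ] : Enc τ :=
  ⟨fun x => enc (Finite.equivFin τ x).val, fun x y h => by
    simpa [Fin.val_inj] using enc_injective h⟩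

theorem enc_prod (a : α) (b : β) : enc (a, b) = .node (enc a) (enc b) := rfl
theorem enc_nil : enc ([] : List α) = .leaf := rfl
theorem enc_cons (a : α) (l : List α) : enc (a :: l) = .node (enc a) (enc l) := rfl
theorem enc_zero : enc (0 : ℕ) = .leaf := rfl
theorem enc_succ (n : ℕ) : enc (n + 1) = .node .leaf (enc n) := rfl

@[simp] theorem size_prod (x : α × β) : size x = size x.1 + size x.2 + 1 := Data.size_node ..
@[simp] theorem size_nil : size ([] : List α) = 1 := rfl
@[simp] theorem size_cons (a : α) (l : List α) : size (a :: l) = size a + size l + 1 :=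
  Data.size_node ..
@[simp] theorem size_nat (n : ℕ) : size n = 2 * n + 1 := by
  induction n with
  | zero => rfl
  | succ n ih => rw [size, enc_succ, Data.size_node, ← size, ih, Data.size_leaf]; ring
theorem size_bool_le (b : Bool) : size b ≤ 3 := by
  cases b <;> simp [size, enc, Data.ofBool]

theorem size_append (l l' : List α) : size (l ++ l') + 1 = size l + size l' := by
  induction l with
  | nil => simp; ring
  | cons a l ih => simp only [List.cons_append, size_cons]; omega

theorem length_le_size (l : List α) : l.length ≤ size l := by
  induction l with
  | nil => simp
  | cons a l ih => simp only [List.length_cons, size_cons]; omega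

theorem size_le_of_sublist {l l' : List α} (h : l.Sublist l') : size l ≤ size l' := by
  induction h with
  | slnil => rfl
  | cons a _ ih => simp only [size_cons]; omega
  | cons_cons a _ ih => simp only [size_cons]; omega

end Instances

theorem eval_mono (p : Polynomial ℕ) {m n : ℕ} (h : m ≤ n) : p.eval m ≤ p.eval n := by
  rw [Polynomial.eval_eq_sum_range, Polynomial.eval_eq_sum_range]
  exact Finset.sum_le_sum fun i _ => Nat.mul_le_mul_left _ (Nat.pow_le_pow_left h i)

/-- `FP A f`: on encoded data, `f` is computed in polynomial time by a program that
works on top of the data stack.  (The alphabet `A` of the input stack is irrelevant.) -/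
def FP (A : Type) {α β : Type} [Enc α] [Enc β] (f : α → β) : Prop :=
  ∃ (c : Cmd (Sym A)) (p : Polynomial ℕ), ∀ a, size (f a) ≤ p.eval (size a) ∧
    ∀ m, Exec c (st [] ((enc a).code ++ m) [] [] []) (st [] ((enc (f a)).code ++ m) [] [] [])
      (p.eval (size a))

/-! ### Basic closure properties of polynomial-time computation on trees. -/

section FP

variable {A : Type} {α β γ σ τ : Type} [Enc α] [Enc β] [Enc γ] [Enc σ] [Enc τ]

theorem FP.size_le {f : α → β} (hf : FP A f) :
    ∃ p : Polynomial ℕ, ∀ a, size (f a) ≤ p.eval (size a) := by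
  obtain ⟨_, p, h⟩ := hf
  exact ⟨p, fun a => (h a).1⟩

theorem FP.of_exec {f : α → β} (c : Cmd (Sym A)) (p q : Polynomial ℕ)
    (hp : ∀ a, size (f a) ≤ p.eval (size a))
    (hq : ∀ a m, Exec c (st [] ((enc a).code ++ m) [] [] [])
      (st [] ((enc (f a)).code ++ m) [] [] []) (q.eval (size a))) : FP A f :=
  ⟨c, p + q, fun a => ⟨(hp a).trans (by simp), fun m => (hq a m).mono (by simp)⟩⟩

theorem FP.of_enc_eq {f : α → β} (h : ∀ a, enc (f a) = enc a) : FP A f :=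
  .of_exec .skip Polynomial.X 1 (fun a => by simp [size, h]) fun a m => by
    rw [h]; simpa using Exec.skip

theorem FP.id : FP A (fun x : α => x) := .of_enc_eq fun _ => rfl

theorem FP.comp {f : α → β} {g : β → γ} (hg : FP A g) (hf : FP A f) :
    FP A fun x => g (f x) := by
  obtain ⟨c, p, hc⟩ := hf
  obtain ⟨d, q, hd⟩ := hg
  have hq : ∀ a, q.eval (size (f a)) ≤ (q.comp p).eval (size a) := fun a => by
    rw [Polynomial.eval_comp]
    exact eval_mono _ (hc a).1
  refine .of_exec (.seq c d) (q.comp p) (p + q.comp p) (fun a => (hd (f a)).1.trans (hq a))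
    fun a m => (((hc a).2 m).seq ((hd (f a)).2 m)).mono ?_
  rw [Polynomial.eval_add]
  exact Nat.add_le_add_left (hq a) _

/-- Push a string on the data stack. -/
def pushList : List Bool → Cmd (Sym A)
  | [] => .skip
  | x :: l => .seq (pushList l) (.push .main x)

theorem exec_pushList (l : List Bool) (m : List Bool) :
    Exec (pushList (A := A) l) (st [] m [] [] []) (st [] (l ++ m) [] [] []) (l.length + 1) := by
  induction l with
  | nil => exact Exec.skip
  | cons x l ih =>
    exact Exec.mono (Exec.seq ih (Exec.push (update_st_main ..))) (by simp)

theorem FP.const (b : β) : FP A (fun _ : α => b) := by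
  refine .of_exec (.seq dropTree (pushList (enc b).code)) (Polynomial.C (size b))
    (7 * Polynomial.X + Polynomial.C (size b + 3)) (fun a => by simp) fun a m => ?_
  refine Exec.mono (Exec.seq (exec_dropTree ..) (exec_pushList ..)) ?_
  simp [size, Data.size]
  omega

theorem FP.pair {f : α → β} {g : α → γ} (hf : FP A f) (hg : FP A g) :
    FP A fun x => (f x, g x) := by
  obtain ⟨c, p, hc⟩ := hf
  obtain ⟨d, q, hd⟩ := hg
  -- With `f x` above `g x` on the stack, a single node symbol on top turns the two codes into the
  -- code of the pair.
  refine .of_exec (.seq dupTree (.seq d (.seq swapTrees (.seq c (.push .main true)))))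
    (p + q + 1) (p + 10 * q + 20 * Polynomial.X + 30) (fun a => ?_) fun a m => ?_
  · have h1 := (hc a).1
    have h2 := (hd a).1
    simp only [size_prod, Polynomial.eval_add, Polynomial.eval_one]
    omega
  · have h := (exec_dupTree (enc a) [] m).seq (((hd a).2 _).seq ((exec_swapTrees _ _ _ _).seq
      (((hc a).2 _).seq (Exec.push (update_st_main _ _ _ _ _ (true :: _))))))
    simp only [enc_prod, Data.code, List.cons_append, List.append_assoc]
    refine h.mono ?_
    have h2 := (hd a).1
    simp [size] at h2 ⊢
    omega

theorem FP.fst : FP A (Prod.fst : α × β → α) := by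
  refine .of_exec (.pop .main fun _ => .seq swapTrees dropTree) Polynomial.X
    (18 * Polynomial.X + 20) (fun a => by simp; omega) fun a m => ?_
  obtain ⟨a, b⟩ := a
  simp only [enc_prod, Data.code, List.cons_append, List.append_assoc]
  refine Exec.mono (Exec.pop rfl (update_st_main ..)
    (Exec.seq (exec_swapTrees _ _ _ _) (exec_dropTree ..))) ?_
  simp [size, enc_prod]
  omega

theorem FP.snd : FP A (Prod.snd : α × β → β) := by
  refine .of_exec (.pop .main fun _ => dropTree) Polynomial.X
    (18 * Polynomial.X + 20) (fun a => by simp; omega) fun a m => ?_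
  obtain ⟨a, b⟩ := a
  simp only [enc_prod, Data.code, List.cons_append, List.append_assoc]
  refine Exec.mono (Exec.pop rfl (update_st_main ..) (exec_dropTree ..)) ?_
  simp [size, enc_prod]
  omega

theorem FP.fst' {f : α → β × γ} (hf : FP A f) : FP A fun x => (f x).1 := FP.fst.comp hf

theorem FP.snd' {f : α → β × γ} (hf : FP A f) : FP A fun x => (f x).2 := FP.snd.comp hf

/-- Run the first program if the truth value on top of the data stack, whose first symbol has
been read, is true, and the second one otherwise. -/
def branchCmd (d e : Cmd (Sym A)) : Option Bool → Cmd (Sym A)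
  | some true => .pop .main fun _ => .pop .main fun _ => d
  | _ => e

theorem FP.cond {c : α → Bool} {f g : α → β} (hc : FP A c) (hf : FP A f) (hg : FP A g) :
    FP A fun x => bif c x then f x else g x := by
  obtain ⟨c', p, hc⟩ := hc
  obtain ⟨d, q, hd⟩ := hf
  obtain ⟨e, r, he⟩ := hg
  refine .of_exec (.seq dupTree (.seq c' (.pop .main (branchCmd d e)))) (q + r)
    (11 * Polynomial.X + p + q + r + 10) (fun a => ?_) fun a m => ?_
  · have h1 := (hd a).1
    have h2 := (he a).1
    cases c a <;> simp <;> omega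
  · refine Exec.mono (T := (11 * size a + 4) + (p.eval (size a) +
      ((q.eval (size a) + r.eval (size a)) + 3))) (Exec.seq (exec_dupTree ..) (Exec.seq
        ((hc a).2 _) ?_)) (by simp; omega)
    cases c a with
    | false =>
      exact Exec.mono (Exec.pop (f := branchCmd d e) (o := some false) rfl (update_st_main ..)
        ((he a).2 m)) (by omega)
    | true =>
      have h : Exec (branchCmd d e (some true)) (st [] (false :: false :: ((enc a).code ++ m))
          [] [] []) (st [] ((enc (f a)).code ++ m) [] [] []) (q.eval (size a) + 1 + 1) :=
        Exec.pop rfl (update_st_main ..) (Exec.pop rfl (update_st_main ..) ((hd a).2 m))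
      exact Exec.mono (Exec.pop (f := branchCmd d e) (o := some true) rfl (update_st_main ..) h)
        (by omega)

theorem FP.ite {p : α → Prop} [DecidablePred p] {f g : α → β} (hp : FP A fun x => decide (p x))
    (hf : FP A f) (hg : FP A g) : FP A fun x => if p x then f x else g x := by
  simpa only [Bool.cond_decide] using hp.cond hf hg

theorem FP.decide_eq [DecidableEq β] {f g : α → β} (hf : FP A f) (hg : FP A g) :
    FP A fun x => decide (f x = g x) := by
  have h : FP A fun x : β × β => decide (x.1 = x.2) := by
    refine .of_exec (.pop .main fun _ => eqTrees) 3 (20 * Polynomial.X + 20)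
      (fun a => by simpa using size_bool_le _) fun a m => ?_
    obtain ⟨a, b⟩ := a
    simp only [enc_prod, Data.code, List.cons_append, List.append_assoc]
    refine Exec.mono (Exec.pop (s₁ := st [] ((enc a).code ++ ((enc b).code ++ m)) [] [] []) rfl
      (update_st_main ..) ?_) (T := 12 * size a + 12 * size b + 12 + 1) (by simp; omega)
    have h := exec_eqTrees (enc a) (enc b) ([] : List A) m
    simp only [enc_injective.eq_iff] at h
    convert h using 5
    · change Data.ofBool _ = Data.ofBool _
      congr!
    · rfl
    · rfl
  exact h.comp (hf.pair hg)

/-- Run a program on every element of a list together with the current state. -/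
def foldCmd (c : Cmd (Sym A)) : Cmd (Sym A) :=
  .loop .main (fun o => o == some true) fun _ =>
    -- The stack, from the top, holds head, tail and state, the cons symbol having been read. The
    -- moves give tail, head, state; then tail, (head, state); then (head, state), tail; then new
    -- state, tail; and finally tail, new state.
    .seq swapTrees <| .seq joinUnder <| .seq swapTrees <| .seq c swapTrees

/-- The time of each round depends on the current state, so a bound `M` on the states after all
prefixes of the list is assumed, besides a bound `N` on the list. -/
theorem exec_foldCmd {c : Cmd (Sym A)} {p : Polynomial ℕ} {f : β × σ → σ}
    (hc : ∀ a, size (f a) ≤ p.eval (size a) ∧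
      ∀ m, Exec c (st [] ((enc a).code ++ m) [] [] []) (st [] ((enc (f a)).code ++ m) [] [] [])
        (p.eval (size a))) (m : List Bool) (N M : ℕ) (l : List β) :
    ∀ s : σ, size l ≤ N →
      (∀ l₁ l₂, l = l₁ ++ l₂ → size (l₁.foldl (fun s b => f (b, s)) s) ≤ M) →
      Exec (foldCmd c) (st [] ((enc l).code ++ ((enc s).code ++ m)) [] [] [])
        (st [] ((enc (l.foldl (fun s b => f (b, s)) s)).code ++ m) [] [] [])
        (l.length * (40 * (N + M) + 40 + p.eval (N + M + 1)) + 1) := by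
  induction l with
  | nil =>
    intro s _ _
    exact Exec.mono (Exec.loop_exit (by rfl) (update_st_main ..)) (by simp)
  | cons a l ih =>
    intro s hN hM
    simp only [size_cons] at hN
    have h1 : size s ≤ M := hM [] (a :: l) rfl
    have h2 : size (f (a, s)) ≤ M := hM [a] l rfl
    have h3 := ih (f (a, s)) (by omega) fun l₁ l₂ h => hM (a :: l₁) l₂ (by rw [h]; rfl)
    have h4 := (exec_swapTrees (A := A) (enc a) (enc l) [] ((enc s).code ++ m)).seq
      ((exec_joinUnder _ _ _ _ _).seq ((exec_swapTrees _ _ _ _).seq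
        (((hc (a, s)).2 _).seq (exec_swapTrees _ _ _ _))))
    refine Exec.mono (Exec.loop_step (o := some true) rfl rfl (update_st_main ..) ?_ h3)
      (T := (40 * (N + M) + 39 + p.eval (N + M + 1)) + _ + 1) ?_
    · simp only [List.tail_cons, st_main, enc_cons, Data.code, List.cons_append,
        List.append_assoc]
      refine h4.mono ?_
      have h5 : p.eval (size (a, s)) ≤ p.eval (N + M + 1) :=
        eval_mono _ (by simp only [size_prod]; omega)
      simp only [size, Data.size_node, enc_prod] at *
      omega
    · simp only [List.length_cons]
      ring_nf
      omega

/-- A polynomial step alone could be iterated to exponential size. The assumed bound on the result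
holds for all lists, hence for prefixes, and so controls all intermediate states. -/
theorem FP.foldl_core {f : β × σ → σ} (hf : FP A f) (q : Polynomial ℕ)
    (hq : ∀ (l : List β) (s : σ),
      size (l.foldl (fun s b => f (b, s)) s) ≤ q.eval (size l + size s)) :
    FP A fun x : List β × σ => x.1.foldl (fun s b => f (b, s)) x.2 := by
  obtain ⟨c, p, hc⟩ := hf
  refine .of_exec (.pop .main fun _ => foldCmd c) q
    (Polynomial.X * (40 * (Polynomial.X + q) + 40 + p.comp (Polynomial.X + q + 1)) + 2)
    (fun a => (hq _ _).trans (eval_mono _ (by simp))) fun a m => ?_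
  obtain ⟨l, s⟩ := a
  simp only [enc_prod, Data.code, List.cons_append, List.append_assoc]
  refine Exec.mono (Exec.pop rfl (update_st_main ..) (exec_foldCmd hc m (size (l, s))
    (q.eval (size (l, s))) l s (by simp; omega) fun l₁ l₂ h => (hq _ _).trans
      (eval_mono _ ?_))) ?_
  · have : size l₁ ≤ size l := size_le_of_sublist (by rw [h]; exact List.sublist_append_left ..)
    simp only [size_prod]; omega
  · simp only [Polynomial.eval_add, Polynomial.eval_mul, Polynomial.eval_X, Polynomial.eval_comp,
      Polynomial.eval_ofNat, Polynomial.eval_one]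
    have : l.length ≤ size (l, s) := (length_le_size l).trans (by simp; omega)
    have := Nat.mul_le_mul_right (40 * (size (l, s) + q.eval (size (l, s))) + 40 +
      p.eval (size (l, s) + q.eval (size (l, s)) + 1)) this
    omega

/-- A fold over a list, in a context `x`, is computable in polynomial time if every step increases
the size of the state by at most a polynomial in the sizes of the context and of the list
element. -/
theorem FP.foldl {f : α → σ → β → σ} {g : α → List β} {h : α → σ} (hg : FP A g) (hh : FP A h)
    (hf : FP A fun x : α × σ × β => f x.1 x.2.1 x.2.2)
    (hr : ∃ r : Polynomial ℕ, ∀ x s b, size (f x s b) ≤ size s + r.eval (size x + size b)) :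
    FP A fun x => (g x).foldl (f x) (h x) := by
  obtain ⟨r, hr⟩ := hr
  -- The core fold has no context, so `x` travels unchanged as a component of the state.
  have hF : FP A fun y : β × α × σ => (y.2.1, f y.2.1 y.2.2 y.1) :=
    .pair (.fst' .snd) (hf.comp (.pair (.fst' .snd) (.pair (.snd' .snd) .fst)))
  have key : ∀ (l : List β) (x : α) (s : σ),
      l.foldl (fun (s : α × σ) b => (s.1, f s.1 s.2 b)) (x, s) = (x, l.foldl (f x) s) := by
    intro l x
    induction l with
    | nil => intro s; rfl
    | cons b l ih => intro s; exact ih _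
  -- Growth is additive and independent of the state, so it sums to at most (number of steps) times
  -- (largest increment).
  have hsize : ∀ (l : List β) (x : α) (s : σ),
      size (l.foldl (f x) s) ≤ size s + size l * r.eval (size x + size l) := by
    intro l x
    induction l with
    | nil => intro s; simp
    | cons b l ih =>
      intro s
      refine (ih _).trans ?_
      have h1 := hr x s b
      have h2 : r.eval (size x + size b) ≤ r.eval (size x + size (b :: l)) :=
        eval_mono _ (by simp only [size_cons]; omega)
      have h3 : size l * r.eval (size x + size l) ≤ size l * r.eval (size x + size (b :: l)) :=
        Nat.mul_le_mul_left _ (eval_mono _ (by simp only [size_cons]; omega))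
      have h4 : (size l + 1) * r.eval (size x + size (b :: l)) ≤
          size (b :: l) * r.eval (size x + size (b :: l)) :=
        Nat.mul_le_mul_right _ (by simp only [size_cons]; omega)
      linarith
  have hcore := FP.foldl_core hF (Polynomial.X + Polynomial.X * r + 1) fun l s => by
    obtain ⟨x, s⟩ := s
    simp only [key]
    have h1 := hsize l x s
    have h2 : r.eval (size x + size l) ≤ r.eval (size l + size (x, s)) :=
      eval_mono _ (by simp only [size_prod]; omega)
    have h3 : size l * r.eval (size x + size l) ≤
        (size l + size (x, s)) * r.eval (size l + size (x, s)) :=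
      Nat.mul_le_mul (by omega) h2
    simp only [size_prod, Polynomial.eval_add, Polynomial.eval_mul, Polynomial.eval_X,
      Polynomial.eval_one] at h3 ⊢
    omega
  have := FP.snd.comp (hcore.comp (hg.pair (FP.id.pair hh)))
  simpa only [key] using this

end FP

end StackProg

/-! ### A library of functions computable in polynomial time -/

namespace StackProg

open Enc (enc enc_injective)

section Library

variable {A : Type} {α β γ σ τ : Type} [Enc α] [Enc β] [Enc γ] [Enc σ] [Enc τ]

theorem FP.of_eq {f g : α → β} (hf : FP A f) (h : ∀ x, f x = g x) : FP A g := by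
  rwa [← funext h]

theorem FP.cons {f : α → β} {g : α → List β} (hf : FP A f) (hg : FP A g) :
    FP A fun x => f x :: g x :=
  (FP.of_enc_eq (f := fun x : β × List β => x.1 :: x.2) fun _ => rfl).comp (hf.pair hg)

/-- Distinguish whether the list on top of the data stack, whose first symbol has been read, is
empty. -/
def casesCmd (d e : Cmd (Sym A)) : Option Bool → Cmd (Sym A)
  | some true => .seq (.push .main true) (.seq swapTrees (.seq (.push .main true) e))
  | _ => d

/-- A nonempty list and the pair of its head and tail have the same tree. Thus restoring the first
symbol, exchanging with the copy of `x`, and adding a node symbol prepares the argument of `f`. -/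
theorem FP.list_cases {g : α → List β} {h : α → γ} {f : α → β → List β → γ} (hg : FP A g)
    (hh : FP A h) (hf : FP A fun x : α × β × List β => f x.1 x.2.1 x.2.2) :
    FP A fun x => match g x with
      | [] => h x
      | b :: l => f x b l := by
  obtain ⟨c, p, hc⟩ := hg
  obtain ⟨d, q, hd⟩ := hh
  obtain ⟨e, r, he⟩ := hf
  have hr : ∀ x b l, g x = b :: l →
      r.eval (size (x, b, l)) ≤ (r.comp (Polynomial.X + p + 1)).eval (size x) := by
    intro x b l h
    rw [Polynomial.eval_comp]
    refine eval_mono _ ?_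
    have := (hc x).1
    simp only [h, size_cons, size_prod, Polynomial.eval_add, Polynomial.eval_X,
      Polynomial.eval_one] at this ⊢
    omega
  refine .of_exec (.seq dupTree (.seq c (.pop .main (casesCmd d e))))
    (q + r.comp (Polynomial.X + p + 1))
    (20 * Polynomial.X + 10 * p + q + r.comp (Polynomial.X + p + 1) + 20) (fun a => ?_)
    fun a m => ?_
  · rw [Polynomial.eval_add]
    rcases hg : g a with _ | ⟨b, l⟩
    · exact (hd a).1.trans (by simp)
    · exact ((he (a, b, l)).1.trans (hr a b l hg)).trans (by simp)
  · refine Exec.mono (T := (11 * size a + 4) + (p.eval (size a) +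
      (((9 * size a + 9 * p.eval (size a) + 10) + q.eval (size a) +
        (r.comp (Polynomial.X + p + 1)).eval (size a)) + 1))) (Exec.seq (exec_dupTree ..)
          (Exec.seq ((hc a).2 _) ?_)) ?_
    · have h4 := (hc a).1
      rcases hg : g a with _ | ⟨b, l⟩
      · refine Exec.pop (k := Stk.main) (S := Sym A) (f := casesCmd d e) (o := some false) rfl
          (s₁ := st [] ((enc a).code ++ m) [] [] []) (by simp [enc_nil, Data.code]) ?_
        exact Exec.mono ((hd a).2 m) (by omega)
      · have h1 := (exec_swapTrees (A := A) (enc (b, l)) (enc a) [] m).seq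
          ((Exec.push (update_st_main _ _ _ _ _ (true :: _))).seq
            (by simpa [enc_prod, Data.code] using (he (a, b, l)).2 m))
        simp only [enc_prod, Data.code, List.cons_append, List.append_assoc] at h1
        have h2 : Exec (casesCmd d e (some true)) (st [] ((enc b).code ++ ((enc l).code ++
            ((enc a).code ++ m))) [] [] []) _ _ := Exec.seq (Exec.push (update_st_main ..)) h1
        refine Exec.pop (k := Stk.main) (S := Sym A) (f := casesCmd d e) (o := some true)
          rfl (s₁ := st [] ((enc b).code ++ ((enc l).code ++ ((enc a).code ++ m))) [] [] []) ?_ ?_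
        · simp [enc_cons, Data.code]
        refine h2.mono ?_
        have h3 := hr a b l hg
        rw [hg, size_cons] at h4
        simp only [size_prod] at h3
        simp only [size, Data.size_node] at *
        omega
    · simp only [Polynomial.eval_add, Polynomial.eval_mul, Polynomial.eval_ofNat,
        Polynomial.eval_X]
      omega

theorem FP.option_cases {g : α → Option β} {h : α → γ} {f : α → β → γ} (hg : FP A g)
    (hh : FP A h) (hf : FP A fun x : α × β => f x.1 x.2) :
    FP A fun x => match g x with
      | none => h x
      | some b => f x b := by
  have h1 : FP A fun x : Option β => x.toList := .of_enc_eq fun _ => rfl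
  refine (FP.list_cases (f := fun x b _ => f x b) (h1.comp hg) hh
    (hf.comp (.pair .fst (.fst' .snd)))).of_eq fun x => ?_
  cases g x <;> rfl

/-- Only trees are computed, so the result may be reread in any type that has the same tree. -/
theorem FP.congr_enc {f : α → β} {g : α → γ} (hf : FP A f) (h : ∀ a, enc (g a) = enc (f a)) :
    FP A g := by
  obtain ⟨c, p, hc⟩ := hf
  refine ⟨c, p, fun a => ?_⟩
  rw [h, size, h]
  exact hc a

theorem FP.none : FP A fun _ : α => (Option.none : Option β) := .const _

theorem FP.nil : FP A fun _ : α => ([] : List β) := .const _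

theorem FP.some {f : α → β} (hf : FP A f) : FP A fun x => Option.some (f x) :=
  (hf.cons .nil).congr_enc fun _ => rfl

theorem FP.tail {f : α → List β} (hf : FP A f) : FP A fun x => (f x).tail :=
  (FP.list_cases (f := fun _ _ l => l) hf .nil (.snd' .snd)).of_eq fun x => by cases f x <;> rfl

theorem FP.headD {f : α → List β} {d : α → β} (hf : FP A f) (hd : FP A d) :
    FP A fun x => (f x).headD (d x) :=
  (FP.list_cases (f := fun _ b _ => b) hf hd (.fst' .snd)).of_eq fun x => by
    cases f x <;> rfl

/-! #### Truth values -/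

theorem FP.not {f : α → Bool} (hf : FP A f) : FP A fun x => !f x :=
  (hf.cond (.const false) (.const true)).of_eq fun x => by cases f x <;> rfl

theorem FP.and {f g : α → Bool} (hf : FP A f) (hg : FP A g) : FP A fun x => f x && g x :=
  (hf.cond hg (.const false)).of_eq fun x => by cases f x <;> rfl

theorem FP.or {f g : α → Bool} (hf : FP A f) (hg : FP A g) : FP A fun x => f x || g x :=
  (hf.cond (.const true) hg).of_eq fun x => by cases f x <;> rfl

theorem FP.isSome {f : α → Option β} (hf : FP A f) : FP A fun x => (f x).isSome :=
  (FP.option_cases (f := fun _ _ => true) hf (.const false) (.const true)).of_eq fun x => by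
    cases f x <;> rfl

/-! #### Folds over lists -/

theorem FP.reverse {f : α → List β} (hf : FP A f) : FP A fun x => (f x).reverse := by
  refine (FP.foldl (f := fun _ s b => b :: s) hf .nil (.cons (.snd' .snd) (.fst' .snd))
    ⟨Polynomial.X + 1, fun x s b => ?_⟩).of_eq fun x => ?_
  · simp; omega
  · simp

theorem FP.foldr {f : α → β → σ → σ} {g : α → List β} {h : α → σ} (hg : FP A g) (hh : FP A h)
    (hf : FP A fun x : α × β × σ => f x.1 x.2.1 x.2.2)
    (hr : ∃ r : Polynomial ℕ, ∀ x s b, size (f x b s) ≤ size s + r.eval (size x + size b)) :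
    FP A fun x => (g x).foldr (f x) (h x) := by
  refine (FP.foldl (f := fun x s b => f x b s) hg.reverse hh
    (hf.comp (.pair .fst (.pair (.snd' .snd) (.fst' .snd)))) hr).of_eq fun x => ?_
  simp

theorem FP.append {f g : α → List β} (hf : FP A f) (hg : FP A g) : FP A fun x => f x ++ g x := by
  refine (FP.foldr (f := fun _ b s => b :: s) hf hg (.cons (.fst' .snd) (.snd' .snd))
    ⟨Polynomial.X + 1, fun x s b => ?_⟩).of_eq fun x => ?_
  · simp; omega
  · simp

theorem FP.map {f : α → β → γ} {g : α → List β} (hg : FP A g)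
    (hf : FP A fun x : α × β => f x.1 x.2) : FP A fun x => (g x).map (f x) := by
  obtain ⟨p, hp⟩ := hf.size_le
  refine (FP.foldr (f := fun x b s => f x b :: s) hg .nil
    (.cons (hf.comp (.pair .fst (.fst' .snd))) (.snd' .snd))
    ⟨p.comp (Polynomial.X + 1) + 1, fun x s b => ?_⟩).of_eq fun x => ?_
  · have := hp (x, b)
    simp at this ⊢
    omega
  · induction g x <;> simp_all

theorem FP.flatMap {f : α → β → List γ} {g : α → List β} (hg : FP A g)
    (hf : FP A fun x : α × β => f x.1 x.2) : FP A fun x => (g x).flatMap (f x) := by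
  obtain ⟨p, hp⟩ := hf.size_le
  refine (FP.foldr (f := fun x b s => f x b ++ s) hg .nil
    (.append (hf.comp (.pair .fst (.fst' .snd))) (.snd' .snd))
    ⟨p.comp (Polynomial.X + 1), fun x s b => ?_⟩).of_eq fun x => ?_
  · have := hp (x, b)
    have := size_append (f x b) s
    simp at *
    omega
  · induction g x <;> simp_all

theorem FP.filter {f : α → β → Bool} {g : α → List β} (hg : FP A g)
    (hf : FP A fun x : α × β => f x.1 x.2) : FP A fun x => (g x).filter (f x) := by
  refine (FP.flatMap (f := fun x b => bif f x b then [b] else []) hg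
    (.cond hf (.cons .snd .nil) .nil)).of_eq fun x => ?_
  induction g x with
  | nil => rfl
  | cons b l ih => cases h : f x b <;> simp_all

theorem FP.filterMap {f : α → β → Option γ} {g : α → List β} (hg : FP A g)
    (hf : FP A fun x : α × β => f x.1 x.2) : FP A fun x => (g x).filterMap (f x) := by
  have h : FP A fun o : Option γ => o.toList := .of_enc_eq fun _ => rfl
  refine (FP.flatMap (f := fun x b => (f x b).toList) hg (h.comp hf)).of_eq fun x => ?_
  induction g x with
  | nil => rfl
  | cons b l ih => cases h : f x b <;> simp_all

theorem FP.any {f : α → β → Bool} {g : α → List β} (hg : FP A g)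
    (hf : FP A fun x : α × β => f x.1 x.2) : FP A fun x => (g x).any (f x) := by
  refine (FP.foldr (f := fun x b s => f x b || s) hg (.const false)
    (.or (hf.comp (.pair .fst (.fst' .snd))) (.snd' .snd))
    ⟨3, fun x s b => (size_bool_le _).trans (by simp)⟩).of_eq fun x => ?_
  induction g x <;> simp_all

theorem FP.all {f : α → β → Bool} {g : α → List β} (hg : FP A g)
    (hf : FP A fun x : α × β => f x.1 x.2) : FP A fun x => (g x).all (f x) := by
  refine (FP.any (f := fun x b => !f x b) hg hf.not).not.of_eq fun x => ?_
  rw [List.any_eq_not_all_not]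
  simp

theorem FP.decide_mem [DecidableEq β] {f : α → β} {g : α → List β} (hf : FP A f) (hg : FP A g) :
    FP A fun x => decide (f x ∈ g x) := by
  refine (FP.any (f := fun x b => decide (f x = b)) hg
    (.decide_eq (hf.comp .fst) .snd)).of_eq fun x => ?_
  rw [Bool.eq_iff_iff]
  simp

/-- Duplicates are removed from a list. -/
def uniq {β : Type} [DecidableEq β] (l : List β) : List β := l.foldr List.insert []

theorem nodup_uniq {β : Type} [DecidableEq β] (l : List β) : (uniq l).Nodup := by
  induction l with
  | nil => exact List.nodup_nil
  | cons b l ih => exact List.Nodup.insert ih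

@[simp] theorem mem_uniq {β : Type} [DecidableEq β] {l : List β} {b : β} : b ∈ uniq l ↔ b ∈ l := by
  induction l with
  | nil => simp [uniq]
  | cons a l ih => simpa [uniq] using or_congr_right ih

theorem FP.uniq [DecidableEq β] {f : α → List β} (hf : FP A f) : FP A fun x => uniq (f x) := by
  refine (FP.foldr (f := fun _ b s => if b ∈ s then s else b :: s) hf .nil
    (.ite (.decide_mem (.fst' .snd) (.snd' .snd)) (.snd' .snd) (.cons (.fst' .snd) (.snd' .snd)))
    ⟨Polynomial.X + 1, fun x s b => ?_⟩).of_eq fun x => ?_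
  · split_ifs
    all_goals simp
    all_goals omega
  · rw [StackProg.uniq]
    congr
    funext b s
    by_cases h : b ∈ s <;> simp [h]

theorem FP.zip {f : α → List β} {g : α → List γ} (hf : FP A f) (hg : FP A g) :
    FP A fun x => (f x).zip (g x) := by
  refine (FP.reverse (FP.snd' (FP.foldl
    (f := fun _ (s : List γ × List (β × γ)) b => (s.1.tail, match s.1 with
      | [] => s.2
      | c :: _ => (b, c) :: s.2)) (σ := List γ × List (β × γ)) hf (.pair hg .nil)
    (.pair (.tail (.fst' (.fst' .snd))) (.list_cases
      (f := fun x c _ => (x.2.2, c) :: x.2.1.2) (.fst' (.fst' .snd)) (.snd' (.fst' .snd))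
      (.cons (.pair (.snd' (.snd' .fst)) (.fst' .snd)) (.snd' (.fst' (.snd' .fst))))))
    ⟨Polynomial.X + 2, fun x s b => ?_⟩))).of_eq fun x => ?_
  · obtain ⟨l, s⟩ := s
    cases l
    all_goals simp
    all_goals omega
  · have key : ∀ (l : List β) (l' : List γ) (s : List (β × γ)),
        (l.foldl (fun (s : List γ × List (β × γ)) b => (s.1.tail, match s.1 with
          | [] => s.2
          | c :: _ => (b, c) :: s.2)) (l', s)).2 = (l.zip l').reverse ++ s := by
      intro l
      induction l with
      | nil => simp
      | cons b l ih => intro l' s; cases l' <;> simp [ih]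
    rw [key]
    simp

/-! #### Numbers in unary -/

/-- Unary numbers are lists of units, which reduces arithmetic and bounded iteration to operations
on lists. -/
theorem enc_replicate (n : ℕ) : enc (List.replicate n ()) = enc n := by
  induction n with
  | zero => rfl
  | succ n ih => rw [List.replicate_succ, enc_cons, ih]; rfl

theorem FP.succ {f : α → ℕ} (hf : FP A f) : FP A fun x => f x + 1 :=
  ((FP.const ()).pair hf).congr_enc fun _ => rfl

theorem FP.length {f : α → List β} (hf : FP A f) : FP A fun x => (f x).length :=
  (FP.map (f := fun _ _ => ()) hf (.const ())).congr_enc fun x => by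
    rw [List.map_const', enc_replicate]

theorem FP.replicate {f : α → ℕ} {g : α → β} (hf : FP A f) (hg : FP A g) :
    FP A fun x => List.replicate (f x) (g x) := by
  have h : FP A fun x => List.replicate (f x) () := hf.congr_enc fun x => enc_replicate _
  refine (FP.map (f := fun x _ => g x) h (hg.comp .fst)).of_eq fun x => ?_
  simp

theorem FP.add {f g : α → ℕ} (hf : FP A f) (hg : FP A g) : FP A fun x => f x + g x :=
  ((hf.replicate (.const ())).append (hg.replicate (.const ()))).length.of_eq fun x => by simp

theorem FP.pred {f : α → ℕ} (hf : FP A f) : FP A fun x => f x - 1 :=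
  (hf.replicate (.const ())).tail.length.of_eq fun x => by simp

theorem FP.iterate {f : α → σ → σ} {g : α → ℕ} {h : α → σ} (hg : FP A g) (hh : FP A h)
    (hf : FP A fun x : α × σ => f x.1 x.2)
    (hr : ∃ r : Polynomial ℕ, ∀ x s, size (f x s) ≤ size s + r.eval (size x)) :
    FP A fun x => (f x)^[g x] (h x) := by
  obtain ⟨r, hr⟩ := hr
  refine (FP.foldl (f := fun x s (_ : Unit) => f x s) (hg.replicate (.const ())) hh
    (hf.comp (.pair .fst (.fst' .snd)))
    ⟨r, fun x s b => (hr x s).trans (Nat.add_le_add_left (eval_mono _ (by omega)) _)⟩).of_eq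
    fun x => ?_
  have key : ∀ (n : ℕ) (s : σ),
      (List.replicate n ()).foldl (fun s _ => f x s) s = (f x)^[n] s := by
    intro n
    induction n with
    | zero => simp
    | succ n ih => intro s; simp [List.replicate_succ, ih]
  exact key _ _

theorem FP.sub {f g : α → ℕ} (hf : FP A f) (hg : FP A g) : FP A fun x => f x - g x := by
  refine (FP.iterate (f := fun _ n => n - 1) hg hf (.pred .snd)
    ⟨0, fun x s => by simp⟩).of_eq fun x => ?_
  induction g x with
  | zero => rfl
  | succ n ih => rw [Function.iterate_succ_apply', ih]; rfl

theorem FP.decide_le {f g : α → ℕ} (hf : FP A f) (hg : FP A g) :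
    FP A fun x => decide (f x ≤ g x) :=
  (FP.decide_eq (hf.sub hg) (.const 0)).of_eq fun x => by simp [Nat.sub_eq_zero_iff_le]

theorem FP.drop {f : α → List β} {g : α → ℕ} (hf : FP A f) (hg : FP A g) :
    FP A fun x => (f x).drop (g x) := by
  refine (FP.iterate (f := fun _ l => l.tail) hg hf (.tail .snd)
    ⟨0, fun x s => by simpa using size_le_of_sublist (List.tail_sublist s)⟩).of_eq fun x => ?_
  induction g x with
  | zero => rfl
  | succ n ih => rw [Function.iterate_succ_apply', ih, List.tail_drop]

theorem FP.getD {f : α → List β} {g : α → ℕ} {d : α → β} (hf : FP A f) (hg : FP A g)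
    (hd : FP A d) : FP A fun x => (f x).getD (g x) (d x) := by
  refine ((hf.drop hg).headD hd).of_eq fun x => ?_
  rw [List.headD_eq_head?_getD, List.head?_drop, List.getD_eq_getElem?_getD]

theorem FP.idxOf [DecidableEq β] {f : α → β} {g : α → List β} (hf : FP A f) (hg : FP A g) :
    FP A fun x => (g x).idxOf (f x) := by
  refine (FP.foldr (f := fun x b n => if b = f x then 0 else n + 1) hg (.const 0)
    (.ite (.decide_eq (.fst' .snd) (hf.comp .fst)) (.const 0) (.succ (.snd' .snd)))
    ⟨2, fun x s b => ?_⟩).of_eq fun x => ?_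
  · split_ifs
    all_goals simp
    all_goals omega
  · induction g x with
    | nil => rfl
    | cons b l ih => by_cases h : b = f x <;> simp_all

theorem FP.range {f : α → ℕ} (hf : FP A f) : FP A fun x => List.range (f x) := by
  obtain ⟨p, hp⟩ := hf.size_le
  -- The appended number is the minimum of `l.length` and `f x`. In the rounds that occur it equals
  -- `l.length`, but the cap bounds the growth in terms of `x` alone, for arbitrary states.
  refine (FP.iterate (f := fun x l => l ++ [l.length - (l.length - f x)]) hf .nil
    (.append .snd (.cons (.sub (.length .snd) (.sub (.length .snd) (hf.comp .fst))) .nil))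
    ⟨p + 2, fun x s => ?_⟩).of_eq fun x => ?_
  · have h1 := size_append s [s.length - (s.length - f x)]
    have h2 := hp x
    simp at h1 h2 ⊢
    omega
  · have key : ∀ i ≤ f x,
        (fun l : List ℕ => l ++ [l.length - (l.length - f x)])^[i] [] = List.range i := by
      intro i
      induction i with
      | zero => intro _; rfl
      | succ n ih =>
        intro h
        rw [Function.iterate_succ_apply', ih (by omega), List.length_range, List.range_succ,
          Nat.sub_eq_zero_of_le (by omega : n ≤ f x), Nat.sub_zero]
    exact key _ le_rfl

/-! #### Finite types -/

theorem FP.finite_cases [Finite τ] [DecidableEq τ] {g : α → τ} {f : τ → α → β} (hg : FP A g)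
    (hf : ∀ t, FP A (f t)) : FP A fun x => f (g x) x := by
  have := Fintype.ofFinite τ
  rcases isEmpty_or_nonempty α with h | ⟨⟨a⟩⟩
  · exact ⟨.skip, 0, fun a => isEmptyElim a⟩
  -- A chain of equality tests over an enumeration of `τ`; the value at the arbitrary point `a` only
  -- serves as a constant for the empty chain.
  have key : ∀ l : List τ, FP A fun x => if g x ∈ l then f (g x) x else f (g a) a := by
    intro l
    induction l with
    | nil => simpa using FP.const _
    | cons t l ih =>
      refine (FP.ite (p := fun x => g x = t) (.decide_eq hg (.const t)) (hf t) ih).of_eq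
        fun x => ?_
      by_cases h : g x = t <;> simp [h]
  simpa using key Finset.univ.toList

/-- The finite table of `f` is built into the program, so even noncomputably defined data about the
relations of a fixed language is available at run time. -/
theorem FP.of_finite [Finite τ] (f : τ → β) : FP A f := by
  classical
  exact (FP.finite_cases (f := fun t _ => f t) .id fun t => .const _)

end Library

end StackProg

/-! ### Reading the input and writing the output -/

namespace StackProg

open Enc (enc enc_injective)

/-- Push a string on stack `a`, in reverse order. -/
def pushListA {B : Type} : List Bool → Cmd (Sym B)
  | [] => .skip
  | x :: l => .seq (.push .a x) (pushListA l)

theorem exec_pushListA {B : Type} (i : List B) (m : List Bool) (l : List Bool) :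
    ∀ a : List Bool, Exec (pushListA (B := B) l) (st i m a [] [])
      (st i m (l.reverse ++ a) [] []) (l.length + 1) := by
  induction l with
  | nil => exact fun a => Exec.skip
  | cons x l ih =>
    intro a
    refine Exec.mono (Exec.seq (Exec.push (update_st_a ..)) ?_) (T := 1 + (l.length + 1))
      (by simp; omega)
    simpa using ih (x :: a)

theorem code_list {β : Type} [Enc β] (l : List β) :
    (enc l).code = (l.flatMap fun x => true :: (enc x).code) ++ [false] := by
  induction l with
  | nil => rfl
  | cons x l ih => simp [enc_cons, Data.code, ih]

/-- Read from the data stack a number in unary, and output the symbol at this position. -/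
def writeNth {B : Type} : List B → Cmd (Sym B)
  | [] => .skip
  | x :: l => .pop .main fun o =>
    if o = some true then .pop .main fun _ => writeNth l else .push .io x

theorem exec_writeNth {B : Type} (i : List B) (m : List Bool) (l : List B) :
    ∀ (n : ℕ) (h : n < l.length),
    Exec (writeNth l) (st i ((enc n).code ++ m) [] [] []) (st (l[n] :: i) m [] [] [])
      (2 * n + 2) := by
  induction l with
  | nil => intro n h; simp at h
  | cons x l ih =>
    intro n h
    cases n with
    | zero =>
      refine Exec.pop (k := Stk.main) (S := Sym B) (o := some false) rfl
        (update_st_main _ _ _ _ _ m) ?_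
      exact Exec.push (update_st_io ..)
    | succ n =>
      refine Exec.mono (Exec.pop (k := Stk.main) (S := Sym B) (o := some true) rfl
        (s₁ := st i (false :: ((enc n).code ++ m)) [] [] []) (by simp [enc_succ, Data.code])
        (T := 2 * n + 2 + 1) ?_) (by omega)
      exact Exec.pop (k := Stk.main) (S := Sym B) (o := some false) rfl
        (update_st_main _ _ _ _ _ ((enc n).code ++ m)) (ih n (by simpa using h))

section InputOutput

variable {B : Type} [Fintype B]

attribute [local instance] Enc.ofFinite

theorem size_finite_le (x : B) : size x ≤ 2 * Fintype.card B + 1 := by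
  have h : size x = size (Finite.equivFin B x).val := rfl
  rw [h, size_nat, ← Nat.card_eq_fintype_card]
  have := (Finite.equivFin B x).isLt
  omega

theorem size_list_finite_le (l : List B) : size l ≤ (2 * Fintype.card B + 2) * l.length + 1 := by
  induction l with
  | nil => simp
  | cons x l ih =>
    have := size_finite_le x
    simp only [size_cons, List.length_cons]
    ring_nf at *
    omega

/-- Push the code of a symbol on stack `a`. -/
noncomputable def readSymbol : Option B → Cmd (Sym B)
  | some x => pushListA (true :: (enc x).code)
  | none => .skip

/-- A cons symbol in front of each code, with a final leaf added afterwards, is precisely the code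
of the list (`code_list`). -/
theorem exec_readSymbol_loop (l : List B) : ∀ (a : List Bool),
    Exec (.loop .io Option.isSome readSymbol) (st l [] a [] [])
      (st [] [] ((l.flatMap fun x => true :: (enc x).code).reverse ++ a) [] [])
      (l.length * (2 * Fintype.card B + 10) + 1) := by
  induction l with
  | nil => exact fun a => Exec.mono (Exec.loop_exit rfl (update_st_io ..)) (by simp)
  | cons x l ih =>
    intro a
    have h := ih ((true :: (enc x).code).reverse ++ a)
    rw [← List.append_assoc, ← List.reverse_append] at h
    refine Exec.mono (Exec.loop_step (k := Stk.io) (S := Sym B) (o := some x) rfl rfl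
      (update_st_io _ l _ _ _ _) (exec_pushListA _ _ (true :: (enc x).code) _) h) ?_
    have := size_finite_le x
    simp only [List.length_cons]
    rw [size, Data.size] at this
    ring_nf at *
    omega

/-- Turn the input into a list on the data stack. -/
noncomputable def readInput : Cmd (Sym B) :=
  .seq (.loop .io Option.isSome readSymbol) (.seq (.push .a false) pourA)

theorem exec_readInput (l : List B) :
    Exec readInput (st l [] [] [] []) (st [] (enc l).code [] [] [])
      (l.length * (2 * Fintype.card B + 10) + 2 * size l + 3) := by
  have h := (exec_readSymbol_loop l []).seq ((Exec.push (update_st_a _ _ _ _ _ (false :: _))).seq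
    (exec_pourA _ _ _ _ _))
  simp only [st_a, List.append_nil, List.reverse_cons, List.reverse_reverse, ← code_list] at h
  refine h.mono ?_
  have : size l = (l.flatMap fun x => true :: (enc x).code).length + 1 := by
    rw [size, Data.size, code_list]; simp
  simp only [List.length_cons, List.length_reverse]
  omega

/-- The elements of a finite type in the order of their numbers. -/
noncomputable def symbols (B : Type) [Finite B] : List B := List.ofFn (Finite.equivFin B).symm

theorem exec_writeSymbol (i : List B) (m : List Bool) (x : B) :
    Exec (writeNth (symbols B)) (st i ((enc x).code ++ m) [] [] []) (st (x :: i) m [] [] [])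
      (2 * Fintype.card B + 2) := by
  have hlt := (Finite.equivFin B x).isLt
  have h := exec_writeNth i m (symbols B) (Finite.equivFin B x) (by simpa [symbols] using hlt)
  have hx : (symbols B)[(Finite.equivFin B x : ℕ)]'(by simpa [symbols] using hlt) = x := by
    simp [symbols]
  rw [hx] at h
  refine h.mono ?_
  rw [← Nat.card_eq_fintype_card]
  omega

/-- Turn a list on the data stack, which is given in reverse order, into the output. -/
noncomputable def writeOutput : Cmd (Sym B) :=
  .loop .main (fun o => o == some true) fun _ => writeNth (symbols B)

theorem exec_writeOutput (l : List B) : ∀ i : List B,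
    Exec writeOutput (st i (enc l).code [] [] []) (st (l.reverse ++ i) [] [] [] [])
      (l.length * (2 * Fintype.card B + 3) + 1) := by
  induction l with
  | nil =>
    exact fun i => Exec.mono (Exec.loop_exit (k := Stk.main) (S := Sym B) rfl
      (update_st_main ..)) (by simp)
  | cons x l ih =>
    intro i
    refine Exec.mono (Exec.loop_step (k := Stk.main) (S := Sym B) (o := some true) rfl rfl
      (update_st_main _ _ _ _ _ ((enc x).code ++ (enc l).code)) (exec_writeSymbol _ _ _)
      (T' := l.length * (2 * Fintype.card B + 3) + 1) ?_) ?_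
    · have h := ih (x :: i)
      rw [List.reverse_cons, List.append_assoc]
      exact h
    · simp only [List.length_cons]
      ring_nf
      omega

/-- A function that acts on encodings by a function of strings which is computable in polynomial
time on trees is computed by a polynomial-time Turing machine. -/
theorem polyTime_of_FP {f : List B → List B} (hf : FP B f) {α β : Type} {ea : α → List B}
    {eb : β → List B} {g : α → β} (h : ∀ x, f (ea x) = eb (g x)) :
    Nonempty (Turing.TM2ComputableInPolyTime ea eb g) := by
  -- Pushing symbols on the output stack reverses their order, so the program computes the reversed
  -- result.
  obtain ⟨c, p, hc⟩ := hf.reverse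
  have hN := fun l : List B => size_list_finite_le l
  let s : Polynomial ℕ := Polynomial.C (2 * Fintype.card B + 2) * Polynomial.X + 1
  refine polyTime_of_exec (.seq readInput (.seq c writeOutput))
    (Polynomial.X * Polynomial.C (2 * Fintype.card B + 10) + 2 * s + 3 +
      (p.comp s + (p.comp s * Polynomial.C (2 * Fintype.card B + 3) + 1))) fun x => ?_
  have h1 := (hc (ea x)).2 []
  have h2 := exec_writeOutput (f (ea x)).reverse []
  simp only [List.append_nil, List.reverse_reverse] at h1 h2
  have h3 := (exec_readInput (ea x)).seq (h1.seq h2)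
  rw [h x] at h3
  refine h3.mono ?_
  have h4 : p.eval (size (ea x)) ≤ p.eval (s.eval (ea x).length) :=
    eval_mono _ (by simpa [s] using hN (ea x))
  have h5 : (eb (g x)).reverse.length ≤ p.eval (s.eval (ea x).length) := by
    rw [← h x]
    exact (length_le_size _).trans ((hc _).1.trans h4)
  have h6 := Nat.mul_le_mul_right (2 * Fintype.card B + 3) h5
  have h7 := hN (ea x)
  simp only [Polynomial.eval_add, Polynomial.eval_mul, Polynomial.eval_X, Polynomial.eval_C,
    Polynomial.eval_comp, Polynomial.eval_ofNat, Polynomial.eval_one]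
  have h8 : s.eval (ea x).length = (2 * Fintype.card B + 2) * (ea x).length + 1 := by simp [s]
  rw [h8] at h4 h5 h6 ⊢
  omega

end InputOutput

end StackProg

/-! ### Mergeable relations -/

namespace MinOnes

namespace BoolRel

variable {R : BoolRel}

/-- Tuples `α` and `γ` whose restrictions to `D` are in the mergeable relation `R` can be
intersected outside `D`. -/
theorem Mergeable.inter_mem (hR : R.Mergeable) {D α γ : Fin R.arity → Bool} (hα : α ∈ R.tuples)
    (hαD : α ⊓ D ∈ R.tuples) (hγ : γ ∈ R.tuples) (hγD : γ ⊓ D ∈ R.tuples) :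
    α ⊓ (D ⊔ γ) ∈ R.tuples := by
  -- The merge of `α, α ⊓ D, γ, γ ⊓ D` is `α ⊓ ((α ⊓ D) ⊔ γ)`, which equals `α ⊓ (D ⊔ γ)` by
  -- distributivity.
  have h := hR α hα (α ⊓ D) hαD γ hγ (γ ⊓ D) hγD
    ⟨⟨le_inf inf_le_left (inf_le_right.trans inf_le_right), inf_le_left⟩,
      ⟨le_inf inf_le_right (inf_le_left.trans inf_le_right), inf_le_left⟩⟩
  rwa [inf_sup_left, ← inf_assoc, inf_idem, ← inf_sup_left] at h

/-- Two tuples below `α` which agree with `α` on `D` can be united. -/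
theorem Mergeable.union_mem (hR : R.Mergeable) {D α β γ : Fin R.arity → Bool}
    (hα : α ∈ R.tuples) (hαD : α ⊓ D ∈ R.tuples) (hβ : β ∈ R.tuples) (hγ : γ ∈ R.tuples)
    (hβα : β ≤ α) (hγα : γ ≤ α) (hβD : β ⊓ D = α ⊓ D) (hγD : γ ⊓ D = α ⊓ D) :
    β ⊔ γ ∈ R.tuples := by
  -- As `β` and `γ` agree on `D`, intersecting them outside `D` is intersecting them everywhere.
  have h1 : β ⊓ γ ∈ R.tuples := by
    have h := hR.inter_mem hβ (hβD ▸ hαD) hγ (hγD ▸ hαD)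
    rwa [inf_sup_left, hβD, ← hγD, sup_eq_right.2] at h
    refine le_inf ?_ inf_le_left
    rw [hγD, ← hβD]
    exact inf_le_left
  -- The outer `α` has no effect on the merge, because `β ⊔ γ ≤ α`.
  have h := hR α hα β hβ γ hγ (β ⊓ γ) h1
    ⟨⟨inf_le_right.trans inf_le_left, hβα⟩, ⟨le_rfl, inf_le_right⟩⟩
  rwa [inf_eq_right.2 (sup_le hβα hγα)] at h

/-- Every tuple of the sunflower restriction of `R` to `D` that has a one in position `i` has a one
in position `j`. -/
def Implies (R : BoolRel) (D : Fin R.arity → Bool) (i j : Fin R.arity) : Prop :=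
  ∀ γ ∈ R.tuples, γ ⊓ D ∈ R.tuples → γ i = true → γ j = true

/-- If a tuple and its restriction to `D` are in the mergeable relation `R`, then so is its
restriction to every superset of `D` that is closed under implications from outside `D`. -/
theorem Mergeable.restrict_mem (hR : R.Mergeable) {D P α : Fin R.arity → Bool} (hDP : D ≤ P)
    (hP : ∀ i j, P i = true → D i = false → R.Implies D i j → P j = true)
    (hα : α ∈ R.tuples) (hαD : α ⊓ D ∈ R.tuples) : α ⊓ P ∈ R.tuples := by
  have inter : ∀ β γ : Fin R.arity → Bool, β ∈ R.tuples → β ⊓ D = α ⊓ D → γ ∈ R.tuples →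
      γ ⊓ D ∈ R.tuples → β ⊓ (D ⊔ γ) ∈ R.tuples ∧ β ⊓ (D ⊔ γ) ⊓ D = α ⊓ D := by
    intro β γ hβ hβD hγ hγD
    refine ⟨hR.inter_mem hβ (hβD ▸ hαD) hγ hγD, ?_⟩
    rw [inf_assoc, inf_eq_right.2 (le_sup_left : D ≤ D ⊔ γ), hβD]
  -- For a position `i` of `α` in `P` outside `D`, successive intersections remove the positions
  -- outside `P` one by one while keeping `i` and all values on `D`.
  have single : ∀ i, α i = true → P i = true → D i = false → ∀ J : Finset (Fin R.arity),
      ∃ β ∈ R.tuples, β ≤ α ∧ β ⊓ D = α ⊓ D ∧ β i = true ∧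
        ∀ j ∈ J, P j = false → β j = false := by
    intro i hi hPi hDi J
    classical
    induction J using Finset.induction_on with
    | empty => exact ⟨α, hα, le_rfl, rfl, hi, by simp⟩
    | insert j J _ ih =>
      obtain ⟨β, h1, h2, h3, h4, h5⟩ := ih
      by_cases hj : P j = true
      · refine ⟨β, h1, h2, h3, h4, fun j' hj' hPj' => ?_⟩
        rcases Finset.mem_insert.1 hj' with rfl | h
        · simp [hj] at hPj'
        · exact h5 j' h hPj'
      -- Closedness of `P` means that `i` does not imply `j`; a witness `γ` with `γ i = 1` and `γ j
      -- = 0` is the tuple to intersect with.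
      · have hni : ¬ R.Implies D i j := fun h => hj (hP i j hPi hDi h)
        simp only [Implies, not_forall, Bool.not_eq_true] at hni
        obtain ⟨γ, hγ, hγD, hγi, hγj⟩ := hni
        obtain ⟨h6, h7⟩ := inter β γ h1 h3 hγ hγD
        refine ⟨_, h6, inf_le_left.trans h2, h7, by simp [h4, hγi], fun j' hj' hPj' => ?_⟩
        rcases Finset.mem_insert.1 hj' with rfl | h
        · have : D j' = false := by
            have := hDP j'
            rw [hPj'] at this
            exact le_bot_iff.1 this
          simp [this, hγj]
        · simp [h5 j' h hPj']
  -- Starting from `α ⊓ D`, the tuples obtained for single positions are united; once all positions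
  -- are covered the union is `α ⊓ P`.
  have all : ∀ I : Finset (Fin R.arity), ∃ β ∈ R.tuples, β ≤ α ⊓ P ∧ β ⊓ D = α ⊓ D ∧
      ∀ i ∈ I, α i = true → P i = true → β i = true := by
    intro I
    classical
    induction I using Finset.induction_on with
    | empty =>
      exact ⟨α ⊓ D, hαD, inf_le_inf_left _ hDP, by rw [inf_assoc, inf_idem], by simp⟩
    | insert i I _ ih =>
      obtain ⟨β, h1, h2, h3, h4⟩ := ih
      by_cases hi : α i = true ∧ P i = true ∧ D i = false
      · obtain ⟨β', h1', h2', h3', h4', h5'⟩ := single i hi.1 hi.2.1 hi.2.2 Finset.univ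
        refine ⟨β ⊔ β', hR.union_mem hα hαD h1 h1' (h2.trans inf_le_left) h2' h3 h3',
          sup_le h2 (le_inf h2' fun j => ?_), by rw [inf_sup_right, h3, h3', sup_idem],
          fun j hj hαj hPj => ?_⟩
        · by_cases hj : P j = true
          · rw [hj]; exact le_top
          · rw [h5' j (Finset.mem_univ _) (by simpa using hj)]
            exact bot_le
        · rcases Finset.mem_insert.1 hj with rfl | h
          · simp [h4']
          · simp [h4 j h hαj hPj]
      · refine ⟨β, h1, h2, h3, fun j hj hαj hPj => ?_⟩
        rcases Finset.mem_insert.1 hj with rfl | h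
        · have hD : D j = true := by
            by_contra hD
            exact hi ⟨hαj, hPj, by simpa using hD⟩
          have := congrFun h3 j
          simpa [hD, hαj] using this
        · exact h4 j h hαj hPj
  obtain ⟨β, h1, h2, -, h4⟩ := all Finset.univ
  convert h1 using 1
  refine le_antisymm (fun i => ?_) h2
  by_cases hi : α i = true ∧ P i = true
  · rw [h4 i (Finset.mem_univ _) hi.1 hi.2]
    exact le_top
  · have : (α ⊓ P) i = false := by
      rw [Pi.inf_apply]
      cases hα : α i <;> cases hP : P i <;> simp_all
    rw [this]
    exact bot_le

end BoolRel

end MinOnes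

/-! ### Partial constraints and sunflowers -/

namespace MinOnes

noncomputable instance decidableEqRel (Γ : Finset BoolRel) : DecidableEq {R : BoolRel // R ∈ Γ} :=
  Classical.decEq _

/-- A constraint, given by a relation and a list of variables. -/
abbrev RawConstraint (Γ : Finset BoolRel) (V : Type) : Type := {R : BoolRel // R ∈ Γ} × List V

/-- A constraint some of whose positions hold the constant zero (`none`) instead of a variable. -/
abbrev PartialConstraint (Γ : Finset BoolRel) (V : Type) : Type :=
  {R : BoolRel // R ∈ Γ} × List (Option V)

section Partial

variable {Γ : Finset BoolRel} {V : Type} [DecidableEq V]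

/-- The value of a position of a partial constraint. -/
def val (a : V → Bool) (v : List (Option V)) (i : ℕ) : Bool := (v.getD i none).elim false a

/-- The assignment `a` satisfies the partial constraint `t`. -/
def PartialConstraint.Holds (t : PartialConstraint Γ V) (a : V → Bool) : Prop :=
  (fun i : Fin t.1.1.arity => val a t.2 i) ∈ t.1.1.tuples

/-- `w` arises from `v` by filling in variables. -/
def extends? (v w : List (Option V)) : Bool :=
  (v.zip w).all fun p => !p.1.isSome || decide (p.1 = p.2)

/-- The variables of `w` in the positions where `v` has none. -/
def petal (v w : List (Option V)) : List V :=
  (v.zip w).filterMap fun p => bif p.1.isSome then none else p.2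

/-- Keep the variables in the positions that are marked in the mask. -/
def applyMask (m : List Bool) (x : List V) : List (Option V) :=
  (m.zip x).map fun p => bif p.1 then some p.2 else none

/-- The number of positions without a variable. -/
def nones (v : List (Option V)) : ℕ := (v.filter fun o => !o.isSome).length

/-- All masks of a given length. -/
noncomputable def masks (r : ℕ) : List (List Bool) :=
  (Finset.univ : Finset (Fin r → Bool)).toList.map List.ofFn

theorem mem_masks {r : ℕ} {m : List Bool} : m ∈ masks r ↔ m.length = r := by
  constructor
  · intro h
    simp only [masks, List.mem_map] at h
    obtain ⟨f, -, rfl⟩ := h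
    simp
  · rintro rfl
    simp only [masks, List.mem_map]
    exact ⟨m.get, by simp, List.ofFn_get m⟩

omit [DecidableEq V] in
@[simp] theorem length_applyMask {m : List Bool} {x : List V} :
    (applyMask m x).length = min m.length x.length := by
  simp [applyMask]

omit [DecidableEq V] in
theorem applyMask_getD (m : List Bool) : ∀ (x : List V) (i : ℕ), m.length = x.length →
    (applyMask m x).getD i none = if m.getD i false then x[i]? else none := by
  induction m with
  | nil => intro x i h; simp [applyMask]
  | cons b m ih =>
    intro x i h
    cases x with
    | nil => simp at h
    | cons y x =>
      cases i with
      | zero => cases b <;> simp [applyMask]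
      | succ i => simpa [applyMask] using ih x i (by simpa using h)

theorem extends?_iff (v : List (Option V)) : ∀ w : List (Option V), v.length = w.length →
    (extends? v w = true ↔ ∀ i, v.getD i none = none ∨ v.getD i none = w.getD i none) := by
  induction v with
  | nil => intro w _; simp [extends?]
  | cons x v ih =>
    intro w h
    cases w with
    | nil => simp at h
    | cons y w =>
      have h1 := ih w (by simpa using h)
      rw [← Nat.and_forall_add_one]
      simp only [List.getD_cons_zero, List.getD_cons_succ, ← h1]
      cases x <;> simp [extends?]

omit [DecidableEq V] in
theorem mem_petal_iff (v : List (Option V)) : ∀ (w : List (Option V)) (x : V),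
    v.length = w.length →
    (x ∈ petal v w ↔ ∃ i < v.length, v.getD i none = none ∧ w.getD i none = some x) := by
  induction v with
  | nil => intro w x _; simp [petal]
  | cons o v ih =>
    intro w x h
    cases w with
    | nil => simp at h
    | cons o' w =>
      have h1 := ih w x (by simpa using h)
      have h2 : x ∈ petal (o :: v) (o' :: w) ↔ (o = none ∧ o' = some x) ∨ x ∈ petal v w := by
        cases o <;> cases o' <;> simp [petal, eq_comm]
      rw [h2, h1]
      constructor
      · rintro (⟨h3, h4⟩ | ⟨i, h3, h4, h5⟩)
        · exact ⟨0, by simp, by simpa using h3, by simpa using h4⟩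
        · exact ⟨i + 1, by simpa using h3, by simpa using h4, by simpa using h5⟩
      · rintro ⟨i, h3, h4, h5⟩
        cases i with
        | zero => exact .inl ⟨by simpa using h4, by simpa using h5⟩
        | succ i => exact .inr ⟨i, by simpa using h3, by simpa using h4, by simpa using h5⟩

omit [DecidableEq V] in
theorem length_petal_le (v w : List (Option V)) : (petal v w).length ≤ v.length :=
  (List.length_filterMap_le _ _).trans (by simp)

/-- A partial constraint follows from an extension whose additional variables are all zero. -/
theorem holds_of_petal_eq_false {R : {R : BoolRel // R ∈ Γ}} {v w : List (Option V)}
    {a : V → Bool} (hvw : v.length = w.length) (hR : v.length = R.1.arity)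
    (he : extends? v w = true) (ha : ∀ x ∈ petal v w, a x = false)
    (hw : PartialConstraint.Holds (R, w) a) : PartialConstraint.Holds (R, v) a := by
  unfold PartialConstraint.Holds at *
  convert hw using 2 with i
  rcases (extends?_iff v w hvw).1 he i with h | h
  · simp only [val, h, Option.elim_none]
    rcases hx : w.getD i none with _ | x
    · rfl
    · exact (ha x ((mem_petal_iff v w x hvw).2 ⟨i, by rw [hR]; exact i.2, h, hx⟩)).symm
  · simp only [val, h]

/-- Add `u` to a packing of extensions of `t` with disjoint petals, if possible; the packing
is represented by its size and by the list of variables in its petals. -/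
noncomputable def packStep (t : PartialConstraint Γ V) (s : ℕ × List V)
    (u : PartialConstraint Γ V) : ℕ × List V :=
  if (decide (u.1 = t.1) && extends? t.2 u.2 &&
      (petal t.2 u.2).all fun x => !decide (x ∈ s.2)) = true then
    (s.1 + 1, petal t.2 u.2 ++ s.2)
  else s

/-- A maximal packing of extensions of `t` in `L` with disjoint petals. -/
noncomputable def packing (L : List (PartialConstraint Γ V)) (t : PartialConstraint Γ V) :
    ℕ × List V :=
  L.foldl (packStep t) (0, [])

theorem packStep_cases (t : PartialConstraint Γ V) (s : ℕ × List V) (u : PartialConstraint Γ V) :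
    (u.1 = t.1 ∧ extends? t.2 u.2 = true ∧ (∀ x ∈ petal t.2 u.2, x ∉ s.2) ∧
      packStep t s u = (s.1 + 1, petal t.2 u.2 ++ s.2)) ∨
    (packStep t s u = s ∧ (u.1 = t.1 → extends? t.2 u.2 = true →
      ∃ x ∈ petal t.2 u.2, x ∈ s.2)) := by
  by_cases h : (decide (u.1 = t.1) && extends? t.2 u.2 &&
      (petal t.2 u.2).all fun x => !decide (x ∈ s.2)) = true
  · refine .inl ?_
    rw [packStep, if_pos h]
    simp only [Bool.and_eq_true, decide_eq_true_eq, List.all_eq_true, Bool.not_eq_true',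
      decide_eq_false_iff_not] at h
    exact ⟨h.1.1, h.1.2, h.2, rfl⟩
  · refine .inr ?_
    rw [packStep, if_neg h]
    refine ⟨rfl, fun h1 h2 => ?_⟩
    by_contra! h3
    exact h (by simpa [h1, h2] using h3)

/-- If more than `k` extensions of `t` with disjoint petals hold, then `t` holds under every
assignment of weight at most `k`. -/
theorem holds_of_lt_packing {L : List (PartialConstraint Γ V)} {t : PartialConstraint Γ V}
    {a : V → Bool} {W : Finset V} {k : ℕ} (ht : t.2.length = t.1.1.arity)
    (hL : ∀ u ∈ L, u.2.length = u.1.1.arity ∧ u.Holds a ∧ ∀ x, some x ∈ u.2 → x ∈ W)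
    (hk : (W.filter fun x => a x = true).card ≤ k) (h : k < (packing L t).1) : t.Holds a := by
  by_contra hneg
  -- If `t` fails, each petal contains a true variable. The set `T` collects one from each petal,
  -- and disjointness makes them distinct, giving more than `k` true variables.
  have key : ∀ (L : List (PartialConstraint Γ V)) (s : ℕ × List V),
      (∀ u ∈ L, u.2.length = u.1.1.arity ∧ u.Holds a ∧ ∀ x, some x ∈ u.2 → x ∈ W) →
      (∃ T : Finset V, T.card = s.1 ∧ ∀ x ∈ T, x ∈ s.2 ∧ x ∈ W ∧ a x = true) →
      ∃ T : Finset V, T.card = (L.foldl (packStep t) s).1 ∧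
        ∀ x ∈ T, x ∈ (L.foldl (packStep t) s).2 ∧ x ∈ W ∧ a x = true := by
    intro L
    induction L with
    | nil => exact fun s _ h => h
    | cons u L ih =>
      rintro s hL ⟨T, hT, hT'⟩
      refine ih _ (fun u' hu' => hL u' (List.mem_cons_of_mem _ hu')) ?_
      rcases packStep_cases t s u with ⟨h1, h2, h3, h4⟩ | ⟨h1, -⟩
      · rw [h4]
        obtain ⟨hu, hu', hW⟩ := hL u List.mem_cons_self
        have hlen : t.2.length = u.2.length := by rw [ht, hu, h1]
        have : ∃ x ∈ petal t.2 u.2, a x = true := by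
          by_contra! hall
          refine hneg (holds_of_petal_eq_false (R := t.1) hlen ht h2 (fun x hx => by
            simpa using hall x hx) ?_)
          rw [← h1]
          exact hu'
        obtain ⟨x, hx, hax⟩ := this
        refine ⟨insert x T, ?_, fun y hy => ?_⟩
        · rw [Finset.card_insert_of_notMem fun hxT => h3 x hx (hT' x hxT).1, hT]
        · rcases Finset.mem_insert.1 hy with rfl | hy
          · obtain ⟨i, hi, -, h6⟩ := (mem_petal_iff _ _ _ hlen).1 hx
            refine ⟨List.mem_append_left _ hx, hW _ ?_, hax⟩
            rw [← h6, List.getD_eq_getElem _ _ (hlen ▸ hi)]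
            exact List.getElem_mem _
          · exact ⟨List.mem_append_right _ (hT' y hy).1, (hT' y hy).2⟩
      · rw [h1]
        exact ⟨T, hT, hT'⟩
  obtain ⟨T, hT, hT'⟩ := key L (0, []) hL ⟨∅, rfl, by simp⟩
  have : T.card ≤ (W.filter fun x => a x = true).card :=
    Finset.card_le_card fun x hx => by simpa using (hT' x hx).2
  rw [packing] at h
  omega

theorem length_packing_le (L : List (PartialConstraint Γ V)) (t : PartialConstraint Γ V) :
    (packing L t).2.length ≤ (packing L t).1 * t.2.length := by
  have key : ∀ (L : List (PartialConstraint Γ V)) (s : ℕ × List V),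
      s.2.length ≤ s.1 * t.2.length →
      (L.foldl (packStep t) s).2.length ≤ (L.foldl (packStep t) s).1 * t.2.length := by
    intro L
    induction L with
    | nil => exact fun s h => h
    | cons u L ih =>
      intro s hs
      refine ih _ ?_
      rcases packStep_cases t s u with ⟨-, -, -, h4⟩ | ⟨h1, -⟩
      · rw [h4]
        have := length_petal_le t.2 u.2
        simp only [List.length_append, add_mul, one_mul]
        omega
      · rwa [h1]
  exact key L _ (by simp)

/-- Every extension of `t` with a nonempty petal meets the maximal packing. -/
theorem exists_mem_packing {L : List (PartialConstraint Γ V)} {t u : PartialConstraint Γ V}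
    (hu : u ∈ L) (h1 : u.1 = t.1) (h2 : extends? t.2 u.2 = true) (h3 : petal t.2 u.2 ≠ []) :
    ∃ x ∈ petal t.2 u.2, x ∈ (packing L t).2 := by
  have mono : ∀ (L : List (PartialConstraint Γ V)) (s : ℕ × List V), ∀ x ∈ s.2,
      x ∈ (L.foldl (packStep t) s).2 := by
    intro L
    induction L with
    | nil => exact fun s x h => h
    | cons u L ih =>
      intro s x hx
      refine ih _ x ?_
      rcases packStep_cases t s u with ⟨-, -, -, h4⟩ | ⟨h1, -⟩
      · rw [h4]
        exact List.mem_append_right _ hx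
      · rwa [h1]
  -- When the greedy procedure considers `u`, either its petal is added or it already meets the
  -- packing; variables are never removed later.
  have key : ∀ (L : List (PartialConstraint Γ V)) (s : ℕ × List V), u ∈ L →
      ∃ x ∈ petal t.2 u.2, x ∈ (L.foldl (packStep t) s).2 := by
    intro L
    induction L with
    | nil => simp
    | cons u' L ih =>
      intro s hu
      rcases List.mem_cons.1 hu with rfl | hu
      · rcases packStep_cases t s u with ⟨-, -, -, h4⟩ | ⟨-, h5⟩
        · obtain ⟨x, hx⟩ := List.exists_mem_of_ne_nil _ h3
          exact ⟨x, hx, mono L _ x (by rw [h4]; exact List.mem_append_left _ hx)⟩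
        · obtain ⟨x, hx, hx'⟩ := h5 h1 h2
          refine ⟨x, hx, mono (u :: L) _ x hx'⟩
      · exact ih _ hu
  exact key L _ hu

/-- The partial constraints that arise from the constraints of `F`. -/
noncomputable def candidates (F : List (RawConstraint Γ V)) : List (PartialConstraint Γ V) :=
  F.flatMap fun c => (masks c.1.1.arity).map fun m => (c.1, applyMask m c.2)

/-- The partial constraints with at most `m` positions without a variable that are found to hold
under all satisfying assignments of `F` of weight at most `k`. -/
noncomputable def forced (F : List (RawConstraint Γ V)) (k : ℕ) : ℕ → List (PartialConstraint Γ V)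
  | 0 => F.map fun c => (c.1, c.2.map some)
  | m + 1 => forced F k m ++ (candidates F).filter fun t =>
      decide (nones t.2 = m + 1) && decide (k + 1 ≤ (packing (forced F k m) t).1)

end Partial

end MinOnes

/-! ### Counting minimal forced constraints -/

namespace MinOnes

section Counting

variable {Γ : Finset BoolRel} {V : Type} [DecidableEq V]

/-- Every constraint of `F` has the right number of variables. -/
def WellFormed (F : List (RawConstraint Γ V)) : Prop := ∀ c ∈ F, c.2.length = c.1.1.arity

/-- The variables of a list of constraints, with repetitions. -/
def rawVars (F : List (RawConstraint Γ V)) : List V := F.flatMap Prod.snd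

/-- The constraints in `F` hold under `a`. -/
def RawSatisfies (F : List (RawConstraint Γ V)) (a : V → Bool) : Prop :=
  ∀ c ∈ F, PartialConstraint.Holds (c.1, c.2.map some) a

/-- The number of variables of `F` that are true under `a`. -/
def rawWeight (F : List (RawConstraint Γ V)) (a : V → Bool) : ℕ :=
  ((rawVars F).toFinset.filter fun x => a x = true).card

omit [DecidableEq V] in
theorem ext_getD {v w : List (Option V)} (h : v.length = w.length)
    (h' : ∀ i < v.length, v.getD i none = w.getD i none) : v = w := by
  refine List.ext_getElem h fun i h1 h2 => ?_
  have := h' i h1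
  rwa [List.getD_eq_getElem _ _ h1, List.getD_eq_getElem _ _ h2] at this

/-- A position empty in `v` is either still empty in `w` or supplies one entry of the petal. -/
theorem nones_eq_add_petal (v : List (Option V)) : ∀ w : List (Option V), v.length = w.length →
    extends? v w = true → nones v = nones w + (petal v w).length := by
  induction v with
  | nil =>
    intro w h _
    have : w = [] := List.length_eq_zero_iff.1 h.symm
    subst this
    rfl
  | cons x v ih =>
    intro w h he
    cases w with
    | nil => simp at h
    | cons y w =>
      simp only [extends?, List.zip_cons_cons, List.all_cons, Bool.and_eq_true] at he
      have h1 := ih w (by simpa using h) he.2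
      have h2 := he.1
      simp only [nones, petal] at h1 ⊢
      cases x <;> cases y <;> simp_all <;> omega

theorem petal_ne_nil {v w : List (Option V)} (h : v.length = w.length)
    (he : extends? v w = true) (hne : v ≠ w) : petal v w ≠ [] := by
  intro hp
  refine hne (ext_getD h fun i hi => ?_)
  rcases (extends?_iff v w h).1 he i with h1 | h1
  · rcases h2 : w.getD i none with _ | x
    · exact h1
    · have := (mem_petal_iff v w x h).2 ⟨i, hi, h1, h2⟩
      simp [hp] at this
  · exact h1

omit [DecidableEq V] in
theorem nones_le_length (v : List (Option V)) : nones v ≤ v.length := List.length_filter_le _ _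

omit [DecidableEq V] in
theorem nones_set (v : List (Option V)) (x : V) : ∀ i < v.length, v.getD i none = none →
    nones (v.set i (some x)) + 1 = nones v := by
  induction v with
  | nil => simp
  | cons o v ih =>
    intro i hi h
    cases i with
    | zero =>
      have : o = none := by simpa using h
      subst this
      simp [nones]
    | succ i =>
      have := ih i (by simpa using hi) (by simpa using h)
      simp only [nones, List.set_cons_succ] at this ⊢
      cases o <;> simp_all

theorem extends?_set {v w : List (Option V)} {i : ℕ} {x : V} (h : v.length = w.length)
    (he : extends? v w = true) (hi : i < v.length) (hx : w.getD i none = some x) :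
    extends? (v.set i (some x)) w = true := by
  rw [extends?_iff _ _ (by simpa using h)]
  intro j
  by_cases hj : i = j
  · subst hj
    right
    rw [hx, List.getD_eq_getElem _ _ (by simpa using hi)]
    simp
  · have := (extends?_iff _ _ h).1 he j
    simpa [List.getD_eq_getElem?_getD, List.getElem?_set_ne hj] using this

omit [DecidableEq V] in
theorem map_some_eq_applyMask (x : List V) :
    x.map some = applyMask (List.replicate x.length true) x := by
  induction x with
  | nil => rfl
  | cons y x ih =>
    rw [List.length_cons, List.replicate_succ, List.map_cons, ih]
    simp [applyMask]

variable {F : List (RawConstraint Γ V)} {k : ℕ}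

omit [DecidableEq V] in
theorem mem_candidates {t : PartialConstraint Γ V} : t ∈ candidates F ↔
    ∃ c ∈ F, ∃ m : List Bool, m.length = c.1.1.arity ∧ t = (c.1, applyMask m c.2) := by
  simp only [candidates, List.mem_flatMap, List.mem_map, mem_masks]
  exact ⟨fun ⟨c, h1, m, h2, h3⟩ => ⟨c, h1, m, h2, h3.symm⟩,
    fun ⟨c, h1, m, h2, h3⟩ => ⟨c, h1, m, h2, h3.symm⟩⟩

omit [DecidableEq V] in
theorem length_of_mem_candidates (hF : WellFormed F) {t : PartialConstraint Γ V}
    (ht : t ∈ candidates F) : t.2.length = t.1.1.arity := by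
  obtain ⟨c, hc, m, hm, rfl⟩ := mem_candidates.1 ht
  simp [hm, hF c hc]

omit [DecidableEq V] in
theorem mem_rawVars_of_mem_candidates {t : PartialConstraint Γ V} (ht : t ∈ candidates F) {x : V}
    (hx : some x ∈ t.2) : x ∈ rawVars F := by
  obtain ⟨c, hc, m, hm, rfl⟩ := mem_candidates.1 ht
  simp only [applyMask, List.mem_map] at hx
  obtain ⟨⟨b, y⟩, hy, h⟩ := hx
  have : y = x := by cases b <;> simp_all
  subst this
  exact List.mem_flatMap.2 ⟨c, hc, (List.of_mem_zip hy).2⟩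

/-- Candidates are closed under removing variables: `v` is the same constraint of `F` under the mask
of its occupied positions. -/
theorem mem_candidates_of_extends? (hF : WellFormed F) {R : {R : BoolRel // R ∈ Γ}}
    {v w : List (Option V)} (hw : (R, w) ∈ candidates F) (h : v.length = w.length)
    (he : extends? v w = true) : (R, v) ∈ candidates F := by
  obtain ⟨c, hc, m, hm, h'⟩ := mem_candidates.1 hw
  simp only [Prod.mk.injEq] at h'
  obtain ⟨rfl, rfl⟩ := h'
  have hl := hF c hc
  have hv : v.length = c.1.1.arity := by rw [h]; simp [hm, hl]
  refine mem_candidates.2 ⟨c, hc, v.map Option.isSome, by simpa using hv, ?_⟩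
  refine congrArg _ (ext_getD (by simp [hv, hl]) fun i hi => ?_)
  rw [applyMask_getD _ _ _ (by simp [hv, hl])]
  rcases (extends?_iff _ _ h).1 he i with h1 | h1
  · rw [h1, if_neg]
    rw [List.getD_eq_getElem _ _ hi] at h1
    rw [List.getD_eq_getElem _ _ (by simpa using hi)]
    simp [h1]
  · rw [applyMask_getD _ _ _ (by rw [hm, hl])] at h1
    rcases h2 : v.getD i none with _ | x
    · rw [if_neg]
      rw [List.getD_eq_getElem _ _ hi] at h2
      rw [List.getD_eq_getElem _ _ (by simpa using hi)]
      simp [h2]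
    · rw [if_pos]
      · rw [h2] at h1
        split_ifs at h1
        exact h1
      · rw [List.getD_eq_getElem _ _ hi] at h2
        rw [List.getD_eq_getElem _ _ (by simpa using hi)]
        simp [h2]

theorem mem_forced_zero (hF : WellFormed F) {t : PartialConstraint Γ V} (ht : t ∈ candidates F)
    (h : nones t.2 = 0) : t ∈ forced F k 0 := by
  obtain ⟨c, hc, m, hm, rfl⟩ := mem_candidates.1 ht
  have hl := hF c hc
  refine List.mem_map.2 ⟨c, hc, congrArg _ (ext_getD (by simp [hm, hl]) fun i hi => ?_)⟩
  simp only [nones, List.length_eq_zero_iff, List.filter_eq_nil_iff] at h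
  have hi' : i < (applyMask m c.2).length := by simpa [hm, hl] using hi
  have h1 := h _ (List.getElem_mem hi')
  have h2 := applyMask_getD m c.2 i (by rw [hm, hl])
  rw [List.getD_eq_getElem _ _ hi'] at h2 ⊢
  rw [h2] at h1 ⊢
  rw [List.getD_eq_getElem?_getD]
  split_ifs at h1 ⊢
  · rw [List.length_map] at hi
    simp [hi]
  · simp at h1

theorem forced_subset_candidates (hF : WellFormed F) (m : ℕ) :
    forced F k m ⊆ candidates F := by
  induction m with
  | zero =>
    intro t ht
    obtain ⟨c, hc, rfl⟩ := List.mem_map.1 ht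
    exact mem_candidates.2 ⟨c, hc, List.replicate c.2.length true, by simpa using hF c hc,
      congrArg _ (map_some_eq_applyMask _)⟩
  | succ m ih =>
    intro t ht
    rcases List.mem_append.1 ht with h | h
    · exact ih h
    · exact List.mem_of_mem_filter h

theorem forced_mono {m m' : ℕ} (h : m ≤ m') : forced F k m ⊆ forced F k m' := by
  induction h with
  | refl => exact fun t ht => ht
  | step _ ih => exact fun t ht => List.mem_append_left _ (ih ht)

/-- Round `m + 1` adds only partial constraints with exactly `m + 1` empty positions, so anything
forced later already occurs at the level of its own number of empty positions. -/
theorem mem_forced_of_nones_le {m m' : ℕ} {t : PartialConstraint Γ V} (ht : t ∈ forced F k m')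
    (h : nones t.2 ≤ m) : t ∈ forced F k m := by
  induction m' with
  | zero => exact forced_mono m.zero_le ht
  | succ m' ih =>
    by_cases hm : m' + 1 ≤ m
    · exact forced_mono hm ht
    · rcases List.mem_append.1 ht with h' | h'
      · exact ih h'
      · have := (List.mem_filter.1 h').2
        simp only [Bool.and_eq_true, decide_eq_true_eq] at this
        omega

/-- Soundness of the sunflower rule, by induction on the rounds: each new element has more than `k`
disjoint petals over it. -/
theorem forced_holds (hF : WellFormed F) {a : V → Bool} (ha : RawSatisfies F a)
    (hk : rawWeight F a ≤ k) (m : ℕ) : ∀ t ∈ forced F k m, t.Holds a := by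
  induction m with
  | zero =>
    intro t ht
    obtain ⟨c, hc, rfl⟩ := List.mem_map.1 ht
    exact ha c hc
  | succ m ih =>
    intro t ht
    rcases List.mem_append.1 ht with h | h
    · exact ih t h
    · obtain ⟨h1, h2⟩ := List.mem_filter.1 h
      simp only [Bool.and_eq_true, decide_eq_true_eq] at h2
      refine holds_of_lt_packing (W := (rawVars F).toFinset) (length_of_mem_candidates hF h1)
        (fun u hu => ?_) hk h2.2
      have hu' := forced_subset_candidates hF m hu
      exact ⟨length_of_mem_candidates hF hu', ih u hu, fun x hx => by
        simpa using mem_rawVars_of_mem_candidates hu' hx⟩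

/-- The partial constraints in `L` that are not proper extensions of others. -/
noncomputable def minimal (L : List (PartialConstraint Γ V)) : List (PartialConstraint Γ V) :=
  L.filter fun t => L.all fun s => !(decide (s.1 = t.1) && extends? s.2 t.2) || decide (s = t)

theorem mem_minimal {L : List (PartialConstraint Γ V)} {t : PartialConstraint Γ V} :
    t ∈ minimal L ↔ t ∈ L ∧ ∀ s ∈ L, s.1 = t.1 → extends? s.2 t.2 = true → s = t := by
  simp only [minimal, List.mem_filter, List.all_eq_true, Bool.or_eq_true, Bool.not_eq_true',
    Bool.and_eq_false_iff, decide_eq_true_eq, decide_eq_false_iff_not]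
  refine and_congr_right fun _ => forall₂_congr fun s _ => ?_
  rw [← Bool.not_eq_true]
  tauto

/-- If `(R, v)` is forced, it is the only minimal element that can extend `v`. Otherwise the
sunflower rule did not apply to it, so the maximal packing has at most `k` petals, and its variables
`H` meet the petal of every minimal extension. -/
theorem minimal_extends_cases (hF : WellFormed F) {d : ℕ} {R : {R : BoolRel // R ∈ Γ}}
    (hd : R.1.arity ≤ d) {v : List (Option V)} (hv : v.length = R.1.arity) :
    ((minimal (forced F k d)).toFinset.filter fun t =>
      t.1 = R ∧ extends? v t.2 = true).card ≤ 1 ∨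
    ∃ H : List V, H.length ≤ k * R.1.arity ∧ 0 < nones v ∧
      ∀ t ∈ minimal (forced F k d), t.1 = R → extends? v t.2 = true →
        ∃ i < v.length, v.getD i none = none ∧ ∃ x ∈ H, t.2.getD i none = some x := by
  by_cases hmem : (R, v) ∈ forced F k d
  · refine .inl (Finset.card_le_one.2 fun s hs t ht => ?_)
    simp only [Finset.mem_filter, List.mem_toFinset, mem_minimal] at hs ht
    rw [← hs.1.2 (R, v) hmem hs.2.1.symm hs.2.2, ← ht.1.2 (R, v) hmem ht.2.1.symm ht.2.2]
  by_cases hS : ∃ t ∈ minimal (forced F k d), t.1 = R ∧ extends? v t.2 = true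
  · right
    obtain ⟨⟨R', w⟩, hw, rfl, he⟩ := hS
    have hlen : ∀ t ∈ minimal (forced F k d), t.2.length = t.1.1.arity := fun t ht =>
      length_of_mem_candidates hF (forced_subset_candidates hF d (mem_minimal.1 ht).1)
    have hcand := mem_candidates_of_extends? hF
      (forced_subset_candidates hF d (mem_minimal.1 hw).1) (hv.trans (hlen _ hw).symm) he
    have hpos : 0 < nones v := by
      by_contra h0
      exact hmem (forced_mono d.zero_le (mem_forced_zero hF hcand (by simp at h0 ⊢; omega)))
    -- A proper extension of `v` has at most `n` empty positions, hence lies in level `n`, the level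
    -- from which petals over `v` are packed.
    obtain ⟨n, hn⟩ : ∃ n, nones v = n + 1 := ⟨nones v - 1, by omega⟩
    have hnd : n + 1 ≤ d := by
      have := nones_le_length v
      omega
    have hpack : (packing (forced F k n) (R', v)).1 ≤ k := by
      by_contra! hlt
      refine hmem (forced_mono hnd (List.mem_append_right _ (List.mem_filter.2 ⟨hcand, ?_⟩)))
      simpa [hn] using hlt
    refine ⟨(packing (forced F k n) (R', v)).2, ?_, hpos, ?_⟩
    · refine (length_packing_le _ _).trans ?_
      rw [hv]
      exact Nat.mul_le_mul_right _ hpack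
    · intro t ht hR he'
      have hl : v.length = t.2.length := by rw [hv, hlen t ht, hR]
      have hne : v ≠ t.2 := by
        rintro rfl
        exact hmem (hR ▸ (mem_minimal.1 ht).1)
      have hp := petal_ne_nil hl he' hne
      have h1 := nones_eq_add_petal v t.2 hl he'
      have h2 := List.length_pos_iff.2 hp
      obtain ⟨x, hx, hx'⟩ := exists_mem_packing (t := (R', v))
        (mem_forced_of_nones_le (m := n) (mem_minimal.1 ht).1 (by omega)) hR he' hp
      obtain ⟨i, hi, h3, h4⟩ := (mem_petal_iff _ _ _ hl).1 hx
      exact ⟨i, hi, h3, x, hx', h4⟩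
  · left
    rw [Finset.filter_eq_empty_iff.2]
    · simp
    · intro t ht h
      exact hS ⟨t, by simpa using ht, h⟩

/-- The number of minimal forced partial constraints that extend a given one. -/
theorem card_minimal_extends_le (hF : WellFormed F) {d : ℕ} {R : {R : BoolRel // R ∈ Γ}}
    (hd : R.1.arity ≤ d) (n : ℕ) : ∀ v : List (Option V), v.length = R.1.arity → nones v ≤ n →
      ((minimal (forced F k d)).toFinset.filter fun t =>
        t.1 = R ∧ extends? v t.2 = true).card ≤
        (R.1.arity * (k * R.1.arity) + 1) ^ n := by
  induction n with
  | zero =>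
    intro v hv hn
    rcases minimal_extends_cases (k := k) hF hd hv with h | ⟨H, -, h, -⟩
    · simpa using h
    · omega
  | succ n ih =>
    intro v hv hn
    rcases minimal_extends_cases (k := k) hF hd hv with h | ⟨H, hH, h, hcov⟩
    -- The summand 1 in the base keeps the power positive, so that it also bounds this unbranched
    -- case.
    · exact h.trans (Nat.one_le_pow _ _ (Nat.succ_pos _))
    · have hlen : ∀ t ∈ minimal (forced F k d), t.2.length = t.1.1.arity := fun t ht =>
        length_of_mem_candidates hF (forced_subset_candidates hF d (mem_minimal.1 ht).1)
      -- One branch for each empty position and each hitting variable; filling that position lowers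
      -- the number of empty positions by one.
      have hsub : ((minimal (forced F k d)).toFinset.filter fun t =>
          t.1 = R ∧ extends? v t.2 = true) ⊆
          (((Finset.range v.length).filter fun i => v.getD i none = none) ×ˢ H.toFinset).biUnion
            fun p => (minimal (forced F k d)).toFinset.filter fun t =>
              t.1 = R ∧ extends? (v.set p.1 (some p.2)) t.2 = true := by
        intro t ht
        simp only [Finset.mem_filter, List.mem_toFinset] at ht
        obtain ⟨ht, hR, he⟩ := ht
        obtain ⟨i, hi, hvi, x, hx, hti⟩ := hcov t ht hR he
        simp only [Finset.mem_biUnion, Finset.mem_product, Finset.mem_filter, Finset.mem_range,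
          List.mem_toFinset]
        exact ⟨(i, x), ⟨⟨hi, hvi⟩, hx⟩, ht, hR,
          extends?_set (by rw [hv, hlen t ht, hR]) he hi hti⟩
      refine (Finset.card_le_card hsub).trans ((Finset.card_biUnion_le_card_mul _ _
        ((R.1.arity * (k * R.1.arity) + 1) ^ n) fun p hp => ?_).trans ?_)
      · simp only [Finset.mem_product, Finset.mem_filter, Finset.mem_range] at hp
        refine ih _ (by simpa using hv) ?_
        have := nones_set v p.2 p.1 hp.1.1 hp.1.2
        omega
      · rw [pow_succ', Finset.card_product]
        refine Nat.mul_le_mul_right _ (Nat.le_succ_of_le (Nat.mul_le_mul ?_ ?_))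
        · exact (Finset.card_filter_le _ _).trans (by simp [hv])
        · exact (List.toFinset_card_le _).trans hH

/-- The number of minimal forced partial constraints. -/
theorem card_minimal_le (hF : WellFormed F) {d : ℕ} (hd : ∀ R ∈ Γ, R.arity ≤ d) :
    (minimal (forced F k d)).toFinset.card ≤ Γ.card * (d * (k * d) + 1) ^ d := by
  -- Everything of the right length extends the tuple without variables, where the branching starts.
  have h : (minimal (forced F k d)).toFinset = Finset.univ.biUnion fun R =>
      (minimal (forced F k d)).toFinset.filter fun t =>
        t.1 = R ∧ extends? (List.replicate R.1.arity none) t.2 = true := by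
    ext t
    simp only [List.mem_toFinset, Finset.mem_biUnion, Finset.mem_univ, Finset.mem_filter,
      true_and]
    refine ⟨fun ht => ⟨t.1, ht, rfl, ?_⟩, fun ⟨_, ht, _⟩ => ht⟩
    rw [extends?_iff]
    · intro i
      left
      rw [List.getD_eq_getElem?_getD, List.getElem?_replicate]
      split_ifs <;> rfl
    · rw [List.length_replicate]
      exact (length_of_mem_candidates hF
        (forced_subset_candidates hF d (mem_minimal.1 ht).1)).symm
  rw [h]
  refine (Finset.card_biUnion_le_card_mul _ _ ((d * (k * d) + 1) ^ d) fun R _ => ?_).trans ?_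
  · have hR := hd R.1 R.2
    refine (card_minimal_extends_le hF hR R.1.arity _ (by simp)
      ((nones_le_length _).trans (by simp))).trans ?_
    calc (R.1.arity * (k * R.1.arity) + 1) ^ R.1.arity
        ≤ (d * (k * d) + 1) ^ R.1.arity := by gcongr
      _ ≤ (d * (k * d) + 1) ^ d := Nat.pow_le_pow_right (Nat.succ_pos _) hR
  · simp

/-- Every forced partial constraint extends a minimal one. -/
theorem exists_minimal_extends (hF : WellFormed F) {d : ℕ} {t : PartialConstraint Γ V}
    (ht : t ∈ forced F k d) :
    ∃ s ∈ minimal (forced F k d), s.1 = t.1 ∧ extends? s.2 t.2 = true := by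
  have hlen : ∀ t ∈ forced F k d, t.2.length = t.1.1.arity := fun t ht =>
    length_of_mem_candidates hF (forced_subset_candidates hF d ht)
  -- A forced partial constraint below `t` with the most empty positions is minimal, since any
  -- proper restriction of it has more.
  obtain ⟨s, hs, hmax⟩ := ((forced F k d).toFinset.filter fun s : PartialConstraint Γ V =>
    s.1 = t.1 ∧ extends? s.2 t.2 = true).exists_max_image (fun s => nones s.2)
    ⟨t, by simpa using ⟨ht, (extends?_iff _ _ rfl).2 fun i => .inr rfl⟩⟩
  simp only [Finset.mem_filter, List.mem_toFinset] at hs hmax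
  obtain ⟨hs, hR, he⟩ := hs
  refine ⟨s, mem_minimal.2 ⟨hs, fun s' hs' hR' he' => ?_⟩, hR, he⟩
  by_contra hne
  have h1 : s'.2.length = s.2.length := by rw [hlen _ hs, hlen _ hs', hR']
  have h2 : s.2.length = t.2.length := by rw [hlen _ hs, hlen _ ht, hR]
  have h3 := nones_eq_add_petal _ _ h1 he'
  have h4 := List.length_pos_iff.2 (petal_ne_nil h1 he' fun h => hne (Prod.ext hR' h))
  have h5 := hmax s' ⟨hs', hR'.trans hR, (extends?_iff _ _ (h1.trans h2)).2 fun i => by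
    rcases (extends?_iff _ _ h1).1 he' i with h | h
    · exact .inl h
    · rw [h]
      exact (extends?_iff _ _ h2).1 he i⟩
  omega

end Counting

end MinOnes

/-! ### A small set of variables that supports some solution -/

namespace MinOnes

open StackProg (uniq nodup_uniq mem_uniq)

/-! ### Bounded reachability in directed graphs. -/

section Reach

variable {V : Type} [DecidableEq V]

/-- Add to `S` the elements of `U` that can be reached from `S` by an arc of `E`. -/
def closeStep (U : List V) (E : List (V × V)) (S : List V) : List V :=
  U.filter fun y => decide (y ∈ S) || E.any fun e => decide (e.2 = y) && decide (e.1 ∈ S)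

/-- The elements of `U` that can be reached from `x` by at most `n` arcs of `E`. -/
def reach (U : List V) (E : List (V × V)) (n : ℕ) (x : V) : List V :=
  (closeStep U E)^[n] (U.filter fun y => decide (y = x))

variable {U : List V} {E : List (V × V)} {x : V}

theorem reach_succ (n : ℕ) : reach U E (n + 1) x = closeStep U E (reach U E n x) :=
  Function.iterate_succ_apply' ..

theorem reach_sublist (n : ℕ) : (reach U E n x).Sublist U := by
  cases n with
  | zero => exact List.filter_sublist
  | succ n => rw [reach_succ]; exact List.filter_sublist

theorem reach_subset_succ (n : ℕ) : reach U E n x ⊆ reach U E (n + 1) x := by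
  intro y hy
  rw [reach_succ]
  exact List.mem_filter.2 ⟨(reach_sublist n).subset hy, by simp [hy]⟩

theorem self_mem_reach (hx : x ∈ U) (n : ℕ) : x ∈ reach U E n x := by
  induction n with
  | zero => exact List.mem_filter.2 ⟨hx, by simp⟩
  | succ n ih => exact reach_subset_succ n ih

/-- Truth spreads along arcs, so a true variable forces its whole reachable set to be true. -/
theorem forall_mem_reach {a : V → Bool} (hE : ∀ e ∈ E, a e.1 = true → a e.2 = true)
    (hx : a x = true) (n : ℕ) : ∀ y ∈ reach U E n x, a y = true := by
  induction n with
  | zero =>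
    intro y hy
    have := (List.mem_filter.1 hy).2
    rw [decide_eq_true_eq] at this
    rwa [this]
  | succ n ih =>
    intro y hy
    rw [reach_succ] at hy
    have := (List.mem_filter.1 hy).2
    simp only [Bool.or_eq_true, decide_eq_true_eq, List.any_eq_true, Bool.and_eq_true] at this
    rcases this with h | ⟨e, he, rfl, h⟩
    · exact ih y h
    · exact hE e he (ih _ h)

/-- Each round adds an element until the set is stable. With at most `k` elements after `k + 1`
rounds, stability has been reached. -/
theorem reach_closed (hU : U.Nodup) {k : ℕ} (h : (reach U E (k + 1) x).length ≤ k) {e : V × V}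
    (he : e ∈ E) (h1 : e.1 ∈ reach U E (k + 1) x) (h2 : e.2 ∈ U) :
    e.2 ∈ reach U E (k + 1) x := by
  have key : ∀ n, n ≤ (reach U E n x).length ∨ reach U E (n + 1) x ⊆ reach U E n x := by
    intro n
    induction n with
    | zero => exact .inl (Nat.zero_le _)
    | succ n ih =>
      by_cases hs : reach U E (n + 1) x ⊆ reach U E n x
      · right
        intro y hy
        rw [reach_succ] at hy
        rw [reach_succ]
        obtain ⟨hy1, hy2⟩ := List.mem_filter.1 hy
        refine List.mem_filter.2 ⟨hy1, ?_⟩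
        simp only [Bool.or_eq_true, decide_eq_true_eq, List.any_eq_true, Bool.and_eq_true]
          at hy2 ⊢
        rcases hy2 with h | ⟨e, he, h, h'⟩
        · exact .inl (hs h)
        · exact .inr ⟨e, he, h, hs h'⟩
      · left
        have h3 := ih.resolve_right hs
        obtain ⟨y, hy, hy'⟩ := Set.not_subset.1 hs
        have h4 : (y :: reach U E n x).length ≤ (reach U E (n + 1) x).length := by
          refine (List.subperm_of_subset ?_ ?_).length_le
          · exact List.nodup_cons.2 ⟨hy', hU.sublist (reach_sublist n)⟩
          · exact List.cons_subset.2 ⟨hy, reach_subset_succ n⟩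
        rw [List.length_cons] at h4
        omega
  refine (key (k + 1)).resolve_left (by omega) ?_
  rw [reach_succ]
  refine List.mem_filter.2 ⟨h2, ?_⟩
  simp only [Bool.or_eq_true, decide_eq_true_eq, List.any_eq_true, Bool.and_eq_true]
  exact .inr ⟨e, he, rfl, h1⟩

end Reach

/-! ### The support: closure of the variables in minimal constraints under valid implications. -/

section Support

variable {Γ : Finset BoolRel} {V : Type} [DecidableEq V] [Inhabited V]

/-- The set of positions that is given by a mask. -/
def maskFun (r : ℕ) (m : List Bool) : Fin r → Bool := fun i => m.getD i false

/-- The list of all masks of positions of a relation, each with the implications between positions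
that hold for the corresponding sunflower restriction. -/
noncomputable def implications (R : {R : BoolRel // R ∈ Γ}) : List (List Bool × List (ℕ × ℕ)) :=
  open Classical in
  (masks R.1.arity).map fun m => (m,
    ((Finset.univ.filter fun p : Fin R.1.arity × Fin R.1.arity =>
      R.1.Implies (maskFun _ m) p.1 p.2).toList.map fun p => (p.1.1, p.2.1)))

/-- The implications between variables of `F` that follow from the partial constraints in `L`. -/
noncomputable def arcs (F : List (RawConstraint Γ V)) (L : List (PartialConstraint Γ V)) :
    List (V × V) :=
  F.flatMap fun c => (implications c.1).flatMap fun p =>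
    if (c.1, applyMask p.1 c.2) ∈ L then
      p.2.map fun q => (c.2.getD q.1 default, c.2.getD q.2 default)
    else []

/-- The variables in minimal partial constraints. -/
noncomputable def coreVars (L : List (PartialConstraint Γ V)) : List V :=
  uniq ((minimal L).flatMap fun t => t.2.filterMap fun o => o)

/-- The set of variables to which the formula `F` is restricted. -/
noncomputable def support (F : List (RawConstraint Γ V)) (k d : ℕ) : List V :=
  uniq <| (coreVars (forced F k d)).flatMap fun x =>
    if (reach (uniq (rawVars F)) (arcs F (forced F k d)) (k + 1) x).length ≤ k then
      reach (uniq (rawVars F)) (arcs F (forced F k d)) (k + 1) x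
    else []

/-- The tuple of values of the variables of a constraint. -/
def tup (c : RawConstraint Γ V) (a : V → Bool) : Fin c.1.1.arity → Bool :=
  fun i => a (c.2.getD i default)

omit [DecidableEq V] in
theorem holds_applyMask {c : RawConstraint Γ V} (hc : c.2.length = c.1.1.arity) {m : List Bool}
    (hm : m.length = c.1.1.arity) {a : V → Bool} :
    PartialConstraint.Holds (c.1, applyMask m c.2) a ↔
      tup c a ⊓ maskFun _ m ∈ c.1.1.tuples := by
  unfold PartialConstraint.Holds
  apply iff_of_eq
  congr 1
  funext i
  have hi : (i : ℕ) < c.2.length := by rw [hc]; exact i.2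
  simp only [val, applyMask_getD _ _ _ (hm.trans hc.symm), tup, maskFun, Pi.inf_apply]
  cases h : m.getD i false <;> simp [hi]

omit [DecidableEq V] in
theorem holds_map_some {c : RawConstraint Γ V} (hc : c.2.length = c.1.1.arity) {a : V → Bool} :
    PartialConstraint.Holds (c.1, c.2.map some) a ↔ tup c a ∈ c.1.1.tuples := by
  unfold PartialConstraint.Holds
  apply iff_of_eq
  congr 1
  funext i
  have hi : (i : ℕ) < c.2.length := by rw [hc]; exact i.2
  simp [val, tup, hi]

omit [Inhabited V] in
theorem eq_applyMask_of_extends? {v : List (Option V)} {x : List V} (h : v.length = x.length)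
    (he : extends? v (x.map some) = true) : v = applyMask (v.map Option.isSome) x := by
  refine ext_getD (by simp [h]) fun i hi => ?_
  rw [applyMask_getD _ _ _ (by simpa using h)]
  have h1 := (extends?_iff _ _ (by simpa using h)).1 he i
  have h2 : (v.map Option.isSome).getD i false = (v.getD i none).isSome := by
    rw [List.getD_eq_getElem _ _ (by simpa using hi), List.getD_eq_getElem _ _ hi]
    simp
  rw [h2]
  rcases h1 with h1 | h1
  · rw [h1]; rfl
  · have h3 : (x.map some).getD i none = x[i]? := by
      rw [List.getD_eq_getElem?_getD]
      simp [h ▸ hi]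
    rw [h1, h3]
    cases x[i]? <;> rfl

variable {F : List (RawConstraint Γ V)} {k d : ℕ}

/-- The masked constraint is forced, so the tuple of a light solution and its restriction to the
mask are both in the relation; the implication applies to precisely such tuples. -/
theorem arcs_valid (hF : WellFormed F) {a : V → Bool} (ha : RawSatisfies F a)
    (hk : rawWeight F a ≤ k) :
    ∀ e ∈ arcs F (forced F k d), a e.1 = true → a e.2 = true := by
  intro e he
  simp only [arcs, implications, List.mem_flatMap, List.mem_map, mem_masks] at he
  obtain ⟨c, hc, _, ⟨m, hm, rfl⟩, he⟩ := he
  split_ifs at he with hL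
  · simp only [List.mem_map, Finset.mem_toList, Finset.mem_filter, Finset.mem_univ,
      true_and] at he
    obtain ⟨_, ⟨p, hp, rfl⟩, rfl⟩ := he
    exact hp (tup c a) ((holds_map_some (hF c hc)).1 (ha c hc))
      ((holds_applyMask (hF c hc) hm).1 (forced_holds hF ha hk d _ hL))
  · simp at he

theorem mem_arcs {c : RawConstraint Γ V} (hc : c ∈ F) {m : List Bool}
    (hm : m.length = c.1.1.arity) (hL : (c.1, applyMask m c.2) ∈ forced F k d)
    {i j : Fin c.1.1.arity} (h : c.1.1.Implies (maskFun _ m) i j) :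
    (c.2.getD i default, c.2.getD j default) ∈ arcs F (forced F k d) := by
  classical
  refine List.mem_flatMap.2 ⟨c, hc, List.mem_flatMap.2 ⟨_, List.mem_map.2
    ⟨m, mem_masks.2 hm, rfl⟩, ?_⟩⟩
  rw [if_pos hL]
  refine List.mem_map.2 ⟨(i.1, j.1), List.mem_map.2 ⟨(i, j), ?_, rfl⟩, rfl⟩
  simpa using h

omit [DecidableEq V] in
theorem getD_mem_rawVars (hF : WellFormed F) {c : RawConstraint Γ V} (hc : c ∈ F)
    (i : Fin c.1.1.arity) : c.2.getD i default ∈ rawVars F := by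
  have hi : (i : ℕ) < c.2.length := by rw [hF c hc]; exact i.2
  rw [List.getD_eq_getElem _ _ hi]
  exact List.mem_flatMap.2 ⟨c, hc, List.getElem_mem hi⟩

theorem mem_support {x : V} : x ∈ support F k d ↔ ∃ y ∈ coreVars (forced F k d),
    (reach (uniq (rawVars F)) (arcs F (forced F k d)) (k + 1) y).length ≤ k ∧
      x ∈ reach (uniq (rawVars F)) (arcs F (forced F k d)) (k + 1) y := by
  simp only [support, mem_uniq, List.mem_flatMap]
  refine exists_congr fun y => and_congr_right fun _ => ?_
  split_ifs with h <;> simp [h]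

theorem support_subset : support F k d ⊆ rawVars F := by
  intro x hx
  obtain ⟨y, -, -, h⟩ := mem_support.1 hx
  exact mem_uniq.1 ((reach_sublist _).subset h)

/-- A variable outside the support that is in a minimal partial constraint is false under all
satisfying assignments of small weight. -/
theorem eq_false_of_mem_coreVars (hF : WellFormed F) {a : V → Bool} (ha : RawSatisfies F a)
    (hk : rawWeight F a ≤ k) {x : V} (hx : x ∈ coreVars (forced F k d)) (hx' : x ∈ rawVars F)
    (hs : x ∉ support F k d) : a x = false := by
  by_contra hax
  rw [Bool.not_eq_false] at hax
  refine hs (mem_support.2 ⟨x, hx, ?_, self_mem_reach (mem_uniq.2 hx') _⟩)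
  -- If `x` were true, so would be all it reaches, at most `k` variables; then `x` would be in the
  -- support.
  have h1 := forall_mem_reach (U := uniq (rawVars F)) (arcs_valid (d := d) hF ha hk) hax (k + 1)
  refine le_trans ?_ hk
  rw [← List.toFinset_card_of_nodup ((nodup_uniq _).sublist (reach_sublist _))]
  refine Finset.card_le_card fun y hy => ?_
  rw [List.mem_toFinset] at hy
  simpa using ⟨mem_uniq.1 ((reach_sublist _).subset hy), h1 y hy⟩

/-- A solution of small weight remains a solution when all variables outside the support are set
to zero. -/
theorem satisfies_support (hΓ : ∀ R ∈ Γ, R.Mergeable) (hF : WellFormed F) {a : V → Bool}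
    (ha : RawSatisfies F a) (hk : rawWeight F a ≤ k) :
    RawSatisfies F fun x => a x && decide (x ∈ support F k d) := by
  intro c hc
  have hl := hF c hc
  obtain ⟨⟨R, v⟩, hs, hR, he⟩ := exists_minimal_extends hF (t := (c.1, c.2.map some))
    (forced_mono d.zero_le (List.mem_map_of_mem (f := fun c : RawConstraint Γ V =>
      (c.1, c.2.map some)) hc) : _ ∈ forced F k d)
  simp only at hR he
  subst hR
  have hs' := (mem_minimal.1 hs).1
  have hv : v.length = c.1.1.arity :=
    length_of_mem_candidates hF (forced_subset_candidates hF d hs')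
  have hvm := eq_applyMask_of_extends? (hv.trans hl.symm) he
  set m := v.map Option.isSome with hm
  have hml : m.length = c.1.1.arity := by simpa [hm] using hv
  rw [hvm] at hs'
  rw [holds_map_some hl]
  have hα := (holds_map_some hl).1 (ha c hc)
  have hαD := (holds_applyMask hl hml).1 (forced_holds hF ha hk d _ hs')
  -- The set `P` contains the core `D` as well as the support, as the restriction lemma demands.
  -- Core variables outside the support are false anyway, so restricting to `P` is the same as
  -- restricting to the support.
  have key := (hΓ _ c.1.2).restrict_mem (D := maskFun _ m) (P := fun i =>
    maskFun _ m i || decide (c.2.getD i default ∈ support F k d)) (fun i => ?_)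
    (fun i j hPi hDi hij => ?_) hα hαD
  · convert key using 1
    funext i
    simp only [tup, Pi.inf_apply]
    by_cases hx : c.2.getD i default ∈ support F k d
    · simp only [hx, decide_true, Bool.and_true, Bool.or_true]
      exact (inf_top_eq _).symm
    · cases hD : maskFun c.1.1.arity m i with
      | false =>
        simp only [hx, decide_false, Bool.and_false, Bool.or_false]
        exact (inf_bot_eq _).symm
      | true =>
        have : a (c.2.getD i default) = false := by
          refine eq_false_of_mem_coreVars hF ha hk (d := d) ?_ (getD_mem_rawVars hF hc i) hx
          refine mem_uniq.2 (List.mem_flatMap.2 ⟨_, hs, List.mem_filterMap.2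
            ⟨some (c.2.getD i default), ?_, rfl⟩⟩)
          have h1 := applyMask_getD m c.2 i (hml.trans hl.symm)
          have hi : (i : ℕ) < c.2.length := by rw [hl]; exact i.2
          have hi' : (i : ℕ) < v.length := by rw [hv]; exact i.2
          rw [← hvm, show m.getD i false = true from hD, if_pos rfl,
            List.getD_eq_getElem _ _ hi', List.getElem?_eq_getElem hi] at h1
          rw [List.getD_eq_getElem _ _ hi, ← h1]
          exact List.getElem_mem hi'
        simp only [this, Bool.false_and]
        simp
  · cases h : maskFun c.1.1.arity m i with
    | false => exact bot_le
    | true => simp [h]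
  · simp only [hDi, Bool.false_or, decide_eq_true_eq] at hPi
    obtain ⟨y, hy, h1, h2⟩ := mem_support.1 hPi
    have h3 := mem_arcs hc hml hs' hij
    -- Position `i` is outside `D`, so its variable is in one of the small reachable sets; that set
    -- is closed and contains the variable at `j` too.
    have h4 := reach_closed (nodup_uniq _) h1 h3 h2 (mem_uniq.2 (getD_mem_rawVars hF hc j))
    simp only [Bool.or_eq_true, decide_eq_true_eq]
    exact .inr (mem_support.2 ⟨y, hy, h1, h4⟩)

omit [Inhabited V] in
theorem length_coreVars_le (hF : WellFormed F) (hd : ∀ R ∈ Γ, R.arity ≤ d) :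
    (coreVars (forced F k d)).length ≤ Γ.card * (d * (k * d) + 1) ^ d * d := by
  rw [coreVars, ← List.toFinset_card_of_nodup (nodup_uniq _)]
  refine le_trans ?_ (Nat.mul_le_mul_right _ (card_minimal_le (k := k) hF hd))
  refine le_trans (Finset.card_le_card ?_) (Finset.card_biUnion_le_card_mul
    (minimal (forced F k d)).toFinset (fun t => (t.2.filterMap fun o => o).toFinset) d
      fun t ht => ?_)
  · intro x hx
    simpa only [List.mem_toFinset, mem_uniq, List.mem_flatMap, Finset.mem_biUnion] using hx
  · rw [List.mem_toFinset] at ht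
    refine (List.toFinset_card_le _).trans ((List.length_filterMap_le _ _).trans ?_)
    rw [length_of_mem_candidates hF (forced_subset_candidates hF d (mem_minimal.1 ht).1)]
    exact hd _ t.1.2

/-- Each of the `O(k ^ d)` variables in minimal constraints contributes a reachable set of at most
`k` elements. -/
theorem length_support_le (hF : WellFormed F) (hd : ∀ R ∈ Γ, R.arity ≤ d) :
    (support F k d).length ≤ Γ.card * (d * (k * d) + 1) ^ d * d * k := by
  refine le_trans ?_ (Nat.mul_le_mul_right _ (length_coreVars_le (k := k) hF hd))
  rw [support, ← List.toFinset_card_of_nodup (nodup_uniq _)]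
  have h1 : ∀ l : List V, (uniq l).toFinset = l.toFinset := fun l => by ext; simp
  rw [h1]
  refine (List.toFinset_card_le _).trans ?_
  rw [List.length_flatMap]
  refine (List.sum_le_card_nsmul _ k fun n hn => ?_).trans (by simp)
  obtain ⟨x, -, rfl⟩ := List.mem_map.1 hn
  split_ifs with h
  · exact h
  · simp

end Support

end MinOnes

/-! ### The kernel -/

namespace MinOnes

open StackProg (uniq nodup_uniq mem_uniq)

section Kernel

variable {Γ : Finset BoolRel} {V W : Type} [DecidableEq V] [DecidableEq W]

/-- `F` has a satisfying assignment of weight at most `k`. -/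
def RawSolvable (F : List (RawConstraint Γ V)) (k : ℕ) : Prop :=
  ∃ a, RawSatisfies F a ∧ rawWeight F a ≤ k

omit [DecidableEq V] [DecidableEq W] in
theorem holds_map {R : {R : BoolRel // R ∈ Γ}} {x : List V} {f : V → W} {a : W → Bool} :
    PartialConstraint.Holds (R, (x.map f).map some) a ↔
      PartialConstraint.Holds (R, x.map some) fun y => a (f y) := by
  unfold PartialConstraint.Holds
  apply iff_of_eq
  congr 1
  funext i
  simp only [val, List.getD_eq_getElem?_getD, List.getElem?_map]
  cases x[(i : ℕ)]? <;> rfl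

omit [DecidableEq V] in
theorem holds_congr {R : {R : BoolRel // R ∈ Γ}} {x : List V} {a a' : V → Bool}
    (h : ∀ y ∈ x, a y = a' y) :
    PartialConstraint.Holds (R, x.map some) a ↔ PartialConstraint.Holds (R, x.map some) a' := by
  unfold PartialConstraint.Holds
  apply iff_of_eq
  congr 1
  funext i
  simp only [val, List.getD_eq_getElem?_getD, List.getElem?_map]
  rcases hx : x[(i : ℕ)]? with _ | y
  · rfl
  · exact h y (List.mem_of_getElem? hx)

/-- The variables in `X` receive new names; all others are replaced by the `i`-th of the
variables that stand for zero. -/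
def rename (name : ℕ → W) (X : List V) (k i : ℕ) (x : V) : W :=
  if x ∈ X then name (k + 1 + X.idxOf x) else name i

/-- The restriction of `F` to the variables in `X`. -/
noncomputable def kernel (name : ℕ → W) (F : List (RawConstraint Γ V)) (X : List V) (k : ℕ) :
    List (RawConstraint Γ W) :=
  -- There is one copy for each zero variable. Removing repetitions makes the size depend on the
  -- number of names instead of the length of `F`.
  uniq <| F.flatMap fun c => (List.range (k + 1)).map fun i =>
    (c.1, c.2.map (rename name X k i))

variable {name : ℕ → W} {F : List (RawConstraint Γ V)} {X : List V} {k : ℕ}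

theorem mem_kernel {c : RawConstraint Γ W} : c ∈ kernel name F X k ↔
    ∃ c' ∈ F, ∃ i ≤ k, c = (c'.1, c'.2.map (rename name X k i)) := by
  simp only [kernel, mem_uniq, List.mem_flatMap, List.mem_map, List.mem_range,
    Nat.lt_succ_iff]
  exact ⟨fun ⟨c', h, i, h', e⟩ => ⟨c', h, i, h', e.symm⟩,
    fun ⟨c', h, i, h', e⟩ => ⟨c', h, i, h', e.symm⟩⟩

theorem wellFormed_kernel (hF : WellFormed F) : WellFormed (kernel name F X k) := by
  intro c hc
  obtain ⟨c', hc', i, -, rfl⟩ := mem_kernel.1 hc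
  simpa using hF c' hc'

theorem mem_rawVars_kernel {c : RawConstraint Γ V} (hc : c ∈ F) {x : V} (hx : x ∈ c.2) {i : ℕ}
    (hi : i ≤ k) : rename name X k i x ∈ rawVars (kernel name F X k) :=
  List.mem_flatMap.2 ⟨_, mem_kernel.2 ⟨c, hc, i, hi, rfl⟩, List.mem_map_of_mem hx⟩

theorem exists_of_mem_rawVars_kernel {y : W} (hy : y ∈ rawVars (kernel name F X k)) :
    ∃ n < k + 1 + X.length, y = name n := by
  obtain ⟨c, hc, hy⟩ := List.mem_flatMap.1 hy
  obtain ⟨c', hc', i, hi, rfl⟩ := mem_kernel.1 hc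
  obtain ⟨x, -, rfl⟩ := List.mem_map.1 hy
  unfold rename
  split_ifs with hx
  · exact ⟨_, by have := List.idxOf_lt_length_of_mem hx; omega, rfl⟩
  · exact ⟨i, by omega, rfl⟩

/-- All zero variables are set to false and the renamed elements of `X` keep their values, so every
copy takes the values of the original constraint. -/
theorem kernel_solvable (hname : Function.Injective name) (hX : X ⊆ rawVars F) {a : V → Bool}
    (ha : RawSatisfies F a) (hk : rawWeight F a ≤ k) (haX : ∀ x, x ∉ X → a x = false) :
    RawSolvable (kernel name F X k) k := by
  classical
  let b : W → Bool := fun y => decide (∃ x ∈ X, a x = true ∧ y = name (k + 1 + X.idxOf x))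
  have hb : ∀ i ≤ k, ∀ x, b (rename name X k i x) = a x := by
    intro i hi x
    rw [Bool.eq_iff_iff]
    simp only [b, decide_eq_true_eq, rename]
    split_ifs with hx
    · refine ⟨?_, fun h => ⟨x, hx, h, rfl⟩⟩
      rintro ⟨x', hx', h, h'⟩
      have := hname h'
      have hxx : x = x' := (List.idxOf_inj hx).1 (by omega)
      rwa [hxx]
    · rw [haX x hx]
      simp only [Bool.false_eq_true, iff_false]
      rintro ⟨x', hx', h, h'⟩
      have := hname h'
      omega
  refine ⟨b, fun c hc => ?_, ?_⟩
  · obtain ⟨c', hc', i, hi, rfl⟩ := mem_kernel.1 hc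
    rw [holds_map]
    simpa only [hb i hi] using ha c' hc'
  · refine le_trans ?_ hk
    refine le_trans (Finset.card_le_card ?_) (Finset.card_image_le
      (f := fun x => name (k + 1 + X.idxOf x)))
    intro y hy
    simp only [Finset.mem_filter, b, decide_eq_true_eq] at hy
    obtain ⟨-, x, hx, h, rfl⟩ := hy
    exact Finset.mem_image.2 ⟨x, by simpa using ⟨hX hx, h⟩, rfl⟩

/-- A solution of the kernel is read off from the copy whose zero variable is false, the variables
outside `X` being set to zero. Neither mergeability nor a particular choice of `X` is needed. -/
theorem solvable_of_kernel (hname : Function.Injective name)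
    (h : RawSolvable (kernel name F X k) k) : RawSolvable F k := by
  classical
  obtain ⟨b, hb, hk⟩ := h
  -- Weight at most `k` cannot make `k + 1` distinct zero variables true. One that does not occur is
  -- also suitable, since then its copies contain no variable from outside `X`.
  obtain ⟨i, hi, hzero⟩ : ∃ i ≤ k, name i ∈ rawVars (kernel name F X k) → b (name i) = false := by
    by_contra! hall
    have : (Finset.range (k + 1)).card ≤ rawWeight (kernel name F X k) b := by
      rw [rawWeight, ← Finset.card_image_of_injective _ hname]
      refine Finset.card_le_card fun y hy => ?_
      obtain ⟨i, hi, rfl⟩ := Finset.mem_image.1 hy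
      have := hall i (Nat.lt_succ_iff.1 (Finset.mem_range.1 hi))
      simpa using this
    rw [Finset.card_range] at this
    omega
  refine ⟨fun x => decide (x ∈ X) && b (name (k + 1 + X.idxOf x)), fun c hc => ?_, ?_⟩
  · have h1 := hb _ (mem_kernel.2 ⟨c, hc, i, hi, rfl⟩)
    rw [holds_map] at h1
    refine (holds_congr fun x hx => ?_).1 h1
    by_cases hxX : x ∈ X
    · simp [rename, hxX]
    · have h2 := mem_rawVars_kernel (name := name) (X := X) hc hx hi
      simp only [rename, hxX, if_false] at h2 ⊢
      simp [hzero h2]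
  · refine le_trans ?_ hk
    refine Finset.card_le_card_of_injOn (fun x => name (k + 1 + X.idxOf x)) ?_ ?_
    · intro x hx
      simp only [Finset.coe_filter, List.mem_toFinset, Bool.and_eq_true, decide_eq_true_eq,
        Set.mem_ofPred_eq] at hx ⊢
      obtain ⟨hx, hxX, hbx⟩ := hx
      obtain ⟨c, hc, hxc⟩ := List.mem_flatMap.1 hx
      have h2 := mem_rawVars_kernel (name := name) (X := X) hc hxc hi
      rw [rename, if_pos hxX] at h2
      exact ⟨h2, hbx⟩
    · intro x hx y hy hxy
      simp only [Finset.coe_filter, List.mem_toFinset, Bool.and_eq_true, decide_eq_true_eq,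
        Set.mem_ofPred_eq] at hx hy
      have := hname hxy
      exact (List.idxOf_inj hx.2.1).1 (by omega)

theorem solvable_kernel_support_iff [Inhabited V] (hΓ : ∀ R ∈ Γ, R.Mergeable)
    (hname : Function.Injective name) (hF : WellFormed F) {d : ℕ} :
    RawSolvable (kernel name F (support F k d) k) k ↔ RawSolvable F k := by
  refine ⟨solvable_of_kernel hname, fun ⟨a, ha, hk⟩ => ?_⟩
  refine kernel_solvable hname support_subset (satisfies_support hΓ hF ha hk (d := d)) ?_ ?_
  · refine le_trans (Finset.card_le_card fun x hx => ?_) hk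
    simp only [Finset.mem_filter, Bool.and_eq_true] at hx ⊢
    exact ⟨hx.1, hx.2.1⟩
  · intro x hx
    simp [hx]

theorem card_rawVars_kernel_le :
    (rawVars (kernel name F X k)).toFinset.card ≤ k + 1 + X.length := by
  refine le_trans (Finset.card_le_card (t := (Finset.range (k + 1 + X.length)).image name) ?_)
    (Finset.card_image_le.trans (by simp))
  intro y hy
  obtain ⟨n, hn, rfl⟩ := exists_of_mem_rawVars_kernel (List.mem_toFinset.1 hy)
  exact Finset.mem_image.2 ⟨n, by simpa using hn, rfl⟩

/-- The constraints are distinct, so they can be counted as a relation together with a tuple over at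
most `k + 1 + X.length` names. -/
theorem length_kernel_le (hF : WellFormed F) {d : ℕ} (hd : ∀ R ∈ Γ, R.arity ≤ d) :
    (kernel name F X k).length ≤ Γ.card * (k + 1 + X.length) ^ d := by
  classical
  have hnd : (kernel name F X k).Nodup := nodup_uniq _
  rw [← List.toFinset_card_of_nodup hnd]
  set S := (rawVars (kernel name F X k)).toFinset with hS
  have hsub : (kernel name F X k).toFinset ⊆ Finset.univ.biUnion fun R : {R // R ∈ Γ} =>
      (Fintype.piFinset fun _ : Fin R.1.arity => S).image fun f => (R, List.ofFn f) := by
    intro c hc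
    rw [List.mem_toFinset] at hc
    refine Finset.mem_biUnion.2 ⟨c.1, Finset.mem_univ _, Finset.mem_image.2
      ⟨fun i => c.2[(i : ℕ)]'(by rw [wellFormed_kernel hF c hc]; exact i.2), ?_, ?_⟩⟩
    · rw [Fintype.mem_piFinset]
      intro i
      rw [hS, List.mem_toFinset]
      exact List.mem_flatMap.2 ⟨c, hc, List.getElem_mem _⟩
    · refine Prod.ext rfl (List.ext_getElem ?_ ?_)
      · simp [wellFormed_kernel hF c hc]
      · simp
  refine (Finset.card_le_card hsub).trans ((Finset.card_biUnion_le_card_mul _ _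
    ((k + 1 + X.length) ^ d) fun R _ => ?_).trans (by simp))
  refine Finset.card_image_le.trans ?_
  rw [Fintype.card_piFinset, Finset.prod_const, Finset.card_univ, Fintype.card_fin]
  calc S.card ^ R.1.arity ≤ (k + 1 + X.length) ^ R.1.arity :=
        Nat.pow_le_pow_left card_rawVars_kernel_le _
    _ ≤ (k + 1 + X.length) ^ d := Nat.pow_le_pow_right (by omega) (hd _ R.2)

end Kernel

end MinOnes

/-! ### The kernel is computed in polynomial time -/

noncomputable instance MinOnes.encRel (Γ : Finset MinOnes.BoolRel) :
    StackProg.Enc {R : MinOnes.BoolRel // R ∈ Γ} := StackProg.Enc.ofFinite _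

namespace StackProg

open MinOnes (BoolRel RawConstraint PartialConstraint)

section PolyTime

variable {A α V : Type} [Enc α] [Enc V] {Γ : Finset BoolRel}

theorem FP.petal {v w : α → List (Option V)} (hv : FP A v) (hw : FP A w) :
    FP A fun x => MinOnes.petal (v x) (w x) :=
  FP.filterMap (α := α) (f := fun _ (p : Option V × Option V) => bif p.1.isSome then Option.none
    else p.2) (hv.zip hw) (.cond (.isSome (.fst' .snd)) .none (.snd' .snd))

theorem FP.applyMask {m : α → List Bool} {v : α → List V} (hm : FP A m) (hv : FP A v) :
    FP A fun x => MinOnes.applyMask (m x) (v x) :=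
  FP.map (α := α) (f := fun _ (p : Bool × V) => bif p.1 then Option.some p.2
    else Option.none) (hm.zip hv)
    (.cond (.fst' .snd) (.some (.snd' .snd)) .none)

theorem FP.nones {v : α → List (Option V)} (hv : FP A v) : FP A fun x => MinOnes.nones (v x) :=
  .length (FP.filter (α := α) (f := fun _ (o : Option V) => !o.isSome) hv (FP.isSome .snd).not)

theorem FP.candidates {F : α → List (RawConstraint Γ V)} (hF : FP A F) :
    FP A fun x => MinOnes.candidates (F x) :=
  FP.flatMap (α := α) (f := fun _ (c : RawConstraint Γ V) =>
      (MinOnes.masks c.1.1.arity).map fun m => (c.1, MinOnes.applyMask m c.2)) hF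
    (.map (f := fun (y : α × RawConstraint Γ V) m => (y.2.1, MinOnes.applyMask m y.2.2))
      ((FP.of_finite fun R : {R : BoolRel // R ∈ Γ} => MinOnes.masks R.1.arity).comp (.fst' .snd))
      (.pair (.fst' (.snd' .fst)) (.applyMask .snd (.snd' (.snd' .fst)))))

theorem FP.rawVars {F : α → List (RawConstraint Γ V)} (hF : FP A F) :
    FP A fun x => MinOnes.rawVars (F x) :=
  .flatMap (α := α) (f := fun _ (c : RawConstraint Γ V) => c.2) hF (.snd' .snd)

variable [DecidableEq V]

theorem FP.extends? {v w : α → List (Option V)} (hv : FP A v) (hw : FP A w) :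
    FP A fun x => MinOnes.extends? (v x) (w x) :=
  FP.all (α := α) (f := fun _ (p : Option V × Option V) => !p.1.isSome || decide (p.1 = p.2))
    (hv.zip hw) (.or (FP.isSome (.fst' .snd)).not (.decide_eq (.fst' .snd) (.snd' .snd)))

theorem FP.packing {L : α → List (PartialConstraint Γ V)} {t : α → PartialConstraint Γ V}
    (hL : FP A L) (ht : FP A t) : FP A fun x => MinOnes.packing (L x) (t x) := by
  have hp : FP A fun x : PartialConstraint Γ V × PartialConstraint Γ V =>
      MinOnes.petal x.1.2 x.2.2 := .petal (.snd' .fst) (.snd' .snd)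
  obtain ⟨p, hp'⟩ := hp.size_le
  have h : FP A fun y : PartialConstraint Γ V × List (PartialConstraint Γ V) =>
      MinOnes.packing y.2 y.1 := by
    refine FP.foldl (f := fun y : PartialConstraint Γ V × List (PartialConstraint Γ V) =>
        MinOnes.packStep y.1) (g := fun y => y.2) (h := fun _ => ((0, []) : ℕ × List V))
      .snd (.const _) ?_ ⟨p.comp (Polynomial.X + 1) + 2, fun x s u => ?_⟩
    · have hpet := hp.comp (f := fun x : (PartialConstraint Γ V × List (PartialConstraint Γ V)) ×
        (ℕ × List V) × PartialConstraint Γ V => (x.1.1, x.2.2)) (.pair (.fst' .fst) (.snd' .snd))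
      refine .ite (p := fun x => _ = true) ?_ (.pair (.succ (.fst' (.fst' .snd)))
        (.append hpet (.snd' (.fst' .snd)))) (.fst' .snd)
      simp only [Bool.decide_eq_true]
      refine .and (.and (.decide_eq (.fst' (.snd' .snd)) (.fst' (.fst' .fst)))
        (.extends? (.snd' (.fst' .fst)) (.snd' (.snd' .snd))))
        (FP.all (f := fun x v => !decide (v ∈ x.2.1.2)) hpet
          (FP.decide_mem .snd (.snd' (.fst' (.snd' .fst)))).not)
    · rcases MinOnes.packStep_cases x.1 s u with ⟨-, -, -, h⟩ | ⟨h, -⟩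
      · have h1 := hp' (x.1, u)
        have h2 := size_append (MinOnes.petal x.1.2 u.2) s.2
        have h3 : p.eval (size (x.1, u)) ≤ p.eval (size x + size u + 1) :=
          eval_mono _ (by
            simp only [size_prod]; omega)
        rw [h]
        simp [size_prod] at *
        omega
      · rw [h]; omega
  exact h.comp (ht.pair hL)

/-- The number of rounds is a fixed parameter of the program, so only a constant number of
polynomial-time rounds is composed and no growth bound on the rounds is required. -/
theorem FP.forced {F : α → List (RawConstraint Γ V)} {k : α → ℕ} (hF : FP A F) (hk : FP A k)
    (m : ℕ) : FP A fun x => MinOnes.forced (F x) (k x) m := by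
  induction m with
  | zero =>
    exact FP.map (α := α) (f := fun _ (c : RawConstraint Γ V) => (c.1, c.2.map Option.some)) hF
      (.pair (.fst' .snd) (FP.map (f := fun _ v => Option.some v) (.snd' .snd) (.some .snd)))
  | succ m ih =>
    exact ih.append (.filter (f := fun x (t : PartialConstraint Γ V) =>
      decide (MinOnes.nones t.2 = m + 1) &&
        decide (k x + 1 ≤ (MinOnes.packing (MinOnes.forced (F x) (k x) m) t).1)) hF.candidates
      (.and (.decide_eq (.nones (.snd' .snd)) (.const _))
        (.decide_le (.succ (hk.comp .fst)) (.fst' (.packing (ih.comp .fst) .snd)))))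

theorem FP.minimal {L : α → List (PartialConstraint Γ V)} (hL : FP A L) :
    FP A fun x => MinOnes.minimal (L x) :=
  .filter (f := fun x (t : PartialConstraint Γ V) => (L x).all fun s =>
      !(decide (s.1 = t.1) && MinOnes.extends? s.2 t.2) || decide (s = t)) hL
    (.all (f := fun (y : α × PartialConstraint Γ V) s =>
        !(decide (s.1 = y.2.1) && MinOnes.extends? s.2 y.2.2) || decide (s = y.2)) (hL.comp .fst)
      (.or (FP.and (.decide_eq (.fst' .snd) (.fst' (.snd' .fst)))
        (.extends? (.snd' .snd) (.snd' (.snd' .fst)))).not (.decide_eq .snd (.snd' .fst))))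

theorem FP.coreVars {L : α → List (PartialConstraint Γ V)} (hL : FP A L) :
    FP A fun x => MinOnes.coreVars (L x) :=
  .uniq (.flatMap (α := α) (f := fun _ (t : PartialConstraint Γ V) => t.2.filterMap fun o => o)
    hL.minimal (.filterMap (f := fun _ o => o) (.snd' .snd) .snd))

theorem FP.arcs [Inhabited V] {F : α → List (RawConstraint Γ V)}
    {L : α → List (PartialConstraint Γ V)} (hF : FP A F) (hL : FP A L) :
    FP A fun x => MinOnes.arcs (F x) (L x) := by
  refine .flatMap (f := fun x (c : RawConstraint Γ V) =>
    (MinOnes.implications c.1).flatMap fun p => if (c.1, MinOnes.applyMask p.1 c.2) ∈ L x then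
      p.2.map fun q => (c.2.getD q.1 default, c.2.getD q.2 default) else []) hF ?_
  refine .flatMap (f := fun (y : α × RawConstraint Γ V) (p : List Bool × List (ℕ × ℕ)) =>
    if (y.2.1, MinOnes.applyMask p.1 y.2.2) ∈ L y.1 then
      p.2.map fun q => (y.2.2.getD q.1 default, y.2.2.getD q.2 default) else [])
    ((FP.of_finite MinOnes.implications).comp (.fst' .snd)) ?_
  refine .ite ((FP.decide_mem (.pair (.fst' (.snd' .fst)) (.applyMask (.fst' .snd)
    (.snd' (.snd' .fst)))) (hL.comp (.fst' .fst))).of_eq fun _ => decide_eq_decide.2 Iff.rfl)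
    ?_ .nil
  exact .map (f := fun (z : (α × RawConstraint Γ V) × List Bool × List (ℕ × ℕ)) (q : ℕ × ℕ) =>
      (z.1.2.2.getD q.1 default, z.1.2.2.getD q.2 default)) (.snd' .snd)
    (.pair (.getD (.snd' (.snd' (.fst' .fst))) (.fst' .snd) (.const _))
      (.getD (.snd' (.snd' (.fst' .fst))) (.snd' .snd) (.const _)))

/-- Every iterate is a sublist of `U`, which bounds the size of the state. -/
theorem FP.reach {U : α → List V} {E : α → List (V × V)} {n : α → ℕ} {v : α → V} (hU : FP A U)
    (hE : FP A E) (hn : FP A n) (hv : FP A v) :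
    FP A fun x => MinOnes.reach (U x) (E x) (n x) (v x) := by
  obtain ⟨p, hp⟩ := hU.size_le
  refine .iterate (f := fun x => MinOnes.closeStep (U x) (E x)) hn
    (.filter (f := fun x y => decide (y = v x)) hU (.decide_eq .snd (hv.comp .fst))) ?_
    ⟨p, fun x s => ?_⟩
  · exact .filter (f := fun (y : α × List V) v => decide (v ∈ y.2) ||
      (E y.1).any fun e => decide (e.2 = v) && decide (e.1 ∈ y.2)) (hU.comp .fst)
      (.or (.decide_mem .snd (.snd' .fst)) (.any (f := fun (z : (α × List V) × V) e =>
        decide (e.2 = z.2) && decide (e.1 ∈ z.1.2)) (hE.comp (.fst' .fst))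
        (.and (.decide_eq (.snd' .snd) (.snd' .fst))
          (.decide_mem (.fst' .snd) (.snd' (.fst' .fst))))))
  · exact (size_le_of_sublist List.filter_sublist).trans ((hp x).trans (Nat.le_add_left _ _))

theorem FP.support [Inhabited V] {F : α → List (RawConstraint Γ V)} {k : α → ℕ} (hF : FP A F)
    (hk : FP A k) (d : ℕ) : FP A fun x => MinOnes.support (F x) (k x) d := by
  have hL := hF.forced hk d
  have hR : FP A fun y : α × V => MinOnes.reach (StackProg.uniq (MinOnes.rawVars (F y.1)))
      (MinOnes.arcs (F y.1) (MinOnes.forced (F y.1) (k y.1) d)) (k y.1 + 1) y.2 :=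
    .reach (FP.uniq (FP.rawVars (hF.comp .fst))) ((hF.comp .fst).arcs (hL.comp .fst))
      (hk.comp .fst).succ .snd
  exact .uniq (.flatMap (f := fun x v => if (MinOnes.reach (StackProg.uniq (MinOnes.rawVars (F x)))
      (MinOnes.arcs (F x) (MinOnes.forced (F x) (k x) d)) (k x + 1) v).length ≤ k x then
      MinOnes.reach (StackProg.uniq (MinOnes.rawVars (F x)))
        (MinOnes.arcs (F x) (MinOnes.forced (F x) (k x) d)) (k x + 1) v else []) hL.coreVars
    (.ite (.decide_le hR.length (hk.comp .fst)) hR .nil))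

theorem FP.kernel {W : Type} [Enc W] [DecidableEq W] {name : ℕ → W} (hname : FP A name)
    {F : α → List (RawConstraint Γ V)} {X : α → List V} {k : α → ℕ} (hF : FP A F) (hX : FP A X)
    (hk : FP A k) : FP A fun x => MinOnes.kernel name (F x) (X x) (k x) := by
  refine .uniq (.flatMap (f := fun x (c : RawConstraint Γ V) => (List.range (k x + 1)).map fun i =>
    (c.1, c.2.map (MinOnes.rename name (X x) (k x) i))) hF ?_)
  refine .map (f := fun (y : α × RawConstraint Γ V) i =>
    (y.2.1, y.2.2.map (MinOnes.rename name (X y.1) (k y.1) i))) (.range (hk.comp .fst).succ) ?_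
  refine .pair (.fst' (.snd' .fst)) (.map (f := fun (z : (α × RawConstraint Γ V) × ℕ) v =>
    MinOnes.rename name (X z.1.1) (k z.1.1) z.2 v) (.snd' (.snd' .fst)) ?_)
  have hX' : FP A fun x : ((α × RawConstraint Γ V) × ℕ) × V => X x.1.1.1 :=
    hX.comp (.fst' (.fst' .fst))
  exact .ite (.decide_mem .snd hX') (hname.comp (.add (.succ (hk.comp (.fst' (.fst' .fst))))
    (.idxOf .snd hX'))) (hname.comp (.snd' .fst))

end PolyTime

end StackProg

/-! ### Formulas and strings -/

namespace MinOnes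

open StackProg Computability

section Strings

variable {Γ : Finset BoolRel}

/-- The list of constraints of `F`, with the names of the variables in binary. -/
def Formula.raw (F : Formula Γ) : List (RawConstraint Γ (List Bool)) :=
  F.map fun c => (c.rel, (List.ofFn c.args).map encodeNat)

theorem encodeNat_injective : Function.Injective encodeNat := encodingNatBool.encode_injective

theorem wellFormed_raw (F : Formula Γ) : WellFormed F.raw := by
  intro c hc
  obtain ⟨c, -, rfl⟩ := List.mem_map.1 hc
  simp

theorem rawVars_raw (F : Formula Γ) :
    rawVars F.raw = (F.flatMap fun c => List.ofFn c.args).map encodeNat := by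
  simp [rawVars, Formula.raw, List.flatMap_map, List.map_flatMap]

theorem toFinset_rawVars_raw (F : Formula Γ) :
    (rawVars F.raw).toFinset = F.vars.image encodeNat := by
  ext x
  simp [rawVars_raw, Formula.vars]

theorem rawSatisfies_raw {F : Formula Γ} {b : List Bool → Bool} :
    RawSatisfies F.raw b ↔ F.Satisfies fun n => b (encodeNat n) := by
  simp only [RawSatisfies, Formula.raw, List.forall_mem_map, Formula.Satisfies]
  refine forall₂_congr fun c _ => ?_
  unfold PartialConstraint.Holds
  apply iff_of_eq
  congr 1
  funext i
  simp [val]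

theorem rawWeight_raw {F : Formula Γ} {b : List Bool → Bool} :
    rawWeight F.raw b = F.weight fun n => b (encodeNat n) := by
  rw [rawWeight, toFinset_rawVars_raw, Finset.filter_image,
    Finset.card_image_of_injective _ encodeNat_injective, Formula.weight]

theorem rawSolvable_raw_iff {F : Formula Γ} {k : ℕ} :
    RawSolvable F.raw k ↔ (F, k) ∈ MinOnesSAT Γ := by
  constructor
  · rintro ⟨b, h, hk⟩
    exact ⟨_, rawSatisfies_raw.1 h, rawWeight_raw.symm.trans_le hk⟩
  · rintro ⟨a, h, hk⟩
    refine ⟨fun v => a (decodeNat v), ?_, ?_⟩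
    · simpa [rawSatisfies_raw] using h
    · simpa [rawWeight_raw] using hk

/-- The formula with given constraints. -/
def ofRaw (H : List (RawConstraint Γ (List Bool))) : Formula Γ :=
  H.map fun c => ⟨c.1, fun i => decodeNat (c.2.getD i [])⟩

/-- Not every bit string is the binary form of a number, so the round trip requires canonical names.
-/
theorem raw_ofRaw {H : List (RawConstraint Γ (List Bool))} (hH : WellFormed H)
    (hv : ∀ v ∈ rawVars H, encodeNat (decodeNat v) = v) : (ofRaw H).raw = H := by
  rw [Formula.raw, ofRaw, List.map_map]
  refine (List.map_congr_left fun c hc => ?_).trans (List.map_id H)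
  refine Prod.ext rfl (List.ext_getElem (by simp [hH c hc]) fun i h1 (h2 : i < c.2.length) => ?_)
  have : c.2[i] ∈ rawVars H := List.mem_flatMap.2 ⟨c, hc, List.getElem_mem _⟩
  simpa [h2] using hv _ this

/-- The names of the variables of the kernel. -/
def unaryName (n : ℕ) : List Bool := List.replicate n true

theorem unaryName_injective : Function.Injective unaryName := fun m n h => by
  simpa [unaryName] using congrArg List.length h

theorem encodePosNum_decodePosNum_replicate (n : ℕ) :
    encodePosNum (decodePosNum (List.replicate (n + 1) true)) = List.replicate (n + 1) true := by
  induction n with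
  | zero => rfl
  | succ n ih =>
    rw [List.replicate_succ, decodePosNum, if_neg (by simp), encodePosNum, ih]

/-- A string of `n` ones is the canonical binary form of `2 ^ n - 1`. Such names are easy to produce
from unary numbers and their length is still polynomial in `k`. -/
theorem encodeNat_decodeNat_unaryName (n : ℕ) :
    encodeNat (decodeNat (unaryName n)) = unaryName n := by
  cases n with
  | zero => rfl
  | succ n =>
    have h : decodeNum (unaryName (n + 1)) =
        Num.pos (decodePosNum (List.replicate (n + 1) true)) := by
      rw [decodeNum, if_neg (by simp [unaryName])]
      exact PosNum.cast_to_num _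
    rw [decodeNat, encodeNat, Num.of_to_nat, h]
    exact encodePosNum_decodePosNum_replicate n

/-- The string for a list of constraints. -/
def unparse (H : List (RawConstraint Γ (List Bool))) : List (Letter Γ) :=
  H.flatMap fun c => .rel c.1 :: c.2.flatMap fun v => v.map .bit ++ [.sep]

theorem unparse_raw (F : Formula Γ) : unparse F.raw = encodeFormula F := by
  rw [unparse, Formula.raw, List.flatMap_map, encodeFormula]
  congr 1
  funext c
  rw [encodeConstraint, List.flatMap_map]
  rfl

/-- Process a letter, from right to left; the state consists of the constraints and the
variables that have been read. -/
def parseStep (l : Letter Γ) (s : List (RawConstraint Γ (List Bool)) × List (List Bool)) :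
    List (RawConstraint Γ (List Bool)) × List (List Bool) :=
  match l with
  | .rel R => ((R, s.2) :: s.1, [])
  | .bit b => (s.1, (b :: s.2.headD []) :: s.2.tail)
  | .sep => (s.1, [] :: s.2)

/-- The list of constraints given by a string. -/
def parse (w : List (Letter Γ)) : List (RawConstraint Γ (List Bool)) :=
  (w.foldr parseStep ([], [])).1

/-- Read from the right, a separator opens an empty name and the bits before it are prepended one
after the other. -/
theorem foldr_parseStep_encodeVar (n : ℕ)
    (s : List (RawConstraint Γ (List Bool)) × List (List Bool)) :
    (encodeVar Γ n).foldr parseStep s = (s.1, encodeNat n :: s.2) := by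
  have h : ∀ l v : List Bool, (l.map Letter.bit).foldr parseStep (s.1, v :: s.2) =
      (s.1, (l ++ v) :: s.2) := by
    intro l v
    induction l with
    | nil => rfl
    | cons b l ih => rw [List.map_cons, List.foldr_cons, ih]; rfl
  rw [encodeVar, List.foldr_append]
  exact (h (encodeNat n) []).trans (by rw [List.append_nil])

theorem parse_encodeFormula (F : Formula Γ) : parse (encodeFormula F) = F.raw := by
  have h1 : ∀ (l : List ℕ) (s : List (RawConstraint Γ (List Bool)) × List (List Bool)),
      (l.flatMap (encodeVar Γ)).foldr parseStep s = (s.1, l.map encodeNat ++ s.2) := by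
    intro l s
    induction l with
    | nil => rfl
    | cons n l ih =>
      rw [List.flatMap_cons, List.foldr_append, ih, foldr_parseStep_encodeVar]
      rfl
  have h2 : (encodeFormula F).foldr parseStep ([], []) = (F.raw, []) := by
    induction F with
    | nil => rfl
    | cons c F ih =>
      rw [encodeFormula, List.flatMap_cons, List.foldr_append]
      rw [encodeFormula] at ih
      rw [ih, encodeConstraint, List.foldr_cons, h1, List.append_nil]
      rfl
  rw [parse, h2]

theorem length_unparse_le {H : List (RawConstraint Γ (List Bool))} (hH : WellFormed H) {d N : ℕ}
    (hd : ∀ R ∈ Γ, R.arity ≤ d) (hN : ∀ v ∈ rawVars H, v.length ≤ N) :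
    (unparse H).length ≤ H.length * (1 + d * (N + 1)) := by
  rw [unparse, List.length_flatMap]
  refine (List.sum_le_card_nsmul _ (1 + d * (N + 1)) fun n hn => ?_).trans (by simp)
  obtain ⟨c, hc, rfl⟩ := List.mem_map.1 hn
  rw [List.length_cons, List.length_flatMap, Nat.add_comm]
  refine Nat.add_le_add_left ((List.sum_le_card_nsmul _ (N + 1) fun n hn => ?_).trans ?_) 1
  · obtain ⟨v, hv, rfl⟩ := List.mem_map.1 hn
    simpa using hN v (List.mem_flatMap.2 ⟨c, hc, hv⟩)
  · rw [List.length_map, hH c hc, smul_eq_mul]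
    exact Nat.mul_le_mul_right _ (hd _ c.1.2)

theorem card_vars_le_length (F : Formula Γ) : F.vars.card ≤ (encodeFormula F).length := by
  refine (List.toFinset_card_le _).trans ?_
  rw [encodeFormula, List.length_flatMap, List.length_flatMap]
  refine List.sum_le_sum fun c _ => ?_
  rw [encodeConstraint, List.length_cons, List.length_flatMap]
  refine le_trans ?_ (Nat.le_succ _)
  have := List.card_nsmul_le_sum ((List.ofFn c.args).map fun n => (encodeVar Γ n).length) 1
    (by simp [encodeVar])
  simpa using this

/-- The number with a given binary representation, or some lower bound for it that is at
least `L`. -/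
def capped (L : ℕ) (v : List Bool) : ℕ :=
  v.foldr (fun b n => if L ≤ n then n else n + n + (bif b then 1 else 0)) 0

theorem foldr_encodeNat (n : ℕ) :
    (encodeNat n).foldr (fun b n => n + n + (bif b then 1 else 0)) 0 = n := by
  have h : ∀ p : PosNum,
      (encodePosNum p).foldr (fun b n => n + n + (bif b then 1 else 0)) 0 = (p : ℕ) := by
    intro p
    induction p with
    | one => rfl
    | bit0 p ih => rw [encodePosNum, List.foldr_cons, ih]; simp
    | bit1 p ih => rw [encodePosNum, List.foldr_cons, ih]; simp
  conv_rhs => rw [← Num.to_of_nat n]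
  rw [encodeNat]
  cases (n : Num) with
  | zero => rfl
  | pos p => exact h p

/-- Doubling stops as soon as `L` is reached, so the value stays small enough for unary notation. It
is exact if `k < L`, and in any case decides whether `L ≤ k`. -/
theorem capped_encodeNat (L k : ℕ) :
    capped L (encodeNat k) = k ∨ L ≤ capped L (encodeNat k) ∧ L ≤ k := by
  have h : ∀ v : List Bool, capped L v = v.foldr (fun b n => n + n + (bif b then 1 else 0)) 0 ∨
      L ≤ capped L v ∧ L ≤ v.foldr (fun b n => n + n + (bif b then 1 else 0)) 0 := by
    intro v
    induction v with
    | nil => exact .inl rfl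
    | cons b v ih =>
      simp only [capped, List.foldr_cons] at ih ⊢
      split_ifs with hL
      · right
        omega
      · left
        rw [ih.resolve_right fun h => hL h.1]
  simpa only [foldr_encodeNat] using h (encodeNat k)

end Strings

end MinOnes

/-! ### The kernelization -/

namespace MinOnes

open StackProg Computability

section Kernelization

variable {Γ : Finset BoolRel}

/-- The kernel of a formula, as a list of constraints. -/
noncomputable def rawKernel (H : List (RawConstraint Γ (List Bool))) (k : ℕ) :
    List (RawConstraint Γ (List Bool)) :=
  kernel unaryName H (support H k (maxArity Γ)) k

/-- The kernelization. -/
noncomputable def kernelization (x : Formula Γ × ℕ) : Formula Γ × ℕ :=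
  -- In the first case the formula is already bounded by the parameter. In the second, the parameter
  -- is below the input length, so `k + 1` copies of each constraint are affordable.
  if (encodeFormula x.1).length ≤ x.2 then x else (ofRaw (rawKernel x.1.raw x.2), x.2)

theorem kernelization_snd (x : Formula Γ × ℕ) : (kernelization x).2 = x.2 := by
  unfold kernelization
  split_ifs <;> rfl

theorem arity_le_maxArity : ∀ R ∈ Γ, R.arity ≤ maxArity Γ := fun _ h => Finset.le_sup h

theorem raw_ofRaw_rawKernel (F : Formula Γ) (k : ℕ) :
    (ofRaw (rawKernel F.raw k)).raw = rawKernel F.raw k := by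
  refine raw_ofRaw (wellFormed_kernel (wellFormed_raw F)) fun v hv => ?_
  obtain ⟨n, -, rfl⟩ := exists_of_mem_rawVars_kernel hv
  exact encodeNat_decodeNat_unaryName n

theorem mem_minOnesSAT_iff_kernelization (hΓ : ∀ R ∈ Γ, R.Mergeable) (x : Formula Γ × ℕ) :
    x ∈ MinOnesSAT Γ ↔ kernelization x ∈ MinOnesSAT Γ := by
  unfold kernelization
  split_ifs
  · rfl
  · rw [← rawSolvable_raw_iff, ← rawSolvable_raw_iff, raw_ofRaw_rawKernel]
    exact (solvable_kernel_support_iff hΓ unaryName_injective (wellFormed_raw x.1)).symm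

/-- The summand `k` covers the unchanged formula. The product is the number of constraints times the
length of one, whose names have at most `k + 1 + |support|` bits and a separator. -/
theorem length_encodeFormula_kernelization_le {d : ℕ} (hd : d = maxArity Γ) (F : Formula Γ)
    (k : ℕ) : (encodeFormula (kernelization (F, k)).1).length ≤
      k + Γ.card * (k + 1 + Γ.card * (d * (k * d) + 1) ^ d * d * k) ^ d *
        (1 + d * (k + 1 + Γ.card * (d * (k * d) + 1) ^ d * d * k + 1)) := by
  subst hd
  unfold kernelization
  split_ifs with h
  · exact Nat.le_add_right_of_le h
  refine Nat.le_add_left_of_le ?_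
  have hF := wellFormed_raw F
  have hX := length_support_le hF arity_le_maxArity (k := k)
  rw [← unparse_raw, raw_ofRaw_rawKernel]
  refine (length_unparse_le (wellFormed_kernel hF) arity_le_maxArity
    (N := k + 1 + (support F.raw k (maxArity Γ)).length) fun v hv => ?_).trans ?_
  · obtain ⟨n, hn, rfl⟩ := exists_of_mem_rawVars_kernel hv
    simpa [unaryName] using hn.le
  · refine Nat.mul_le_mul ((length_kernel_le hF arity_le_maxArity).trans ?_) ?_
    all_goals gcongr

theorem card_vars_kernelization_le (F : Formula Γ) (k : ℕ) :
    (kernelization (F, k)).1.vars.card ≤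
      (1 + Γ.card * (maxArity Γ * maxArity Γ + 1) ^ maxArity Γ * maxArity Γ) *
        (k + 1) ^ (maxArity Γ + 1) := by
  have h1 : k + 1 ≤ (k + 1) ^ (maxArity Γ + 1) := Nat.le_self_pow (by omega) _
  unfold kernelization
  split_ifs with h
  · calc F.vars.card ≤ (encodeFormula F).length := card_vars_le_length F
      _ ≤ 1 * (k + 1) ^ (maxArity Γ + 1) := by simp only at h; omega
      _ ≤ _ := Nat.mul_le_mul_right _ (Nat.le_add_right _ _)
  · have hX := length_support_le (wellFormed_raw F) arity_le_maxArity (k := k)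
    have h2 : (ofRaw (rawKernel F.raw k)).vars.card ≤
        k + 1 + (support F.raw k (maxArity Γ)).length := by
      rw [← Finset.card_image_of_injective _ encodeNat_injective, ← toFinset_rawVars_raw,
        raw_ofRaw_rawKernel]
      exact card_rawVars_kernel_le
    refine h2.trans ?_
    set d := maxArity Γ
    -- This separates the dependence on `k`: the `d`-th power and the factor `k` from the reachable
    -- sets together give `(k + 1) ^ (d + 1)`.
    have h3 : d * (k * d) + 1 ≤ (d * d + 1) * (k + 1) := by
      ring_nf
      nlinarith [Nat.zero_le (d ^ 2)]
    calc k + 1 + (support F.raw k d).length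
        ≤ (k + 1) ^ (d + 1) + Γ.card * ((d * d + 1) * (k + 1)) ^ d * d * (k + 1) := by
          refine Nat.add_le_add h1 (hX.trans ?_)
          gcongr
          omega
      _ = _ := by rw [mul_pow]; ring

end Kernelization

/-! ### Polynomial running time of the kernelization on strings. -/

section PolyTime

variable {Γ : Finset BoolRel}

instance : Finite (Letter Γ) :=
  Finite.of_injective (β := {R : BoolRel // R ∈ Γ} ⊕ Bool ⊕ Unit)
    (fun
      | .rel R => .inl R
      | .bit b => .inr (.inl b)
      | .sep => .inr (.inr ()))
    fun l l' h => by cases l <;> cases l' <;> simp_all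

noncomputable instance : Enc (Letter Γ) := Enc.ofFinite _

noncomputable instance : Enc (Letter Γ ⊕ Bool) := Enc.ofFinite _

variable {A α : Type} [Enc α]

theorem FP_parse {w : α → List (Letter Γ)} (hw : FP A w) : FP A fun x => parse (w x) := by
  classical
  refine .fst' (.foldr (f := fun _ => parseStep) hw (.const ([], [])) ?_ ?_)
  · refine FP.finite_cases (f := fun l (x : α × Letter Γ × List (RawConstraint Γ (List Bool)) ×
      List (List Bool)) => parseStep l x.2.2) (.fst' .snd) fun l => ?_
    have h1 := FP.fst' (FP.snd' (FP.snd (A := A) (α := α) (β := Letter Γ ×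
      List (RawConstraint Γ (List Bool)) × List (List Bool))))
    have h2 := FP.snd' (FP.snd' (FP.snd (A := A) (α := α) (β := Letter Γ ×
      List (RawConstraint Γ (List Bool)) × List (List Bool))))
    cases l with
    | rel R => exact .pair (.cons (.pair (.const R) h2) h1) .nil
    | bit b => exact .pair h1 (.cons (.cons (.const b) (.headD h2 (.const []))) (.tail h2))
    | sep => exact .pair h1 (.cons (.const []) h2)
  -- One letter adds a bounded number of tree nodes, whatever has been read before, as the fold
  -- requires.
  · refine ⟨Polynomial.C (2 * Fintype.card {R : BoolRel // R ∈ Γ} + 10), fun _ s l => ?_⟩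
    obtain ⟨H, args⟩ := s
    rw [Polynomial.eval_C]
    cases l with
    | rel R =>
      have : size R ≤ _ := size_finite_le R
      simp only [parseStep, size_prod, size_cons, size_nil]
      omega
    | bit b =>
      have := size_bool_le b
      cases args <;> simp [parseStep] <;> omega
    | sep =>
      simp [parseStep]
      omega

theorem FP_unparse {H : α → List (RawConstraint Γ (List Bool))} (hH : FP A H) :
    FP A fun x => unparse (H x) := by
  refine .flatMap (f := fun _ (c : RawConstraint Γ (List Bool)) =>
    Letter.rel c.1 :: c.2.flatMap fun v => v.map .bit ++ [.sep]) hH ?_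
  refine .cons ((FP.of_finite Letter.rel).comp (.fst' .snd)) (.flatMap
    (f := fun _ (v : List Bool) => v.map Letter.bit ++ [Letter.sep]) (.snd' .snd) ?_)
  exact .append (.map (f := fun _ b => Letter.bit b) .snd ((FP.of_finite Letter.bit).comp .snd))
    (.const _)

theorem FP_capped {L : α → ℕ} {v : α → List Bool} (hL : FP A L) (hv : FP A v) :
    FP A fun x => capped (L x) (v x) := by
  have h : FP A fun x : ℕ × List Bool => capped x.1 x.2 := by
    refine .foldr (f := fun (x : ℕ × List Bool) b n =>
      if x.1 ≤ n then n else n + n + (bif b then 1 else 0)) .snd (.const 0) ?_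
      ⟨Polynomial.X + 2, fun x n b => ?_⟩
    · exact .ite (.decide_le (.fst' .fst) (.snd' .snd)) (.snd' .snd)
        (.add (.add (.snd' .snd) (.snd' .snd)) (.cond (.fst' .snd) (.const 1) (.const 0)))
    · split_ifs
      · omega
      · cases b <;> simp [size_prod] <;> omega
  exact h.comp (hL.pair hv)

/-- The string function `f` splits the input into formula and parameter, and uses the capped
parameter in unary both for the length test and for the construction of the kernel. -/
theorem polyTime_kernelization :
    Nonempty (Turing.TM2ComputableInPolyTime
      (encodingProd (formulaEncoding Γ) encodingNatBool).encode
      (encodingProd (formulaEncoding Γ) encodingNatBool).encode kernelization) := by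
  have := Fintype.ofFinite (Letter Γ ⊕ Bool)
  let u (w : List (Letter Γ ⊕ Bool)) := w.filterMap Sum.getLeft?
  let v (w : List (Letter Γ ⊕ Bool)) := w.filterMap Sum.getRight?
  let c (w : List (Letter Γ ⊕ Bool)) := capped (u w).length (v w)
  let f (w : List (Letter Γ ⊕ Bool)) : List (Letter Γ ⊕ Bool) :=
    if (u w).length ≤ c w then w
    else (unparse (rawKernel (parse (u w)) (c w))).map .inl ++ (v w).map .inr
  have hu : FP (Letter Γ ⊕ Bool) u :=
    .filterMap (f := fun _ => Sum.getLeft?) .id ((FP.of_finite Sum.getLeft?).comp .snd)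
  have hv : FP (Letter Γ ⊕ Bool) v :=
    .filterMap (f := fun _ => Sum.getRight?) .id ((FP.of_finite Sum.getRight?).comp .snd)
  have hc : FP (Letter Γ ⊕ Bool) c := FP_capped hu.length hv
  have hname : FP (Letter Γ ⊕ Bool) unaryName := .replicate .id (.const true)
  have hf : FP (Letter Γ ⊕ Bool) f := by
    refine .ite (.decide_le hu.length hc) .id (.append ?_ ?_)
    · exact .map (f := fun _ => Sum.inl)
        (FP_unparse (.kernel hname (FP_parse hu) (.support (FP_parse hu) hc _) hc))
        ((FP.of_finite Sum.inl).comp .snd)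
    · exact .map (f := fun _ => Sum.inr) hv ((FP.of_finite Sum.inr).comp .snd)
  refine polyTime_of_FP hf fun x => ?_
  obtain ⟨F, k⟩ := x
  have henc : ∀ (F : Formula Γ) (k : ℕ), (encodingProd (formulaEncoding Γ) encodingNatBool).encode
      (F, k) = (encodeFormula F).map .inl ++ (encodeNat k).map .inr := fun _ _ => rfl
  have hu' : u ((encodeFormula F).map .inl ++ (encodeNat k).map .inr) = encodeFormula F := by
    simp [u, Function.comp_def]
  have hv' : v ((encodeFormula F).map .inl ++ (encodeNat k).map .inr) = encodeNat k := by
    simp [v, Function.comp_def]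
  rw [henc]
  simp only [f, c, hu', hv', kernelization, parse_encodeFormula]
  have h := capped_encodeNat (encodeFormula F).length k
  by_cases hk : (encodeFormula F).length ≤ k
  · rw [if_pos hk, if_pos (by omega), henc]
  -- In this case the parameter is smaller than the formula, so the capped value is the parameter
  -- itself.
  · have hk' := h.resolve_right fun h => hk h.2
    rw [if_neg hk, if_neg (by omega), henc, hk', ← unparse_raw, raw_ofRaw_rawKernel]

end PolyTime

end MinOnes

theorem mainTheorem1 (Γ : Finset MinOnes.BoolRel) (hΓ : ∀ R ∈ Γ, R.Mergeable) :
    ∃ K : MinOnes.Formula Γ × ℕ → MinOnes.Formula Γ × ℕ,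
      MinOnes.IsPolynomialKernelization (MinOnes.formulaEncoding Γ) (MinOnes.MinOnesSAT Γ) K ∧
      ∃ C : ℕ, ∀ (F : MinOnes.Formula Γ) (k : ℕ),
        (K (F, k)).1.vars.card ≤ C * (k + 1) ^ (MinOnes.maxArity Γ + 1) := by
  refine ⟨MinOnes.kernelization, ⟨MinOnes.polyTime_kernelization,
    MinOnes.mem_minOnesSAT_iff_kernelization hΓ, ?_⟩, _, MinOnes.card_vars_kernelization_le⟩
  obtain ⟨d, hd⟩ : ∃ d, d = MinOnes.maxArity Γ := ⟨_, rfl⟩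
  let D : Polynomial ℕ := Polynomial.C d
  let k : Polynomial ℕ := Polynomial.X
  let N : Polynomial ℕ := Polynomial.C Γ.card
  refine ⟨k + N * (k + 1 + N * (D * (k * D) + 1) ^ d * D * k) ^ d *
    (1 + D * (k + 1 + N * (D * (k * D) + 1) ^ d * D * k + 1)), fun x => ⟨?_, ?_⟩⟩
  · rw [MinOnes.kernelization_snd]
    simp [k]
  · refine (MinOnes.length_encodeFormula_kernelization_le hd x.1 x.2).trans ?_
    simp [k, D, N]
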